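/- Conventions. Let $f\in\mathbb{R}[x,y]$ define a real affine curve $\Gamma=\{f=0\}$ with complexification $\Gamma^{\mathbb{C}}\subset\mathbb{C}^2$. The normal to $\Gamma^{\mathbb C}$ (or $\Gamma$) at a nonsingular point $p$ is the line $f_y(p)(X-x(p))-f_x(p)(Y-y(p))=0$. The curve of normals $N_\Gamma\subset(\mathbb{RP}^2)^\vee$ (resp. $N_\Gamma^{\mathbb C}\subset(\mathbb{CP}^2)^\vee$) is the set of normals of $\Gamma$ at its real points (resp. of $\Gamma^{\mathbb{C}}$), and a tilde denotes its projective (Zariski) closure. The $\mathbb{R}$-degree of $N_\Gamma$ is the supremum of the number of real points of $\tilde N_\Gamma\cap\Lambda$ over all real lines $\Lambda\subset(\mathbb{RP}^2)^\vee$ that meet $\tilde N_\Gamma$ transversally. An arrangement of $d$ lines in $\mathbb{R}^2$ is generic if no two lines are parallel and no three are concurrent; let $G$ be the product of linear equations of its lines. For a real polynomial $H$ with $\deg H\le d$ that vanishes at no node of the arrangement, the curves $G+\varepsilon H=0$ with small $\varepsilon>0$ form a Brusotti smoothing of the arrangement. It is called admissible with respect to a point $z\in\mathbb{R}^2$ if,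 for every node $v$ and every neighbourhood $U$ of $v$, for all sufficiently small $\varepsilon>0$ the curve $G+\varepsilon H=0$ has two distinct real normals through $z$ with feet in $U$. Proposition. Let $d\ge 1$. (1) Generic arrangements of $d$ lines exist. For every generic arrangement of $d$ lines in $\mathbb{R}^2$ there are a point $z\in\mathbb{R}^2$ outside the lines and a Brusotti smoothing $G+\varepsilon H=0$, admissible with respect to $z$, such that for all sufficiently small $\varepsilon>0$ the curve $\Gamma=\{G+\varepsilon H=0\}$ has degree $d$, $\Gamma^{\mathbb C}\subset\mathbb{C}^2$ is nonsingular, exactly $d^2$ complex normals to $\Gamma$ pass through $z$, and all of them are real, that is, all their feet are real points of $\Gamma$. Moreover, $\tilde N_\Gamma^{\mathbb C}$ is a plane curve of degree $d^2$, and the $\mathbb{R}$-degree of $N_\Gamma$ equals $d^2$. (2) Consequently, the maximum of the $\mathbb{R}$-degree of $N_\Gamma$ over all real curves $\Gamma=\{f=0\}$ with $f$ squarefree of degree $d$ equals $d^2$. -/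

import Mathlib

open Filter Topology MvPolynomial
open scoped LinearAlgebra.Projectivization

noncomputable section

namespace PlaneNormals

section Field

variable {K : Type*} [Field K]

/-- A point of the dual projective plane over `K`: the class of `(a, b, c)` is the line
`a * X + b * Y + c = 0` (the line at infinity if `a = b = 0`). -/
abbrev DualPlane (K : Type*) [Field K] : Type _ := ℙ K (Fin 3 → K)

/-- Coefficients of the line through `p` whose direction is the gradient of `f` at `p`, that is,
of `f_y(p) * (X - p 0) - f_x(p) * (Y - p 1) = 0`. It is the zero vector exactly when the gradient
of `f` vanishes at `p`. -/
def normalVector (f : MvPolynomial (Fin 2) K) (p : Fin 2 → K) : Fin 3 → K :=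
  ![eval p (pderiv 1 f), - eval p (pderiv 0 f),
    p 1 * eval p (pderiv 0 f) - p 0 * eval p (pderiv 1 f)]

/-- `ℓ` is the normal to the curve `f = 0` at its nonsingular point `p`. -/
def IsNormalAt (f : MvPolynomial (Fin 2) K) (p : Fin 2 → K) (ℓ : DualPlane K) : Prop :=
  eval p f = 0 ∧ ∃ h : normalVector f p ≠ 0, ℓ = Projectivization.mk K (normalVector f p) h

/-- The (quasi-projective) curve of normals of the affine curve `f = 0`, with `K`-points as feet. -/
def curveOfNormals (f : MvPolynomial (Fin 2) K) : Set (DualPlane K) :=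
  {ℓ | ∃ p, IsNormalAt f p ℓ}

/-- The affine point `z`, as a point `[z 0 : z 1 : 1]` of the projective plane. -/
def toProj (z : Fin 2 → K) : ℙ K (Fin 3 → K) :=
  Projectivization.mk K ![z 0, z 1, 1] (fun h => one_ne_zero (congrFun h 2))

/-- A line of the dual plane: the pencil of all lines passing through the point `w` of the
projective plane. -/
def pencil (w : ℙ K (Fin 3 → K)) : Set (DualPlane K) :=
  {ℓ | Projectivization.orthogonal ℓ w}

/-- The normals of the curve `f = 0` that pass through the affine point `z`. -/
def normalsThrough (f : MvPolynomial (Fin 2) K) (z : Fin 2 → K) : Set (DualPlane K) :=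
  curveOfNormals f ∩ pencil (toProj z)

/-- The polynomials in three variables that vanish on (the affine cone over) `S`. -/
def projIdeal (S : Set (DualPlane K)) : Ideal (MvPolynomial (Fin 3) K) :=
  MvPolynomial.vanishingIdeal K
    {v : Fin 3 → K | ∃ hv : v ≠ 0, Projectivization.mk K v hv ∈ S}

/-- The projective (Zariski) closure of `S`. -/
def projClosure (S : Set (DualPlane K)) : Set (DualPlane K) :=
  {ℓ | ∀ g ∈ projIdeal S, eval ℓ.rep g = 0}

/-- The projective closure of `S` is a plane curve of degree `n`: its ideal is generated by one
nonzero form of degree `n`. -/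
def HasDegree (S : Set (DualPlane K)) (n : ℕ) : Prop :=
  ∃ h : MvPolynomial (Fin 3) K, h ≠ 0 ∧ h.IsHomogeneous n ∧ projIdeal S = Ideal.span {h}

/-- The line `pencil w` meets the projective closure of `S` transversally: at every common point
`ℓ`, the tangent line (direction `t`) of `pencil w` is not contained in the Zariski tangent space
of the closure of `S`. In particular all common points are nonsingular points of this closure. -/
def MeetsTransversally (w : ℙ K (Fin 3 → K)) (S : Set (DualPlane K)) : Prop :=
  ∀ ℓ ∈ projClosure S ∩ pencil w, ∃ g ∈ projIdeal S, ∃ t : Fin 3 → K,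
    t ⬝ᵥ w.rep = 0 ∧ ∑ i, eval ℓ.rep (pderiv i g) * t i ≠ 0

/-- The affine curve `f = 0` has no singular `K`-point. -/
def IsNonsingular (f : MvPolynomial (Fin 2) K) : Prop :=
  ∀ p : Fin 2 → K, eval p f = 0 → ∃ i, eval p (pderiv i f) ≠ 0

end Field

/-- The `ℝ`-degree: the supremum of the number of real intersection points with the real lines
that are transversal to the curve. -/
def realDegree (S : Set (DualPlane ℝ)) : ℕ∞ :=
  ⨆ (w : ℙ ℝ (Fin 3 → ℝ)) (_ : MeetsTransversally w S), (projClosure S ∩ pencil w).encard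

/-- The equation of the complexification of the real curve `f = 0`. -/
def complexify (f : MvPolynomial (Fin 2) ℝ) : MvPolynomial (Fin 2) ℂ :=
  MvPolynomial.map (algebraMap ℝ ℂ) f

/-- A real point as a complex point. -/
def toComplex (z : Fin 2 → ℝ) : Fin 2 → ℂ := fun i => (z i : ℂ)

/-- The linear polynomial `l 0 * X + l 1 * Y + l 2`. -/
def linePoly (l : Fin 3 → ℝ) : MvPolynomial (Fin 2) ℝ :=
  C (l 0) * X 0 + C (l 1) * X 1 + C (l 2)

/-- The lines `L i` (given by their coefficients) form a generic arrangement: no two are parallel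
(or equal) and no three pass through one point. -/
structure IsGenericArrangement {d : ℕ} (L : Fin d → Fin 3 → ℝ) : Prop where
  isLine : ∀ i, L i 0 ≠ 0 ∨ L i 1 ≠ 0
  not_parallel : ∀ i j, i ≠ j → L i 0 * L j 1 - L i 1 * L j 0 ≠ 0
  not_concurrent : ∀ i j k, i ≠ j → i ≠ k → j ≠ k → ∀ v : Fin 2 → ℝ,
    ¬ (eval v (linePoly (L i)) = 0 ∧ eval v (linePoly (L j)) = 0 ∧ eval v (linePoly (L k)) = 0)

/-- The nodes of the arrangement: the points that lie on two different lines of it. -/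
def nodes {d : ℕ} (L : Fin d → Fin 3 → ℝ) : Set (Fin 2 → ℝ) :=
  {v | ∃ i j, i ≠ j ∧ eval v (linePoly (L i)) = 0 ∧ eval v (linePoly (L j)) = 0}

/-- The curve `G + ε H = 0`, where `G` is the product of the equations of the lines. If `H` does
not vanish at the nodes, then for small `ε > 0` this is the smoothing of the arrangement in which,
at each node `v`, the two opposite sectors where `G` has the sign of `H(v)` are glued together. -/
def smoothing {d : ℕ} (L : Fin d → Fin 3 → ℝ) (H : MvPolynomial (Fin 2) ℝ) (ε : ℝ) :
    MvPolynomial (Fin 2) ℝ :=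
  (∏ i, linePoly (L i)) + C ε * H

/-- The smoothing prescribed by `H` is admissible at the node `v` with respect to the point `z`:
the curves `G + ε H = 0` with small `ε > 0` have two different real normals through `z` that are
close to the segment from `z` to `v`, that is, with feet in any given neighbourhood `U` of `v`. -/
def IsAdmissibleAt {d : ℕ} (L : Fin d → Fin 3 → ℝ) (H : MvPolynomial (Fin 2) ℝ)
    (z v : Fin 2 → ℝ) : Prop :=
  ∀ U ∈ 𝓝 v, ∀ᶠ ε in 𝓝[>] (0 : ℝ), ∃ p ∈ U, ∃ q ∈ U, ∃ ℓ ∈ pencil (toProj z),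
    ∃ m ∈ pencil (toProj z), ℓ ≠ m ∧
      IsNormalAt (smoothing L H ε) p ℓ ∧ IsNormalAt (smoothing L H ε) q m

/-- The smoothing of the arrangement prescribed by `H` is an admissible Brusotti smoothing with
respect to `z`: it is of the same degree, smooths every node, and is admissible at every node. -/
structure IsAdmissibleSmoothing {d : ℕ} (L : Fin d → Fin 3 → ℝ) (H : MvPolynomial (Fin 2) ℝ)
    (z : Fin 2 → ℝ) : Prop where
  totalDegree_le : H.totalDegree ≤ d
  ne_zero : ∀ v ∈ nodes L, eval v H ≠ 0
  admissible : ∀ v ∈ nodes L, IsAdmissibleAt L H z v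

/-- All complex normals through the real point `z` to the real curve `f = 0` are real: every foot
of such a normal is a real point of the curve. -/
def AllNormalsReal (f : MvPolynomial (Fin 2) ℝ) (z : Fin 2 → ℝ) : Prop :=
  ∀ p ℓ, IsNormalAt (complexify f) p ℓ → ℓ ∈ pencil (toProj (toComplex z)) →
    ∃ q : Fin 2 → ℝ, p = toComplex q

end PlaneNormals

end

open Filter Topology MvPolynomial
open scoped LinearAlgebra.Projectivization

noncomputable section

/-! Upper bound. The coefficients of the normal at a point are the polynomials `normalPoly f`, of
degree at most `d`. Pulling forms of degree `e` back along this map and reducing modulo `f` lands in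
polynomials of degree at most `d * e` modulo `f`, a space whose dimension grows like `d ^ 2 * e`
(`finrank_forms_le`). Ternary forms grow quadratically in `e`, so some nonzero form vanishes on the
curve of normals. As this curve has no isolated points, Bézout's inequality shows that its ideal is
generated by one form `h` (`exists_projIdeal_eq_span`). Forms modulo `h` grow like `n * e` with `n`
the degree of `h`, hence `n ≤ d ^ 2` (`degree_le_of_projIdeal_eq_span`). A pencil transversal to the
closure is not contained in it, and so meets it in at most `n` points.

Lower bound. The feet of the normals through `z` are the nonsingular common zeros of `f` and
`footPoly f z`. For a perturbed arrangement both have degree at most `d`, and they are coprime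
because their leading forms are (`isRelPrime_footPoly`). By Bézout, over `ℝ` and over `ℂ` alike,
there are at most `d ^ 2` common zeros. It is therefore enough to exhibit `d ^ 2` real nonsingular
feet lying in pairwise different directions from `z`; this is `IsFeetSystem`. Such a system exhausts
the complex feet; it forces smoothness, since a singular point satisfies the foot equation for every
`z`; and it puts `d ^ 2` points of the closure on the pencil of `z`, so that the degree is exactly
`d ^ 2` and the pencil is transversal.

Construction. Take `z` in general position. As `ε → 0`, one foot tends to the foot of the
perpendicular from `z` to each line (`exists_isFootPath_line`) and two feet tend to each node
(`exists_isFootPath_node`): `d + 2 * (d * (d - 1) / 2) = d ^ 2`. Near a node, where the equation is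
`s * t * P + ε * H` in terms of the two linear forms `s` and `t`, rescaling by `√ε` turns the
problem into finding the points of a hyperbola whose normal has the direction of `z - v`. They are
real and nondegenerate for a suitable sign of `H v`, and then the implicit function theorem applies.
The required values of `H` at the nodes are reached by interpolation with products of `d - 2` of the
lines. -/

namespace PlaneNormals

/-! ### Dimensions of spaces of polynomials and forms -/

section Dimension

/-- The pairs of natural numbers with sum at most `e` are a triangular array. -/
theorem two_mul_card_triangle (e : ℕ) :
    2 * Nat.card {p : ℕ × ℕ // p.1 + p.2 ≤ e} = (e + 1) * (e + 2) := by
  have h : {p : ℕ × ℕ | p.1 + p.2 ≤ e} =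
      ((Finset.range (e + 1)).biUnion fun k => Finset.HasAntidiagonal.antidiagonal k :
        Finset (ℕ × ℕ)) := by
    ext p
    simp
  have h2 : Nat.card {p : ℕ × ℕ // p.1 + p.2 ≤ e} = ∑ k ∈ Finset.range (e + 1), (k + 1) := by
    change Nat.card ({p : ℕ × ℕ | p.1 + p.2 ≤ e} : Set (ℕ × ℕ)) = _
    rw [h]
    simp only [Nat.card_eq_fintype_card, Fintype.card_coe, Finset.coe_sort_coe]
    rw [Finset.card_biUnion]
    · simp
    · intro i _ j _ hij
      rw [Function.onFun, Finset.disjoint_left]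
      intro p hp hq
      simp only [Finset.HasAntidiagonal.mem_antidiagonal] at hp hq
      omega
  rw [h2]
  clear h h2
  induction e with
  | zero => simp
  | succ e ih => rw [Finset.sum_range_succ, mul_add, ih]; ring

variable (K : Type*) [Field K]

theorem two_mul_finrank_restrictTotalDegree (e : ℕ) :
    2 * Module.finrank K (restrictTotalDegree (Fin 2) K e) = (e + 1) * (e + 2) := by
  refine .trans ?_ (two_mul_card_triangle e)
  rw [restrictTotalDegree, Module.finrank_eq_nat_card_basis
    (basisRestrictSupport K {n : Fin 2 →₀ ℕ | (n.sum fun _ i => i) ≤ e})]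
  congr 1
  refine Nat.card_congr ((Finsupp.equivFunOnFinite.trans (finTwoArrowEquiv ℕ)).subtypeEquiv ?_)
  intro n
  simp [Finsupp.sum_fintype]

/-- The third exponent is determined by the other two, so the count is that of affine polynomials of
degree at most `e`. The equal dimensions let a single Bézout argument serve the affine and the
projective plane. -/
theorem two_mul_finrank_homogeneousSubmodule (e : ℕ) :
    2 * Module.finrank K (homogeneousSubmodule (Fin 3) K e) = (e + 1) * (e + 2) := by
  refine .trans ?_ (two_mul_card_triangle e)
  rw [homogeneousSubmodule_eq_finsupp_supported]
  change 2 * Module.finrank K (restrictSupport K {n : Fin 3 →₀ ℕ | n.degree = e}) = _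
  rw [Module.finrank_eq_nat_card_basis
    (basisRestrictSupport K {n : Fin 3 →₀ ℕ | n.degree = e})]
  congr 1
  refine Nat.card_congr
    { toFun := fun n => ⟨(n.1 0, n.1 1), ?_⟩
      invFun := fun p => ⟨Finsupp.equivFunOnFinite.symm ![p.1.1, p.1.2, e - (p.1.1 + p.1.2)], ?_⟩
      left_inv := ?_
      right_inv := ?_ }
  · have := n.2
    simp only [Set.mem_ofPred_eq, Finsupp.degree_eq_sum, Fin.sum_univ_three] at this
    simp only
    omega
  · have := p.2
    simp only [Set.mem_ofPred_eq, Finsupp.degree_eq_sum, Fin.sum_univ_three]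
    simp
    omega
  · rintro ⟨n, hn⟩
    simp only [Set.mem_ofPred_eq, Finsupp.degree_eq_sum, Fin.sum_univ_three] at hn
    ext i
    fin_cases i <;> simp
    omega
  · rintro ⟨⟨a, b⟩, h⟩
    simp

instance (e : ℕ) : FiniteDimensional K (homogeneousSubmodule (Fin 3) K e) := by
  refine Module.finite_of_finrank_pos ?_
  have := two_mul_finrank_homogeneousSubmodule K e
  by_contra h
  have h0 : Module.finrank K (homogeneousSubmodule (Fin 3) K e) = 0 := by omega
  rw [h0] at this
  simp at this

end Dimension

/-! ### Bézout's inequality, abstract and affine -/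

section Bezout

variable {K : Type*} [Field K]

/-- **Bézout's inequality** for an exhaustive family of subspaces `V e` whose dimensions are those
of the spaces of ternary forms of degree `e`. -/
theorem card_le_mul_of_isRelPrime {R : Type*} [CommRing R] [IsDomain R] [DecompositionMonoid R]
    [Algebra K R] (V : ℕ → Submodule K R) [∀ e, FiniteDimensional K (V e)]
    (hV : ∀ e, 2 * Module.finrank K (V e) = (e + 1) * (e + 2)) {f g : R} {m n : ℕ}
    (hf0 : f ≠ 0) (hf : ∀ e a, f * a ∈ V (e + m) ↔ a ∈ V e)
    (hg : ∀ e a, g * a ∈ V (e + n) ↔ a ∈ V e) (hfg : IsRelPrime f g)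
    {ι : Type*} [Fintype ι] (ev : ι → R →ₗ[K] K) (hevf : ∀ i a, ev i (f * a) = 0)
    (hevg : ∀ i a, ev i (g * a) = 0)
    (hsep : ∃ e₀, ∀ e, e₀ ≤ e → ∀ i, ∃ a ∈ V e, ev i a ≠ 0 ∧ ∀ j, j ≠ i → ev j a = 0) :
    Fintype.card ι ≤ m * n := by
  classical
  obtain ⟨e, he⟩ := hsep
  let N := e + m + n
  have hNf : ∀ a ∈ V (e + n), f * a ∈ V N := fun a ha => by
    have : N = (e + n) + m := by omega
    rw [this]; exact (hf _ _).2 ha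
  have hNg : ∀ a ∈ V (e + m), g * a ∈ V N := fun a ha => (hg _ _).2 ha
  -- The degree `N` part of the ideal `(f, g)` is the range of `Θ`. It lies in the kernel of
  -- evaluation at the given points, which is onto by the separation hypothesis; so the number of
  -- points is at most the codimension of this range.
  let Θ : (V (e + n) × V (e + m)) →ₗ[K] V N :=
    (LinearMap.restrict (LinearMap.mulLeft K f) hNf).coprod
      (LinearMap.restrict (LinearMap.mulLeft K g) hNg)
  have hΘ : ∀ x, (Θ x : R) = f * x.1 + g * x.2 := fun x => rfl
  let E : V N →ₗ[K] (ι → K) := (LinearMap.pi ev).comp (V N).subtype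
  have hE : ∀ x i, E x i = ev i x := fun x i => rfl
  have hEsurj : Function.Surjective E := by
    rw [← LinearMap.range_eq_top, eq_top_iff, ← (Pi.basisFun K ι).span_eq, Submodule.span_le]
    rintro _ ⟨i, rfl⟩
    obtain ⟨a, haV, hai, haj⟩ := he N (by omega) i
    refine ⟨(ev i a)⁻¹ • ⟨a, haV⟩, ?_⟩
    ext j
    rw [map_smul, Pi.smul_apply, hE, Pi.basisFun_apply]
    rcases eq_or_ne j i with rfl | hji
    · simp [hai]
    · simp [haj j hji, hji]
  -- By coprimality the only relations between `f` and `g` are the trivial ones `f * (g * c) = g *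
  -- (f * c)`, with `c` in `V e`.
  have hker : Module.finrank K (LinearMap.ker Θ) ≤ Module.finrank K (V e) := by
    have key : ∀ x : LinearMap.ker Θ, ∃ c : V e, (x.1.1 : R) = g * c ∧ (x.1.2 : R) = - (f * c) := by
      rintro ⟨⟨⟨a, ha⟩, ⟨b, hb⟩⟩, hx⟩
      have h0 : f * a + g * b = 0 := by
        have := congrArg Subtype.val (LinearMap.mem_ker.1 hx)
        rwa [hΘ] at this
      have hdvd : f ∣ b := hfg.dvd_of_dvd_mul_left ⟨-a, by linear_combination h0⟩
      obtain ⟨c, rfl⟩ := hdvd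
      refine ⟨⟨-c, neg_mem ((hf _ _).1 hb)⟩, ?_, by simp⟩
      have : f * (a + g * c) = 0 := by linear_combination h0
      rcases mul_eq_zero.1 this with h | h
      · exact absurd h hf0
      · simp only; linear_combination h
    let φ : V e →ₗ[K] R := (LinearMap.mulLeft K f).comp (V e).subtype
    let ψ : LinearMap.ker Θ →ₗ[K] R :=
      (-((V (e + m)).subtype.comp (LinearMap.snd K _ _))).comp (LinearMap.ker Θ).subtype
    have hψ : Function.Injective ψ := by
      intro x y hxy
      obtain ⟨c, h1, h2⟩ := key x
      obtain ⟨c', h1', h2'⟩ := key y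
      have hxy' : -(x.1.2 : R) = -(y.1.2 : R) := hxy
      rw [h2, h2', neg_neg, neg_neg] at hxy'
      rw [mul_left_cancel₀ hf0 hxy', ← h1'] at h1
      rw [hxy', ← h2'] at h2
      exact Subtype.ext (Prod.ext (Subtype.ext h1) (Subtype.ext h2))
    have hle : LinearMap.range ψ ≤ LinearMap.range φ := by
      rintro _ ⟨x, rfl⟩
      obtain ⟨c, h1, h2⟩ := key x
      exact ⟨c, by change f * (c : R) = -(x.1.2 : R); rw [h2, neg_neg]⟩
    calc Module.finrank K (LinearMap.ker Θ) = Module.finrank K (LinearMap.range ψ) :=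
          (LinearMap.finrank_range_of_inj hψ).symm
      _ ≤ Module.finrank K (LinearMap.range φ) := Submodule.finrank_mono hle
      _ ≤ Module.finrank K (V e) := LinearMap.finrank_range_le φ
  have hrange : LinearMap.range Θ ≤ LinearMap.ker E := by
    rintro _ ⟨x, rfl⟩
    rw [LinearMap.mem_ker]
    ext i
    rw [hE, hΘ, map_add, hevf, hevg, add_zero, Pi.zero_apply]
  have h1 := LinearMap.finrank_range_add_finrank_ker Θ
  have h2 := LinearMap.finrank_range_add_finrank_ker E
  rw [LinearMap.range_eq_top.2 hEsurj, finrank_top, Module.finrank_pi] at h2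
  rw [Module.finrank_prod] at h1
  have h3 := Submodule.finrank_mono hrange
  have a1 := hV e
  have a2 := hV (e + n)
  have a3 := hV (e + m)
  have a4 := hV (e + m + n)
  change Fintype.card ι + _ = Module.finrank K (V (e + m + n)) at h2
  -- The second difference `q (e + m + n) - q (e + m) - q (e + n) + q e` of `q e = (e + 1) * (e + 2)
  -- / 2` equals `m * n`.
  nlinarith

/-- The set of common zeros of two coprime plane curves is finite, and its cardinality is at most
the product of the degrees. -/
theorem encard_commonZeros_le {f g : MvPolynomial (Fin 2) K} (hf : f ≠ 0) (hg : g ≠ 0)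
    (hfg : IsRelPrime f g) :
    {p : Fin 2 → K | eval p f = 0 ∧ eval p g = 0}.encard ≤
      ((f.totalDegree * g.totalDegree : ℕ) : ℕ∞) := by
  classical
  by_contra! hlt
  obtain ⟨t, htZ, htcard⟩ := Set.exists_subset_encard_eq (Order.add_one_le_of_lt hlt)
  have htfin : t.Finite := Set.finite_of_encard_le_coe (k := f.totalDegree * g.totalDegree + 1)
    (by rw [htcard]; simp)
  have : Fintype t := htfin.fintype
  have hmem : ∀ {h : MvPolynomial (Fin 2) K}, h ≠ 0 → ∀ e a,
      h * a ∈ restrictTotalDegree (Fin 2) K (e + h.totalDegree) ↔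
        a ∈ restrictTotalDegree (Fin 2) K e := by
    intro h hh e a
    rw [mem_restrictTotalDegree, mem_restrictTotalDegree]
    by_cases ha : a = 0
    · simp [ha]
    · rw [totalDegree_mul_of_isDomain hh ha]; omega
  have key := card_le_mul_of_isRelPrime (K := K) (fun e => restrictTotalDegree (Fin 2) K e)
    (two_mul_finrank_restrictTotalDegree K) hf (hmem hf) (hmem hg) hfg
    (fun p : t => (aeval (R := K) p.1).toLinearMap)
    (fun p a => by simp [aeval_eq_eval, (htZ p.2).1])
    (fun p a => by simp [aeval_eq_eval, (htZ p.2).2])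
    ⟨Fintype.card t, fun e he p => by
      have hne : ∀ q : Fin 2 → K, q ≠ p.1 → ∃ i, p.1 i ≠ q i := fun q hq => by
        by_contra! h
        exact hq (funext fun i => (h i).symm)
      choose! i hi using hne
      -- One factor for each other point `q`, in a coordinate where `q` differs from `p`; the number
      -- of points is therefore a sufficient degree.
      refine ⟨∏ q ∈ Finset.univ.erase p, (X (i q.1) - C (q.1 (i q.1))), ?_, ?_, ?_⟩
      · rw [mem_restrictTotalDegree]
        refine (totalDegree_finsetProd _ _).trans ((Finset.sum_le_card_nsmul _ _ 1 ?_).trans ?_)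
        · intro q _
          refine (totalDegree_sub _ _).trans ?_
          simp
        · rw [smul_eq_mul, mul_one]
          exact (Finset.card_le_univ _).trans he
      · simp only [AlgHom.toLinearMap_apply, map_prod, map_sub, aeval_X, aeval_C]
        rw [Finset.prod_ne_zero_iff]
        intro q hq
        exact sub_ne_zero.2 (hi q.1 fun h => (Finset.ne_of_mem_erase hq) (Subtype.ext h))
      · intro q hq
        simp only [AlgHom.toLinearMap_apply, map_prod, map_sub, aeval_X, aeval_C]
        exact Finset.prod_eq_zero (Finset.mem_erase.2 ⟨hq, Finset.mem_univ _⟩) (by simp)⟩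
  have h2 : (Fintype.card t : ℕ∞) = ((f.totalDegree * g.totalDegree : ℕ) : ℕ∞) + 1 := by
    rw [← htcard, ← Set.coe_fintypeCard]
  have h3 : Fintype.card t = f.totalDegree * g.totalDegree + 1 := by exact_mod_cast h2
  omega

end Bezout

/-! ### Grading through the substitution `x ↦ t x` -/

section Dilate

variable {σ : Type*} {K : Type*} [Field K]

/-- The substitution `x ↦ t x`, as a polynomial in `t`. -/
def dilate : MvPolynomial σ K →ₐ[K] Polynomial (MvPolynomial σ K) :=
  aeval fun i => Polynomial.C (X i) * Polynomial.X

theorem dilate_of_isHomogeneous {p : MvPolynomial σ K} {n : ℕ} (hp : p.IsHomogeneous n) :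
    dilate p = Polynomial.C p * Polynomial.X ^ n := by
  have hmon : ∀ s ∈ p.support, dilate (monomial s (coeff s p)) =
      Polynomial.C (monomial s (coeff s p)) * Polynomial.X ^ n := by
    intro s hs
    rw [dilate, aeval_monomial, monomial_eq (s := s)]
    simp only [mul_pow, Finsupp.prod, Finset.prod_mul_distrib, Finset.prod_pow_eq_pow_sum, map_mul,
      map_prod, map_pow]
    rw [hp.degree_eq_sum_deg_support hs, mul_assoc]
    rfl
  conv_lhs => rw [p.as_sum]
  conv_rhs => rw [p.as_sum]
  rw [map_sum, map_sum, Finset.sum_mul]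
  exact Finset.sum_congr rfl hmon

theorem dilate_eq_sum (p : MvPolynomial σ K) :
    dilate p = ∑ i ∈ Finset.range (p.totalDegree + 1),
      Polynomial.C (homogeneousComponent i p) * Polynomial.X ^ i := by
  conv_lhs => rw [← sum_homogeneousComponent p]
  rw [map_sum]
  exact Finset.sum_congr rfl fun i _ =>
    dilate_of_isHomogeneous (homogeneousComponent_isHomogeneous i p)

theorem coeff_dilate (p : MvPolynomial σ K) (m : ℕ) :
    (dilate p).coeff m = homogeneousComponent m p := by
  rw [dilate_eq_sum, Polynomial.finsetSum_coeff]
  simp only [Polynomial.coeff_C_mul_X_pow]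
  rw [Finset.sum_ite_eq]
  split_ifs with h
  · rfl
  · rw [homogeneousComponent_eq_zero]
    simpa using h

theorem eval_one_dilate (p : MvPolynomial σ K) : (dilate p).eval 1 = p := by
  rw [dilate_eq_sum, Polynomial.eval_finsetSum]
  simp [sum_homogeneousComponent]

theorem dilate_ne_zero {p : MvPolynomial σ K} (hp : p ≠ 0) : dilate p ≠ 0 := fun h =>
  hp (by rw [← eval_one_dilate p, h, Polynomial.eval_zero])

theorem natDegree_dilate_le (p : MvPolynomial σ K) : (dilate p).natDegree ≤ p.totalDegree := by
  rw [Polynomial.natDegree_le_iff_coeff_eq_zero]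
  intro m hm
  rw [coeff_dilate, homogeneousComponent_eq_zero _ _ hm]

theorem isHomogeneous_of_natTrailingDegree_eq {p : MvPolynomial σ K}
    (h : (dilate p).natTrailingDegree = (dilate p).natDegree) :
    p.IsHomogeneous (dilate p).natDegree := by
  have hp : p = homogeneousComponent (dilate p).natDegree p := by
    conv_lhs => rw [← eval_one_dilate p]
    rw [← coeff_dilate, Polynomial.eval_eq_sum_range]
    simp only [one_pow, mul_one]
    refine Finset.sum_eq_single _ ?_ ?_
    · intro i hi hne
      refine Polynomial.coeff_eq_zero_of_lt_natTrailingDegree ?_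
      rw [h]
      exact lt_of_le_of_ne (by simpa [Nat.lt_succ_iff] using hi) hne
    · simp
  rw [hp]
  convert homogeneousComponent_isHomogeneous (dilate p).natDegree p
  exact hp.symm

/-- The factors of a nonzero form are forms. -/
theorem isHomogeneous_of_mul {p q : MvPolynomial σ K} {n : ℕ} (h : (p * q).IsHomogeneous n)
    (h0 : p * q ≠ 0) :
    ∃ i j, i + j = n ∧ p.IsHomogeneous i ∧ q.IsHomogeneous j := by
  have hp := dilate_ne_zero (left_ne_zero_of_mul h0)
  have hq := dilate_ne_zero (right_ne_zero_of_mul h0)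
  have hd := dilate_of_isHomogeneous h
  have hC : Polynomial.C (p * q) ≠ 0 := Polynomial.C_ne_zero.2 h0
  have h1 : (dilate (p * q)).natDegree = n := by
    rw [hd, Polynomial.natDegree_C_mul_X_pow n _ h0]
  have h2 : (dilate (p * q)).natTrailingDegree = n := by
    rw [hd, Polynomial.C_mul_X_pow_eq_monomial, Polynomial.natTrailingDegree_monomial h0]
  rw [map_mul, Polynomial.natDegree_mul hp hq] at h1
  rw [map_mul, Polynomial.natTrailingDegree_mul hp hq] at h2
  -- Degrees and trailing degrees in `t` both add up to `n`, and each trailing degree is at most the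
  -- corresponding degree, so they agree for each factor.
  have h3 := Polynomial.natTrailingDegree_le_natDegree (dilate p)
  have h4 := Polynomial.natTrailingDegree_le_natDegree (dilate q)
  exact ⟨_, _, h1, isHomogeneous_of_natTrailingDegree_eq (by omega),
    isHomogeneous_of_natTrailingDegree_eq (by omega)⟩

theorem mul_mem_homogeneousSubmodule_iff {p a : MvPolynomial σ K} {m e : ℕ}
    (hp : p.IsHomogeneous m) (hp0 : p ≠ 0) :
    p * a ∈ homogeneousSubmodule σ K (e + m) ↔ a ∈ homogeneousSubmodule σ K e := by
  rw [mem_homogeneousSubmodule, mem_homogeneousSubmodule]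
  constructor
  · intro h
    rcases eq_or_ne a 0 with rfl | ha
    · exact isHomogeneous_zero _ _ _
    · obtain ⟨i, j, hij, hi, hj⟩ := isHomogeneous_of_mul h (mul_ne_zero hp0 ha)
      have := hi.inj_right hp hp0
      obtain rfl : j = e := by omega
      exact hj
  · intro h
    rw [add_comm]
    exact hp.mul h

theorem eval_smul_of_isHomogeneous {p : MvPolynomial σ K} {m : ℕ}
    (hp : p.IsHomogeneous m) (c : K) (v : σ → K) : eval (c • v) p = c ^ m * eval v p := by
  rw [eval_eq, eval_eq, Finset.mul_sum]
  refine Finset.sum_congr rfl fun s hs => ?_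
  simp only [Pi.smul_apply, smul_eq_mul, mul_pow, Finset.prod_mul_distrib,
    Finset.prod_pow_eq_pow_sum]
  have h : s.degree = m := hp.degree_eq_sum_deg_support hs |>.symm
  rw [show ∑ i ∈ s.support, s i = m from h]
  ring

end Dilate

/-! ### Linear forms and the projective Bézout inequality -/

section LinForm

variable {K : Type*} [Field K]

/-- The linear form with coefficients `u`. -/
def linForm (u : Fin 3 → K) : MvPolynomial (Fin 3) K := ∑ i, C (u i) * X i

theorem eval_linForm (u v : Fin 3 → K) : eval v (linForm u) = v ⬝ᵥ u := by
  simp [linForm, dotProduct, mul_comm]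

theorem isHomogeneous_linForm (u : Fin 3 → K) : (linForm u).IsHomogeneous 1 := by
  refine IsHomogeneous.sum _ _ _ fun i _ => ?_
  simpa using (isHomogeneous_C (Fin 3) (u i)).mul (isHomogeneous_X K i)

/-- The cross product of representatives is nonzero, say in coordinate `i`. Then `u = q × e_i` kills
`q`, while `p ⬝ u` is that coordinate of `p × q`. -/
theorem exists_linear_separating {p q : ℙ K (Fin 3 → K)} (h : p ≠ q) :
    ∃ u : Fin 3 → K, p.rep ⬝ᵥ u ≠ 0 ∧ q.rep ⬝ᵥ u = 0 := by
  have hc : crossProduct p.rep q.rep ≠ 0 := by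
    rw [ne_eq, ← Projectivization.mk_eq_mk_iff_crossProduct_eq_zero p.rep_nonzero q.rep_nonzero,
      p.mk_rep, q.mk_rep]
    exact h
  obtain ⟨i, hi⟩ := Function.ne_iff.1 hc
  refine ⟨crossProduct q.rep (Pi.single i 1), ?_, dot_self_cross _ _⟩
  rw [triple_product_permutation, triple_product_permutation, single_one_dotProduct]
  exact hi

end LinForm

section Bezout

variable {K : Type*} [Field K]

/-- Coprime ternary forms of degrees `m` and `n` have at most `m * n` common zeros in the projective
plane. -/
theorem encard_projective_commonZeros_le {f g : MvPolynomial (Fin 3) K} {m n : ℕ} (hf : f ≠ 0)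
    (hg : g ≠ 0) (hfm : f.IsHomogeneous m) (hgn : g.IsHomogeneous n) (hfg : IsRelPrime f g) :
    {p : ℙ K (Fin 3 → K) | eval p.rep f = 0 ∧ eval p.rep g = 0}.encard ≤ ((m * n : ℕ) : ℕ∞) := by
  classical
  by_contra! hlt
  obtain ⟨t, htZ, htcard⟩ := Set.exists_subset_encard_eq (Order.add_one_le_of_lt hlt)
  have htfin : t.Finite := Set.finite_of_encard_le_coe (k := m * n + 1)
    (by rw [htcard]; simp)
  have : Fintype t := htfin.fintype
  have key := card_le_mul_of_isRelPrime (K := K) (fun e => homogeneousSubmodule (Fin 3) K e)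
    (two_mul_finrank_homogeneousSubmodule K) hf
    (fun e a => mul_mem_homogeneousSubmodule_iff hfm hf)
    (fun e a => mul_mem_homogeneousSubmodule_iff hgn hg) hfg
    (fun p : t => (aeval (R := K) p.1.rep).toLinearMap)
    (fun p a => by simp [aeval_eq_eval, (htZ p.2).1])
    (fun p a => by simp [aeval_eq_eval, (htZ p.2).2])
    ⟨Fintype.card t, fun e he p => by
      have hne : ∀ q : ℙ K (Fin 3 → K), p.1 ≠ q → ∃ u, p.1.rep ⬝ᵥ u ≠ 0 ∧ q.rep ⬝ᵥ u = 0 :=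
        fun q hq => exists_linear_separating hq
      choose! u hu hu' using hne
      obtain ⟨u₀, hu₀⟩ : ∃ u₀ : Fin 3 → K, p.1.rep ⬝ᵥ u₀ ≠ 0 := by
        by_contra! h
        exact p.1.rep_nonzero (dotProduct_eq_zero _ h)
      -- The power of a linear form not vanishing at `p` pads the product to degree exactly `e`.
      refine ⟨(∏ q ∈ Finset.univ.erase p, linForm (u q.1)) *
        linForm u₀ ^ (e - (Finset.univ.erase p).card), ?_, ?_, ?_⟩
      · rw [mem_homogeneousSubmodule]
        have h1 := IsHomogeneous.prod (Finset.univ.erase p) (fun q : t => linForm (u q.1))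
          (fun _ => 1) (fun q _ => isHomogeneous_linForm _)
        have h2 := h1.mul ((isHomogeneous_linForm u₀).pow (e - (Finset.univ.erase p).card))
        have h3 : (Finset.univ.erase p).card ≤ e := (Finset.card_le_univ _).trans he
        convert h2
        simp only [Finset.sum_const, smul_eq_mul, mul_one, one_mul]
        omega
      · change eval p.1.rep _ ≠ 0
        simp only [map_mul, map_prod, map_pow, eval_linForm]
        refine mul_ne_zero (Finset.prod_ne_zero_iff.2 fun q hq => ?_) (pow_ne_zero _ hu₀)
        exact hu q.1 fun h => (Finset.ne_of_mem_erase hq) (Subtype.ext h.symm)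
      · intro q hq
        change eval q.1.rep _ = 0
        simp only [map_mul, map_prod, map_pow, eval_linForm]
        refine mul_eq_zero_of_left
          (Finset.prod_eq_zero (Finset.mem_erase.2 ⟨hq, Finset.mem_univ _⟩) ?_) _
        exact hu' q.1 fun h => hq (Subtype.ext h.symm)⟩
  have h2 : (Fintype.card t : ℕ∞) = ((m * n : ℕ) : ℕ∞) + 1 := by
    rw [← htcard, ← Set.coe_fintypeCard]
  have h3 : Fintype.card t = m * n + 1 := by exact_mod_cast h2
  omega

end Bezout

/-! ### The ideal of a set without isolated points is principal -/

section ProjIdeal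

variable {K : Type*} [Field K]

theorem mem_projIdeal_iff {S : Set (DualPlane K)} {g : MvPolynomial (Fin 3) K} :
    g ∈ projIdeal S ↔
      ∀ (v : Fin 3 → K) (hv : v ≠ 0), Projectivization.mk K v hv ∈ S → eval v g = 0 := by
  rw [projIdeal, mem_vanishingIdeal_iff]
  exact ⟨fun h v hv hS => h v ⟨hv, hS⟩, fun h v ⟨hv, hS⟩ => h v hv hS⟩

theorem eval_rep_mk_eq_zero_iff {g : MvPolynomial (Fin 3) K} {n : ℕ} (hg : g.IsHomogeneous n)
    (v : Fin 3 → K) (hv : v ≠ 0) :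
    eval (Projectivization.mk K v hv).rep g = 0 ↔ eval v g = 0 := by
  obtain ⟨a, ha⟩ := Projectivization.exists_smul_eq_mk_rep K v hv
  rw [← ha, Units.smul_def, eval_smul_of_isHomogeneous hg]
  simp

theorem mem_projIdeal_iff_of_isHomogeneous {S : Set (DualPlane K)} {g : MvPolynomial (Fin 3) K}
    {n : ℕ} (hg : g.IsHomogeneous n) : g ∈ projIdeal S ↔ ∀ ℓ ∈ S, eval ℓ.rep g = 0 := by
  rw [mem_projIdeal_iff]
  constructor
  · intro h ℓ hℓ
    exact h ℓ.rep ℓ.rep_nonzero (by rwa [ℓ.mk_rep])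
  · intro h v hv hS
    exact (eval_rep_mk_eq_zero_iff hg v hv).1 (h _ hS)

theorem eval_eval_dilate {σ : Type*} (v : σ → K) (t : K) (g : MvPolynomial σ K) :
    ((dilate g).map (eval v)).eval t = eval (t • v) g := by
  have : ((Polynomial.evalRingHom t).comp ((Polynomial.mapRingHom (eval v)).comp
      (dilate : MvPolynomial σ K →ₐ[K] _).toRingHom)) = eval (t • v) := by
    refine MvPolynomial.ringHom_ext (fun r => ?_) (fun i => ?_)
    · simp [dilate, Polynomial.algebraMap_apply, algebraMap_eq]
    · simp [dilate, mul_comm t]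
  exact congrArg (fun φ : MvPolynomial σ K →+* K => φ g) this

/-- On each line of the cone over `S`, `g (t • v)` is a polynomial in `t` vanishing for all `t ≠ 0`,
hence zero; its coefficients are the values of the homogeneous components. -/
theorem homogeneousComponent_mem_projIdeal [Infinite K] {S : Set (DualPlane K)}
    {g : MvPolynomial (Fin 3) K} (hg : g ∈ projIdeal S) (k : ℕ) :
    homogeneousComponent k g ∈ projIdeal S := by
  rw [mem_projIdeal_iff] at hg ⊢
  intro v hv hS
  have h0 : (dilate g).map (eval v) = 0 := by
    refine Polynomial.eq_zero_of_infinite_isRoot _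
      ((Set.finite_singleton (0 : K)).infinite_compl.mono fun t ht => ?_)
    have ht0 : t ≠ 0 := ht
    change Polynomial.eval t _ = 0
    rw [eval_eval_dilate]
    refine hg _ (smul_ne_zero ht0 hv) ?_
    convert hS using 1
    rw [Projectivization.mk_eq_mk_iff']
    exact ⟨t, rfl⟩
  rw [← coeff_dilate, ← Polynomial.coeff_map, h0, Polynomial.coeff_zero]

theorem mem_of_homogeneousComponent_mem {σ : Type*} {I : Ideal (MvPolynomial σ K)}
    {g : MvPolynomial σ K} (h : ∀ k, homogeneousComponent k g ∈ I) : g ∈ I := by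
  rw [← sum_homogeneousComponent g]
  exact sum_mem fun k _ => h k

/-- No point of `S` is isolated, in the weak sense that every form that does not vanish at some
point of `S` does not vanish at infinitely many points of `S`. -/
def HasNoIsolatedPoint (S : Set (DualPlane K)) : Prop :=
  ∀ (n : ℕ) (q : MvPolynomial (Fin 3) K), q.IsHomogeneous n → ∀ ℓ ∈ S, eval ℓ.rep q ≠ 0 →
    {m | m ∈ S ∧ eval m.rep q ≠ 0}.Infinite

/-- Let `h` be a nonzero form of least degree in the ideal and `g'` another form in it; write `h = c
* a`, `g' = c * b` with `a`, `b` coprime. If `a` were not constant, then `c` would not be in the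
ideal, by minimality. So infinitely many points of `S` would lie off `c = 0`, all of them common
zeros of `a` and `b`, against Bézout. No decomposition into components is needed. -/
theorem exists_projIdeal_eq_span [Infinite K] {S : Set (DualPlane K)} (hS : HasNoIsolatedPoint S)
    (h0 : projIdeal S ≠ ⊥) :
    ∃ (n : ℕ) (h : MvPolynomial (Fin 3) K),
      h ≠ 0 ∧ h.IsHomogeneous n ∧ projIdeal S = Ideal.span {h} := by
  classical
  have hex : ∃ n, ∃ h : MvPolynomial (Fin 3) K, h ≠ 0 ∧ h.IsHomogeneous n ∧ h ∈ projIdeal S := by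
    obtain ⟨g, hg, hg0⟩ := Submodule.exists_mem_ne_zero_of_ne_bot h0
    have : ∃ k, homogeneousComponent k g ≠ 0 := by
      by_contra! hk
      exact hg0 (by rw [← sum_homogeneousComponent g, Finset.sum_eq_zero fun k _ => hk k])
    obtain ⟨k, hk⟩ := this
    exact ⟨k, _, hk, homogeneousComponent_isHomogeneous k g,
      homogeneousComponent_mem_projIdeal hg k⟩
  obtain ⟨h, hh0, hhn, hhI⟩ := Nat.find_spec hex
  have hmin := fun m hm => Nat.find_min hex (m := m) hm
  set n := Nat.find hex
  refine ⟨n, h, hh0, hhn, le_antisymm (fun g hg => ?_) ?_⟩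
  swap
  · rwa [Ideal.span_singleton_le_iff_mem]
  refine mem_of_homogeneousComponent_mem fun k => ?_
  rw [Ideal.mem_span_singleton]
  have hgk := homogeneousComponent_isHomogeneous k g
  have hgI := homogeneousComponent_mem_projIdeal hg k
  generalize homogeneousComponent k g = g' at hgk hgI
  rcases eq_or_ne g' 0 with rfl | hg0
  · exact dvd_zero h
  obtain ⟨a, b, c, hab, rfl, rfl⟩ := UniqueFactorizationMonoid.exists_reduced_factors h hh0 g'
  obtain ⟨i, j, hij, hci, haj⟩ := isHomogeneous_of_mul hhn hh0
  obtain ⟨i', j', -, -, hbj⟩ := isHomogeneous_of_mul hgk hg0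
  have hc0 := left_ne_zero_of_mul hh0
  have ha0 := right_ne_zero_of_mul hh0
  rcases Nat.eq_zero_or_pos j with rfl | hj
  · have hac : a.totalDegree = 0 := haj.totalDegree ha0
    rw [totalDegree_eq_zero_iff_eq_C] at hac
    have hau : IsUnit a := by
      rw [hac]
      refine (IsUnit.mk0 _ fun h => ha0 ?_).map C
      rw [hac, h, C_0]
    obtain ⟨u, rfl⟩ := hau
    exact mul_dvd_mul_left c (Units.coe_dvd)
  · exfalso
    have hcI : c ∉ projIdeal S := fun hcI => hmin i (by omega) ⟨c, hc0, hci, hcI⟩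
    rw [mem_projIdeal_iff_of_isHomogeneous hci] at hcI
    push Not at hcI
    obtain ⟨ℓ, hℓ, hcℓ⟩ := hcI
    refine hS i c hci ℓ hℓ hcℓ (Set.Finite.subset (Set.finite_of_encard_le_coe
      (encard_projective_commonZeros_le ha0 (right_ne_zero_of_mul hg0) haj hbj hab)) ?_)
    rintro m ⟨hmS, hmc⟩
    have h1 := (mem_projIdeal_iff_of_isHomogeneous hhn).1 hhI m hmS
    have h2 := (mem_projIdeal_iff_of_isHomogeneous hgk).1 hgI m hmS
    rw [map_mul] at h1 h2
    exact ⟨(mul_eq_zero.1 h1).resolve_left hmc, (mul_eq_zero.1 h2).resolve_left hmc⟩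

theorem mem_projClosure_iff {S : Set (DualPlane K)} {h : MvPolynomial (Fin 3) K}
    (hI : projIdeal S = Ideal.span {h}) (ℓ : DualPlane K) :
    ℓ ∈ projClosure S ↔ eval ℓ.rep h = 0 := by
  constructor
  · intro hℓ
    exact hℓ h (by rw [hI]; exact Ideal.mem_span_singleton_self h)
  · intro hℓ g hg
    rw [hI, Ideal.mem_span_singleton] at hg
    obtain ⟨r, rfl⟩ := hg
    rw [map_mul, hℓ, zero_mul]

theorem subset_projClosure (S : Set (DualPlane K)) : S ⊆ projClosure S := fun ℓ hℓ _ hg =>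
  mem_projIdeal_iff.1 hg ℓ.rep ℓ.rep_nonzero (by rwa [ℓ.mk_rep])

end ProjIdeal

/-! ### Upper bound for the degree by Hilbert functions -/

section Degree

variable {K : Type*} [Field K]

theorem totalDegree_pderiv_le {σ : Type*} (i : σ) (f : MvPolynomial σ K) :
    (pderiv i f).totalDegree ≤ f.totalDegree - 1 := by
  classical
  conv_lhs => rw [f.as_sum, map_sum]
  refine (totalDegree_finsetSum_le fun s hs => ?_)
  rw [pderiv_monomial]
  rcases Nat.eq_zero_or_pos (s i) with h | h
  · simp [h]
  · have hs' : s.degree ≤ f.totalDegree := le_totalDegree hs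
    refine (totalDegree_monomial_le _ _).trans ?_
    have h2 : (s - Finsupp.single i 1).degree + 1 = s.degree := by
      have h3 : s - Finsupp.single i 1 + Finsupp.single i 1 = s :=
        tsub_add_cancel_of_le (by simpa [Nat.succ_le_iff] using h)
      conv_rhs => rw [← h3]
      rw [map_add, Finsupp.degree_single]
    change (s - Finsupp.single i 1).degree ≤ _
    omega

theorem totalDegree_aeval_le {σ τ : Type*} (n : σ → MvPolynomial τ K) {d e : ℕ}
    (hn : ∀ i, (n i).totalDegree ≤ d) (g : MvPolynomial σ K) (hg : g.totalDegree ≤ e) :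
    (aeval n g).totalDegree ≤ d * e := by
  rw [aeval_def, eval₂_eq]
  refine totalDegree_finsetSum_le fun s hs => ?_
  refine (totalDegree_mul _ _).trans ?_
  have h1 : (algebraMap K (MvPolynomial τ K) (coeff s g)).totalDegree = 0 := totalDegree_C _
  rw [h1, zero_add]
  refine (totalDegree_finsetProd _ _).trans ?_
  calc ∑ i ∈ s.support, (n i ^ s i).totalDegree ≤ ∑ i ∈ s.support, d * s i :=
        Finset.sum_le_sum fun i _ => (totalDegree_pow _ _).trans
          (by rw [mul_comm d]; exact Nat.mul_le_mul_left _ (hn i))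
    _ = d * ∑ i ∈ s.support, s i := by rw [Finset.mul_sum]
    _ ≤ d * e := Nat.mul_le_mul_left _ ((le_totalDegree hs).trans hg)

/-- The polynomial map that sends a point to the coefficients of the normal at that point. -/
def normalPoly (f : MvPolynomial (Fin 2) K) : Fin 3 → MvPolynomial (Fin 2) K :=
  ![pderiv 1 f, - pderiv 0 f, X 1 * pderiv 0 f - X 0 * pderiv 1 f]

theorem eval_normalPoly (f : MvPolynomial (Fin 2) K) (p : Fin 2 → K) (i : Fin 3) :
    eval p (normalPoly f i) = normalVector f p i := by
  fin_cases i <;> simp [normalPoly, normalVector]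

theorem eval_aeval_normalPoly (f : MvPolynomial (Fin 2) K) (p : Fin 2 → K)
    (g : MvPolynomial (Fin 3) K) :
    eval p (aeval (normalPoly f) g) = eval (normalVector f p) g := by
  have : (eval p).comp (aeval (R := K) (normalPoly f)).toRingHom = eval (normalVector f p) := by
    refine MvPolynomial.ringHom_ext (fun r => ?_) (fun i => ?_)
    · simp [algebraMap_eq]
    · simp [eval_normalPoly]
  exact congrArg (fun φ : MvPolynomial (Fin 3) K →+* K => φ g) this

theorem totalDegree_normalPoly_le {f : MvPolynomial (Fin 2) K} (hf : 1 ≤ f.totalDegree)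
    (i : Fin 3) : (normalPoly f i).totalDegree ≤ f.totalDegree := by
  have h0 := totalDegree_pderiv_le 0 f
  have h1 := totalDegree_pderiv_le 1 f
  fin_cases i
  · simp only [normalPoly, Fin.zero_eta, Matrix.cons_val_zero]; omega
  · simp only [normalPoly, Fin.mk_one, Matrix.cons_val_one, Matrix.cons_val_zero, totalDegree_neg]
    omega
  · simp only [normalPoly, Fin.reduceFinMk, Matrix.cons_val]
    refine (totalDegree_sub _ _).trans (max_le ?_ ?_) <;>
    · refine (totalDegree_mul _ _).trans ?_
      rw [totalDegree_X]
      omega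

theorem mem_projIdeal_of_dvd {f : MvPolynomial (Fin 2) K} {g : MvPolynomial (Fin 3) K} {n : ℕ}
    (hg : g.IsHomogeneous n) (hdvd : f ∣ aeval (normalPoly f) g) :
    g ∈ projIdeal (curveOfNormals f) := by
  rw [mem_projIdeal_iff_of_isHomogeneous hg]
  rintro ℓ ⟨p, hp, hn, rfl⟩
  rw [eval_rep_mk_eq_zero_iff hg, ← eval_aeval_normalPoly]
  obtain ⟨r, hr⟩ := hdvd
  rw [hr, map_mul, hp, zero_mul]

/-- Comparison of Hilbert functions: the forms of degree `e` modulo those that vanish on the curve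
of normals embed into the polynomials of degree `d * e` modulo `f`. -/
theorem finrank_forms_le {f : MvPolynomial (Fin 2) K} (hf : 1 ≤ f.totalDegree) (e : ℕ)
    (W : Submodule K (MvPolynomial (Fin 3) K)) [FiniteDimensional K W]
    (hW : ∀ g, g.IsHomogeneous (e + 1) → g ∈ projIdeal (curveOfNormals f) → g ∈ W) :
    Module.finrank K (homogeneousSubmodule (Fin 3) K (e + 1)) +
        Module.finrank K (restrictTotalDegree (Fin 2) K (f.totalDegree * e)) ≤
      Module.finrank K (restrictTotalDegree (Fin 2) K (f.totalDegree * (e + 1))) +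
        Module.finrank K W := by
  have hf0 : f ≠ 0 := by rintro rfl; simp at hf
  set d := f.totalDegree
  have h1 : ∀ g ∈ homogeneousSubmodule (Fin 3) K (e + 1),
      (aeval (normalPoly f)).toLinearMap g ∈ restrictTotalDegree (Fin 2) K (d * (e + 1)) := by
    intro g hg
    rw [mem_homogeneousSubmodule] at hg
    rw [mem_restrictTotalDegree]
    exact totalDegree_aeval_le _ (totalDegree_normalPoly_le hf) g hg.totalDegree_le
  have h2 : ∀ r ∈ restrictTotalDegree (Fin 2) K (d * e),
      LinearMap.mulLeft K f r ∈ restrictTotalDegree (Fin 2) K (d * (e + 1)) := by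
    intro r hr
    rw [mem_restrictTotalDegree] at hr ⊢
    refine (totalDegree_mul _ _).trans ?_
    rw [mul_add, mul_one]
    omega
  let Θ := (LinearMap.restrict (aeval (R := K) (normalPoly f)).toLinearMap h1).coprod
    (LinearMap.restrict (LinearMap.mulLeft K f) h2)
  have hΘ : ∀ x, (Θ x : MvPolynomial (Fin 2) K) =
    aeval (normalPoly f) (x.1 : MvPolynomial (Fin 3) K) + f * x.2 := fun x => rfl
  have hker : ∀ x ∈ LinearMap.ker Θ, aeval (normalPoly f) (x.1 : MvPolynomial (Fin 3) K) +
      f * x.2 = 0 := by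
    intro x hx
    have := congrArg Subtype.val (LinearMap.mem_ker.1 hx)
    rwa [hΘ] at this
  let ψ : LinearMap.ker Θ →ₗ[K] MvPolynomial (Fin 3) K :=
    ((homogeneousSubmodule (Fin 3) K (e + 1)).subtype.comp (LinearMap.fst K _ _)).comp
      (LinearMap.ker Θ).subtype
  have hψ : Function.Injective ψ := by
    intro x y hxy
    have hxy' : (x.1.1 : MvPolynomial (Fin 3) K) = y.1.1 := hxy
    have hx := hker x.1 x.2
    have hy := hker y.1 y.2
    rw [hxy'] at hx
    have : f * (x.1.2 : MvPolynomial (Fin 2) K) = f * y.1.2 := by linear_combination hx - hy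
    exact Subtype.ext (Prod.ext (Subtype.ext hxy') (Subtype.ext (mul_left_cancel₀ hf0 this)))
  have hle : LinearMap.range ψ ≤ W := by
    rintro _ ⟨x, rfl⟩
    refine hW _ x.1.1.2 (mem_projIdeal_of_dvd (f := f) x.1.1.2 ⟨-x.1.2, ?_⟩)
    have h0 := hker x.1 x.2
    change aeval (normalPoly f) (x.1.1 : MvPolynomial (Fin 3) K) = _
    linear_combination h0
  have h3 : Module.finrank K (LinearMap.ker Θ) ≤ Module.finrank K W := by
    rw [← LinearMap.finrank_range_of_inj hψ]
    exact Submodule.finrank_mono hle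
  have h4 := LinearMap.finrank_range_add_finrank_ker Θ
  rw [Module.finrank_prod] at h4
  have h5 := Submodule.finrank_le (LinearMap.range Θ)
  omega

/-- If no form vanished, the dimension of forms of degree `e + 1`, about `e ^ 2 / 2`, would be
bounded by a function of `e` with leading term `d ^ 2 * e`. The value `e = 2 * d ^ 2 + 3 * d` is
large enough for a contradiction. -/
theorem projIdeal_curveOfNormals_ne_bot {f : MvPolynomial (Fin 2) K} (hf : 1 ≤ f.totalDegree) :
    projIdeal (curveOfNormals f) ≠ ⊥ := by
  intro h
  set d := f.totalDegree with hd
  have key := finrank_forms_le hf (2 * d ^ 2 + 3 * d) ⊥ fun g _ hg => by rwa [h] at hg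
  rw [finrank_bot, add_zero, ← hd] at key
  have h1 := two_mul_finrank_homogeneousSubmodule K (2 * d ^ 2 + 3 * d + 1)
  have h2 := two_mul_finrank_restrictTotalDegree K (d * (2 * d ^ 2 + 3 * d))
  have h3 := two_mul_finrank_restrictTotalDegree K (d * (2 * d ^ 2 + 3 * d + 1))
  nlinarith [sq_nonneg d, pow_nonneg (Nat.zero_le d) 3, pow_nonneg (Nat.zero_le d) 4]

/-- In degree `s + n` the ideal is `h` times the forms of degree `s`, so the quotient has dimension
`n * s` plus a constant. The comparison bounds it by `d ^ 2 * s` plus a constant, which forces `n ≤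
d ^ 2` when `s` is large; `s = 2 * d ^ 2 * n + 3 * d` suffices. -/
theorem degree_le_of_projIdeal_eq_span {f : MvPolynomial (Fin 2) K} (hf : 1 ≤ f.totalDegree)
    {h : MvPolynomial (Fin 3) K} {n : ℕ} (h0 : h ≠ 0) (hn : h.IsHomogeneous n)
    (hI : projIdeal (curveOfNormals f) = Ideal.span {h}) : n ≤ f.totalDegree ^ 2 := by
  by_contra! hlt
  set d := f.totalDegree with hd
  have key : ∀ s : ℕ, Module.finrank K (homogeneousSubmodule (Fin 3) K (s + n)) +
      Module.finrank K (restrictTotalDegree (Fin 2) K (d * (s + n - 1))) ≤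
      Module.finrank K (restrictTotalDegree (Fin 2) K (d * (s + n))) +
        Module.finrank K (homogeneousSubmodule (Fin 3) K s) := by
    intro s
    obtain ⟨e, he⟩ : ∃ e, s + n = e + 1 := ⟨s + n - 1, by omega⟩
    have := finrank_forms_le hf e ((homogeneousSubmodule (Fin 3) K s).map (LinearMap.mulLeft K h))
      fun g hg hgI => by
        rw [hI, Ideal.mem_span_singleton] at hgI
        obtain ⟨r, rfl⟩ := hgI
        refine ⟨r, ?_, rfl⟩
        refine (mul_mem_homogeneousSubmodule_iff hn h0).1 ?_
        rw [he]
        exact hg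
    rw [he, Nat.add_sub_cancel]
    exact this.trans (Nat.add_le_add_left (Submodule.finrank_map_le _ _) _)
  obtain ⟨k, rfl⟩ : ∃ k, n = d ^ 2 + 1 + k := ⟨n - (d ^ 2 + 1), by omega⟩
  specialize key (2 * d ^ 2 * (d ^ 2 + 1 + k) + 3 * d)
  set s := 2 * d ^ 2 * (d ^ 2 + 1 + k) + 3 * d with hs
  have e1 : s + (d ^ 2 + 1 + k) - 1 = s + d ^ 2 + k := by omega
  rw [e1] at key
  have h1 := two_mul_finrank_homogeneousSubmodule K (s + (d ^ 2 + 1 + k))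
  have h2 := two_mul_finrank_homogeneousSubmodule K s
  have h3 := two_mul_finrank_restrictTotalDegree K (d * (s + d ^ 2 + k))
  have h4 := two_mul_finrank_restrictTotalDegree K (d * (s + (d ^ 2 + 1 + k)))
  have h5 : (s + (d ^ 2 + 1 + k) + 1) * (s + (d ^ 2 + 1 + k) + 2) +
      (d * (s + d ^ 2 + k) + 1) * (d * (s + d ^ 2 + k) + 2) ≤
      (d * (s + (d ^ 2 + 1 + k)) + 1) * (d * (s + (d ^ 2 + 1 + k)) + 2) + (s + 1) * (s + 2) := by
    omega
  set D := d ^ 2 + 1 + k with hD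
  have h6 : s * D = s * d ^ 2 + s + s * k := by rw [hD]; ring
  have e2 : s + d ^ 2 + k + 1 = s + D := by omega
  have h7 : d * (s + D) = d * (s + d ^ 2 + k) + d := by rw [← e2]; ring
  rw [h7] at h5
  have h8 : d * (s + d ^ 2 + k) * d + d * d = d ^ 2 * s + d ^ 2 * D := by rw [hD]; ring
  have h9 : 0 ≤ s * k := Nat.zero_le _
  nlinarith

end Degree

/-! ### Restriction of polynomials to parametrized lines -/

section RestrictLine

variable {σ : Type*} {K : Type*} [Field K]

/-- The restriction of a polynomial to the parametrized line `s ↦ a + s b`. -/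
def restrictLine (a b : σ → K) : MvPolynomial σ K →ₐ[K] Polynomial K :=
  aeval fun i => Polynomial.C (a i) + Polynomial.X * Polynomial.C (b i)

theorem eval_restrictLine (a b : σ → K) (g : MvPolynomial σ K) (s : K) :
    (restrictLine a b g).eval s = eval (a + s • b) g := by
  have : (Polynomial.evalRingHom s).comp (restrictLine a b).toRingHom = eval (a + s • b) := by
    refine MvPolynomial.ringHom_ext (fun r => ?_) (fun i => ?_)
    · simp [restrictLine]
    · simp [restrictLine, mul_comm s]
  exact congrArg (fun φ : MvPolynomial σ K →+* K => φ g) this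

theorem natDegree_restrictLine_le (a b : σ → K) (g : MvPolynomial σ K) :
    (restrictLine a b g).natDegree ≤ g.totalDegree := by
  rw [restrictLine, aeval_def, eval₂_eq]
  refine Polynomial.natDegree_sum_le_of_forall_le _ _ fun s hs => ?_
  have h1 : ∀ i, (Polynomial.C (a i) + Polynomial.X * Polynomial.C (b i)).natDegree ≤ 1 := by
    intro i
    compute_degree
  refine (Polynomial.natDegree_C_mul_le _ _).trans ((Polynomial.natDegree_prod_le _ _).trans ?_)
  refine le_trans (Finset.sum_le_sum fun i _ => ?_) (le_totalDegree hs)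
  exact Polynomial.natDegree_pow_le.trans (by simpa using Nat.mul_le_mul_left (s i) (h1 i))

theorem eval_derivative_restrictLine [Fintype σ] (a b : σ → K) (g : MvPolynomial σ K) (s : K) :
    (restrictLine a b g).derivative.eval s = ∑ i, eval (a + s • b) (pderiv i g) * b i := by
  classical
  induction g using MvPolynomial.induction_on with
  | C r => simp [restrictLine]
  | add p q hp hq => simp [hp, hq, add_mul, Finset.sum_add_distrib]
  | mul_X p j hp =>
    rw [map_mul, Polynomial.derivative_mul, Polynomial.eval_add, Polynomial.eval_mul,
      Polynomial.eval_mul, hp, eval_restrictLine, eval_restrictLine]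
    have h1 : (restrictLine a b (X j : MvPolynomial σ K)).derivative = Polynomial.C (b j) := by
      simp [restrictLine]
    rw [h1]
    simp only [Derivation.leibniz, pderiv_X, smul_eq_mul, map_add, map_mul, eval_X, add_mul,
      Finset.sum_add_distrib, Polynomial.eval_C]
    rw [Finset.sum_mul, add_comm]
    congr 1
    · rw [Finset.sum_eq_single j]
      · simp
      · intro i _ hij
        simp [Ne.symm hij]
      · simp
    · exact Finset.sum_congr rfl fun i _ => by ring

/-- The coefficient of `s ^ n` in `h (a + s • b)` is `h b`. To read it off, the roles of `a` and `b`
are exchanged and the reversed polynomial is evaluated at `0`. -/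
theorem restrictLine_ne_zero_of_eval_ne_zero [Infinite K] {h : MvPolynomial σ K} {n : ℕ}
    (hn : h.IsHomogeneous n) (a : σ → K) {b : σ → K} (hb : eval b h ≠ 0) :
    restrictLine a b h ≠ 0 := by
  intro h0
  have hQ : restrictLine b a h = 0 := by
    refine Polynomial.eq_zero_of_infinite_isRoot _
      ((Set.finite_singleton (0 : K)).infinite_compl.mono fun t ht => ?_)
    have ht0 : t ≠ 0 := ht
    change Polynomial.eval t _ = 0
    have h1 : b + t • a = t • (a + t⁻¹ • b) := by
      rw [smul_add, smul_smul, mul_inv_cancel₀ ht0, one_smul, add_comm]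
    rw [eval_restrictLine, h1, eval_smul_of_isHomogeneous hn, ← eval_restrictLine, h0]
    simp
  apply hb
  have := eval_restrictLine b a h 0
  rw [hQ] at this
  simpa using this.symm

end RestrictLine

/-! ### Intersections of the closure with a pencil -/

section Pencil

variable {K : Type*} [Field K]

theorem mem_pencil_iff {w : ℙ K (Fin 3 → K)} {ℓ : DualPlane K} :
    ℓ ∈ pencil w ↔ ℓ.rep ⬝ᵥ w.rep = 0 := by
  rw [← Projectivization.orthogonal_mk ℓ.rep_nonzero w.rep_nonzero, ℓ.mk_rep, w.mk_rep]
  rfl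

theorem dotProduct_rep_toProj (z : Fin 2 → K) (u : Fin 3 → K) :
    u ⬝ᵥ (toProj z).rep = 0 ↔ u ⬝ᵥ ![z 0, z 1, 1] = 0 := by
  obtain ⟨a, ha⟩ := Projectivization.exists_smul_eq_mk_rep K ![z 0, z 1, 1]
    (fun h => one_ne_zero (congrFun h 2))
  rw [toProj, ← ha, Units.smul_def, dotProduct_smul, smul_eq_mul]
  simp

theorem pencil_nonempty (w : ℙ K (Fin 3 → K)) : (pencil w).Nonempty := by
  have : ∃ v : Fin 3 → K, v ≠ 0 ∧ v ⬝ᵥ w.rep = 0 := by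
    by_cases h : w.rep 0 = 0
    · refine ⟨![1, 0, 0], fun h => one_ne_zero (congrFun h 0), ?_⟩
      simp [dotProduct, Fin.sum_univ_three, h]
    · refine ⟨![w.rep 1, - w.rep 0, 0], fun h' => h ?_, ?_⟩
      · simpa using congrFun h' 1
      · simp [dotProduct, Fin.sum_univ_three]
        ring
  obtain ⟨v, hv, hvw⟩ := this
  refine ⟨Projectivization.mk K v hv, ?_⟩
  rw [← Projectivization.orthogonal_mk hv w.rep_nonzero, w.mk_rep] at hvw
  exact hvw

/-- All three vectors are orthogonal to `w`, hence dependent; and `u` is not a multiple of `a`,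
because the form `h` vanishes at `a` but not at `u`. -/
theorem exists_eq_add_smul {n : ℕ} {h : MvPolynomial (Fin 3) K} (hn : h.IsHomogeneous n)
    {w a u m : Fin 3 → K} (hw : w ≠ 0) (ha0 : a ≠ 0) (haw : a ⬝ᵥ w = 0) (huw : u ⬝ᵥ w = 0)
    (hmw : m ⬝ᵥ w = 0) (ha : eval a h = 0) (hu : eval u h ≠ 0) :
    ∃ α β : K, m = α • a + β • u := by
  have hdet : (Matrix.of ![a, u, m]).det = 0 := by
    rw [← Matrix.exists_mulVec_eq_zero_iff]
    refine ⟨w, hw, ?_⟩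
    ext i
    fin_cases i <;> simpa [Matrix.mulVec]
  rw [← Matrix.exists_vecMul_eq_zero_iff] at hdet
  obtain ⟨c, hc, hc0⟩ := hdet
  have hlin : c 0 • a + c 1 • u + c 2 • m = 0 := by
    rw [← hc0]
    ext j
    simp [Matrix.vecMul, dotProduct, Fin.sum_univ_three]
  by_cases h2 : c 2 = 0
  · exfalso
    rw [h2, zero_smul, add_zero] at hlin
    by_cases h1 : c 1 = 0
    · rw [h1, zero_smul, add_zero] at hlin
      have h0 := (smul_eq_zero.1 hlin).resolve_right ha0
      exact hc (by ext i; fin_cases i <;> simp [h0, h1, h2])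
    · have : u = (-(c 1)⁻¹ * c 0) • a := by
        have h3 : c 1 • u = -(c 0 • a) := by rw [eq_neg_iff_add_eq_zero, add_comm]; exact hlin
        rw [neg_mul, neg_smul, mul_smul, ← smul_neg, ← h3, smul_smul, inv_mul_cancel₀ h1, one_smul]
      rw [this, eval_smul_of_isHomogeneous hn, ha, mul_zero] at hu
      exact hu rfl
  · refine ⟨-(c 2)⁻¹ * c 0, -(c 2)⁻¹ * c 1, ?_⟩
    have h3 : c 2 • m = -(c 0 • a + c 1 • u) := by
      rw [eq_neg_iff_add_eq_zero, add_comm]; exact hlin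
    rw [mul_smul, mul_smul, ← smul_add, neg_smul, ← smul_neg, ← h3, smul_smul, inv_mul_cancel₀ h2,
      one_smul]

variable {S : Set (DualPlane K)} {h : MvPolynomial (Fin 3) K} {n : ℕ}

/-- The points of the closure on a pencil are parametrized by roots of the restriction of the
equation. -/
theorem exists_restrictLine_root (hn : h.IsHomogeneous n) (hI : projIdeal S = Ideal.span {h})
    {w : ℙ K (Fin 3 → K)} {u : Fin 3 → K} (huw : u ⬝ᵥ w.rep = 0) (hu : eval u h ≠ 0)
    {ℓ : DualPlane K} (hℓ : ℓ ∈ projClosure S ∩ pencil w) :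
    ∃ r : DualPlane K → K, Set.InjOn r (projClosure S ∩ pencil w) ∧
      ∀ m ∈ projClosure S ∩ pencil w, (restrictLine ℓ.rep u h).IsRoot (r m) := by
  have key : ∀ m ∈ projClosure S ∩ pencil w, ∃ s : K, ∃ c : K, c ≠ 0 ∧
      m.rep = c • (ℓ.rep + s • u) := by
    rintro m ⟨hmS, hmw⟩
    rw [mem_projClosure_iff hI] at hmS
    obtain ⟨α, β, hαβ⟩ := exists_eq_add_smul hn w.rep_nonzero ℓ.rep_nonzero
      (mem_pencil_iff.1 hℓ.2) huw (mem_pencil_iff.1 hmw) ((mem_projClosure_iff hI ℓ).1 hℓ.1) hu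
    have hα : α ≠ 0 := by
      rintro rfl
      rw [zero_smul, zero_add] at hαβ
      rw [hαβ, eval_smul_of_isHomogeneous hn] at hmS
      have hβ : β ^ n = 0 := (mul_eq_zero.1 hmS).resolve_right hu
      exact m.rep_nonzero (by rw [hαβ, eq_zero_of_pow_eq_zero hβ, zero_smul])
    exact ⟨α⁻¹ * β, α, hα, by rw [hαβ, smul_add, smul_smul, mul_inv_cancel_left₀ hα]⟩
  choose! r c hc hr using key
  refine ⟨r, ?_, ?_⟩
  · intro m hm m' hm' hmm
    have h1 := hr m hm
    have h2 := hr m' hm'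
    rw [← m.mk_rep, ← m'.mk_rep, Projectivization.mk_eq_mk_iff']
    refine ⟨c m * (c m')⁻¹, ?_⟩
    rw [h2, h1, hmm, smul_smul, mul_assoc, inv_mul_cancel₀ (hc m' hm'), mul_one]
  · intro m hm
    have h1 := hr m hm
    have h2 := (mem_projClosure_iff hI m).1 hm.1
    rw [h1, eval_smul_of_isHomogeneous hn] at h2
    rw [Polynomial.IsRoot, eval_restrictLine]
    exact (mul_eq_zero.1 h2).resolve_left (pow_ne_zero _ (hc m hm))

variable [Infinite K]

theorem encard_projClosure_inter_pencil_le (hn : h.IsHomogeneous n)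
    (hI : projIdeal S = Ideal.span {h}) {w : ℙ K (Fin 3 → K)} {u : Fin 3 → K}
    (huw : u ⬝ᵥ w.rep = 0) (hu : eval u h ≠ 0) :
    (projClosure S ∩ pencil w).encard ≤ n := by
  classical
  rcases (projClosure S ∩ pencil w).eq_empty_or_nonempty with he | ⟨ℓ, hℓ⟩
  · simp [he]
  obtain ⟨r, hinj, hr⟩ := exists_restrictLine_root hn hI huw hu hℓ
  have hP := restrictLine_ne_zero_of_eval_ne_zero hn ℓ.rep hu
  rw [← hinj.encard_image]
  calc (r '' (projClosure S ∩ pencil w)).encard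
      ≤ ((restrictLine ℓ.rep u h).roots.toFinset : Set K).encard := by
        refine Set.encard_le_encard ?_
        rintro _ ⟨m, hm, rfl⟩
        simpa [hP] using hr m hm
    _ = ((restrictLine ℓ.rep u h).roots.toFinset.card : ℕ∞) := Set.encard_coe_eq_coe_finsetCard _
    _ ≤ n := by
        refine Nat.cast_le.2 ((Multiset.toFinset_card_le _).trans ((Polynomial.card_roots' _).trans
          ((natDegree_restrictLine_le _ _ _).trans hn.totalDegree_le)))

/-- The restriction of `h` to the pencil has degree at most `n` and `n` distinct roots, so all its
roots are simple, and the derivative of `h` along the pencil is nonzero at each common point. -/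
theorem meetsTransversally_of_encard_eq (hn : h.IsHomogeneous n)
    (hI : projIdeal S = Ideal.span {h}) {w : ℙ K (Fin 3 → K)} {u : Fin 3 → K}
    (huw : u ⬝ᵥ w.rep = 0) (hu : eval u h ≠ 0) (hcard : (projClosure S ∩ pencil w).encard = n) :
    MeetsTransversally w S := by
  classical
  intro ℓ hℓ
  refine ⟨h, by rw [hI]; exact Ideal.mem_span_singleton_self h, u, huw, fun h0 => ?_⟩
  obtain ⟨r, hinj, hr⟩ := exists_restrictLine_root hn hI huw hu hℓ
  have hP := restrictLine_ne_zero_of_eval_ne_zero hn ℓ.rep hu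
  set P := restrictLine ℓ.rep u h
  have h1 : P.eval 0 = 0 := by
    rw [eval_restrictLine, zero_smul, add_zero]
    exact (mem_projClosure_iff hI ℓ).1 hℓ.1
  have h2 : P.derivative.eval 0 = 0 := by
    rw [eval_derivative_restrictLine, zero_smul, add_zero]
    exact h0
  have h3 : 1 < P.rootMultiplicity 0 :=
    (Polynomial.one_lt_rootMultiplicity_iff_isRoot hP).2 ⟨h1, h2⟩
  have h4 : n ≤ P.roots.toFinset.card := by
    rw [← Nat.cast_le (α := ℕ∞), ← Set.encard_coe_eq_coe_finsetCard, ← hcard, ← hinj.encard_image]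
    refine Set.encard_le_encard ?_
    rintro _ ⟨m, hm, rfl⟩
    simpa [hP] using hr m hm
  have h5 : P.roots.card ≤ n := (Polynomial.card_roots' _).trans
    ((natDegree_restrictLine_le _ _ _).trans hn.totalDegree_le)
  have h6 : P.roots.Nodup := by
    rw [← Multiset.toFinset_card_eq_card_iff_nodup]
    exact le_antisymm (Multiset.toFinset_card_le _) (h5.trans h4)
  have h7 := Multiset.nodup_iff_count_le_one.1 h6 0
  rw [Polynomial.count_roots] at h7
  omega

/-- If the pencil lay in the closure, every element of the ideal would vanish along it, together
with its derivative in that direction. Since a pencil is nonempty, transversality would fail at some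
point. -/
theorem exists_eval_ne_zero_of_meetsTransversally (hI : projIdeal S = Ideal.span {h})
    {w : ℙ K (Fin 3 → K)} (hw : MeetsTransversally w S) :
    ∃ u : Fin 3 → K, u ⬝ᵥ w.rep = 0 ∧ eval u h ≠ 0 := by
  by_contra! hall
  obtain ⟨ℓ, hℓ⟩ := pencil_nonempty w
  have hℓw := mem_pencil_iff.1 hℓ
  obtain ⟨g, hg, t, htw, ht⟩ := hw ℓ ⟨(mem_projClosure_iff hI ℓ).2 (hall _ hℓw), hℓ⟩
  apply ht
  rw [hI, Ideal.mem_span_singleton] at hg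
  obtain ⟨r, rfl⟩ := hg
  have h0 : restrictLine ℓ.rep t (h * r) = 0 := by
    refine Polynomial.funext fun s => ?_
    rw [eval_restrictLine, map_mul, hall, zero_mul, Polynomial.eval_zero]
    rw [add_dotProduct, smul_dotProduct, hℓw, htw, smul_zero, add_zero]
  have h1 := eval_derivative_restrictLine ℓ.rep t (h * r) 0
  rw [h0, zero_smul, add_zero] at h1
  simpa using h1.symm

/-- The last coefficient of the linear form is `1`, so modulo it the third variable can be
eliminated by `τ`. What remains of `g` vanishes identically over an infinite field. -/
theorem linForm_dvd_of_eval_eq_zero (z : Fin 2 → K) (g : MvPolynomial (Fin 3) K)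
    (hg : ∀ u : Fin 3 → K, u ⬝ᵥ ![z 0, z 1, 1] = 0 → eval u g = 0) :
    linForm ![z 0, z 1, 1] ∣ g := by
  let τ : Fin 3 → MvPolynomial (Fin 3) K := ![X 0, X 1, - (C (z 0) * X 0 + C (z 1) * X 1)]
  have h1 : ∀ p : MvPolynomial (Fin 3) K, linForm ![z 0, z 1, 1] ∣ p - aeval τ p := by
    intro p
    induction p using MvPolynomial.induction_on with
    | C r => simp [algebraMap_eq]
    | add p q hp hq =>
      have := dvd_add hp hq
      rw [map_add]
      convert this using 1
      ring
    | mul_X p i hp =>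
      have hX : linForm ![z 0, z 1, 1] ∣ X i - τ i := by
        fin_cases i
        · simp [τ]
        · simp [τ]
        · refine ⟨1, ?_⟩
          simp [τ, linForm, Fin.sum_univ_three]
          ring
      have := dvd_add (hp.mul_right (X i)) (hX.mul_left (aeval τ p))
      rw [map_mul, aeval_X]
      convert this using 1
      ring
  have h2 : aeval τ g = 0 := by
    refine MvPolynomial.funext fun x => ?_
    have h3 : (eval x).comp (aeval (R := K) τ).toRingHom =
        eval ![x 0, x 1, - (z 0 * x 0 + z 1 * x 1)] := by
      refine MvPolynomial.ringHom_ext (fun r => ?_) (fun i => ?_)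
      · simp [algebraMap_eq]
      · fin_cases i <;> simp [τ]
    have h4 := congrArg (fun φ : MvPolynomial (Fin 3) K →+* K => φ g) h3
    change eval x (aeval τ g) = _ at h4
    rw [h4, map_zero]
    refine hg _ ?_
    simp [dotProduct, Fin.sum_univ_three]
    ring
  have h5 := h1 g
  rwa [h2, sub_zero] at h5

/-- Otherwise `h` is the linear form of the pencil times some `g`. By degree `g` is not in the
ideal, so `g ≠ 0` at infinitely many points of `S`, and all of these lie in the pencil. -/
theorem exists_eval_ne_zero_of_finite (hS : HasNoIsolatedPoint S) (h0 : h ≠ 0)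
    (hn : h.IsHomogeneous n) (hI : projIdeal S = Ideal.span {h}) (z : Fin 2 → K)
    (hfin : (S ∩ pencil (toProj z)).Finite) :
    ∃ u : Fin 3 → K, u ⬝ᵥ (toProj z).rep = 0 ∧ eval u h ≠ 0 := by
  by_contra! hall
  obtain ⟨g, rfl⟩ := linForm_dvd_of_eval_eq_zero z h fun u hu =>
    hall u ((dotProduct_rep_toProj z u).2 hu)
  obtain ⟨i, j, hij, hli, hgj⟩ := isHomogeneous_of_mul hn h0
  have hg0 := right_ne_zero_of_mul h0
  have hi : i = 1 := hli.inj_right (isHomogeneous_linForm _) (left_ne_zero_of_mul h0)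
  have hgI : g ∉ projIdeal S := by
    intro hg
    rw [hI, Ideal.mem_span_singleton] at hg
    have := totalDegree_le_of_dvd_of_isDomain hg hg0
    rw [hn.totalDegree h0, hgj.totalDegree hg0] at this
    omega
  rw [mem_projIdeal_iff_of_isHomogeneous hgj] at hgI
  push Not at hgI
  obtain ⟨ℓ, hℓ, hgℓ⟩ := hgI
  refine hS j g hgj ℓ hℓ hgℓ (hfin.subset ?_)
  rintro m ⟨hmS, hgm⟩
  refine ⟨hmS, mem_pencil_iff.2 ?_⟩
  have h1 := (mem_projIdeal_iff_of_isHomogeneous hn).1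
    (by rw [hI]; exact Ideal.mem_span_singleton_self _) m hmS
  rw [map_mul, eval_linForm] at h1
  exact (dotProduct_rep_toProj z _).2 ((mul_eq_zero.1 h1).resolve_right hgm)

end Pencil

/-! ### Absence of isolated normals; upper bound for the real degree -/

section Analysis

theorem hasStrictFDerivAt_eval {σ : Type*} [Fintype σ] {𝕜 : Type*} [NontriviallyNormedField 𝕜]
    (f : MvPolynomial σ 𝕜) (p : σ → 𝕜) :
    HasStrictFDerivAt (fun x => eval x f)
      (∑ i, eval p (pderiv i f) • (ContinuousLinearMap.proj i : (σ → 𝕜) →L[𝕜] 𝕜)) p := by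
  classical
  induction f using MvPolynomial.induction_on with
  | C r =>
    refine HasStrictFDerivAt.congr_fderiv (f := fun x : σ → 𝕜 => eval x (C r)) ?_
      (f' := 0) (by ext v; simp [sum_apply])
    simp only [eval_C]
    exact hasStrictFDerivAt_const r p
  | add f g hf hg =>
    simp only [map_add]
    refine (hf.add hg).congr_fderiv ?_
    rw [← Finset.sum_add_distrib]
    exact Finset.sum_congr rfl fun i _ => (add_smul _ _ _).symm
  | mul_X f j hf =>
    have hX : HasStrictFDerivAt (fun x : σ → 𝕜 => x j)
        (ContinuousLinearMap.proj j : (σ → 𝕜) →L[𝕜] 𝕜) p :=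
      (ContinuousLinearMap.proj j : (σ → 𝕜) →L[𝕜] 𝕜).hasStrictFDerivAt
    simp only [map_mul, eval_X]
    refine (hf.mul hX).congr_fderiv ?_
    ext v
    simp only [Derivation.leibniz, pderiv_X, smul_eq_mul, map_add, map_mul, eval_X, add_mul,
      Finset.sum_add_distrib, add_apply, sum_apply, smul_apply,
      ContinuousLinearMap.proj_apply, Finset.mul_sum]
    congr 1
    · rw [Finset.sum_eq_single j]
      · simp
      · intro i _ hij
        simp [Ne.symm hij]
      · simp
    · exact Finset.sum_congr rfl fun i _ => by ring

variable {K : Type*} [RCLike K]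

/-- Near a nonsingular point, a plane curve has infinitely many points. -/
theorem infinite_zeros_of_mem_nhds {f : MvPolynomial (Fin 2) K} {p : Fin 2 → K}
    (hp : eval p f = 0) {i : Fin 2} (hi : eval p (pderiv i f) ≠ 0) {U : Set (Fin 2 → K)}
    (hU : U ∈ 𝓝 p) : {q | q ∈ U ∧ eval q f = 0}.Infinite := by
  obtain ⟨j, hij⟩ : ∃ j : Fin 2, j ≠ i := exists_ne i
  -- The derivative of `Ψ` at `p` is onto, so `Ψ` maps `U` onto a neighbourhood of `(0, p j)`. Its
  -- slice over `0` is infinite and consists of values of the coordinate `j` at zeros of `f` in `U`.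
  let Ψ : (Fin 2 → K) → K × K := fun x => (eval x f, x j)
  have hd : HasStrictFDerivAt Ψ
      ((∑ i, eval p (pderiv i f) • (ContinuousLinearMap.proj i : (Fin 2 → K) →L[K] K)).prod
        (ContinuousLinearMap.proj j)) p :=
    (hasStrictFDerivAt_eval f p).prodMk
      (ContinuousLinearMap.proj j : (Fin 2 → K) →L[K] K).hasStrictFDerivAt
  have hsum : ∀ v : Fin 2 → K, ∑ k, eval p (pderiv k f) * v k =
      eval p (pderiv i f) * v i + eval p (pderiv j f) * v j := by
    intro v
    rw [Fin.sum_univ_two]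
    fin_cases i <;> fin_cases j <;> first | exact absurd rfl hij | simp [add_comm]
  have hmap := hd.map_nhds_eq_of_surj (by
    rw [LinearMap.range_eq_top]
    rintro ⟨a, b⟩
    obtain ⟨v, hvi, hvj⟩ : ∃ v : Fin 2 → K,
        v i = (eval p (pderiv i f))⁻¹ * (a - eval p (pderiv j f) * b) ∧ v j = b :=
      ⟨Function.update (fun _ => b) i _, Function.update_self _ _ _, Function.update_of_ne hij _ _⟩
    refine ⟨v, Prod.ext ?_ hvj⟩
    change (∑ k, eval p (pderiv k f) • (ContinuousLinearMap.proj k : (Fin 2 → K) →L[K] K)) v = a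
    rw [sum_apply]
    refine (hsum v).trans ?_
    rw [hvi, hvj, mul_inv_cancel_left₀ hi, sub_add_cancel])
  have himg : Ψ '' U ∈ 𝓝 ((0 : K), p j) := by
    have := Filter.image_mem_map (m := Ψ) hU
    rw [hmap] at this
    simpa only [Ψ, hp] using this
  have hslice : {s : K | ((0 : K), s) ∈ Ψ '' U} ∈ 𝓝 (p j) :=
    (Continuous.prodMk_right (0 : K)).continuousAt himg
  have hinf : {s : K | ((0 : K), s) ∈ Ψ '' U}.Infinite :=
    infinite_of_mem_nhds (p j) hslice
  refine Set.Infinite.of_image (fun q => q j) (hinf.mono ?_)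
  rintro s ⟨q, hqU, hq⟩
  have h1 : eval q f = 0 := congrArg Prod.fst hq
  have h2 : q j = s := congrArg Prod.snd hq
  exact ⟨q, ⟨hqU, h1⟩, h2⟩

theorem normalVector_ne_zero_iff {K : Type*} [Field K] {f : MvPolynomial (Fin 2) K}
    {p : Fin 2 → K} : normalVector f p ≠ 0 ↔ ∃ i, eval p (pderiv i f) ≠ 0 := by
  constructor
  · intro h
    by_contra! hall
    exact h (by ext i; fin_cases i <;> simp [normalVector, hall])
  · rintro ⟨i, hi⟩ h
    fin_cases i
    · exact hi (by simpa [normalVector] using congrFun h 1)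
    · exact hi (by simpa [normalVector] using congrFun h 0)

theorem dotProduct_normalVector {K : Type*} [Field K] (f : MvPolynomial (Fin 2) K)
    (p z : Fin 2 → K) : normalVector f p ⬝ᵥ ![z 0, z 1, 1] =
      (z 0 - p 0) * eval p (pderiv 1 f) - (z 1 - p 1) * eval p (pderiv 0 f) := by
  simp [normalVector, dotProduct, Fin.sum_univ_three]
  ring

theorem continuous_normalVector (f : MvPolynomial (Fin 2) K) : Continuous (normalVector f) := by
  refine continuous_pi fun i => ?_
  simp only [← eval_normalPoly]
  exact MvPolynomial.continuous_eval _

/-- A curve that contains none of its normals has no isolated normals. -/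
theorem hasNoIsolatedPoint_curveOfNormals {f : MvPolynomial (Fin 2) K}
    (hf : ∀ p, eval p f = 0 → normalVector f p ≠ 0 →
      ∃ t : K, eval (p + t • fun i => eval p (pderiv i f)) f ≠ 0) :
    HasNoIsolatedPoint (curveOfNormals f) := by
  rintro n q hq _ ⟨p, hp, hn, rfl⟩ hqp
  rw [Ne, eval_rep_mk_eq_zero_iff hq] at hqp
  obtain ⟨i, hi⟩ := normalVector_ne_zero_iff.1 hn
  have hU : {x | normalVector f x ≠ 0 ∧ eval (normalVector f x) q ≠ 0} ∈ 𝓝 p := by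
    refine IsOpen.mem_nhds (IsOpen.inter ?_ ?_) ⟨hn, hqp⟩
    · exact isOpen_ne_fun (continuous_normalVector f) continuous_const
    · exact isOpen_ne_fun ((MvPolynomial.continuous_eval q).comp (continuous_normalVector f))
        continuous_const
  have hinf := infinite_zeros_of_mem_nhds hp hi hU
  set W := {x | x ∈ {x | normalVector f x ≠ 0 ∧ eval (normalVector f x) q ≠ 0} ∧ eval x f = 0}
  by_contra hfin
  rw [Set.not_infinite] at hfin
  have hex : ∀ x ∈ W, ∃ ℓ : DualPlane K, ∃ h : normalVector f x ≠ 0,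
      ℓ = Projectivization.mk K (normalVector f x) h := fun x hx => ⟨_, hx.1.1, rfl⟩
  choose! ℓ hℓ using hex
  -- A point `y` with the same normal as `x` lies on the normal line at `x`. By hypothesis `f` does
  -- not vanish identically on that line, so only finitely many points share a normal.
  refine hinf (Set.Finite.of_finite_fibers ℓ (hfin.subset ?_) ?_)
  · rintro _ ⟨x, hx, rfl⟩
    obtain ⟨h, hx'⟩ := hℓ x hx
    exact ⟨⟨x, hx.2, h, hx'⟩, by rw [hx', Ne, eval_rep_mk_eq_zero_iff hq]; exact hx.1.2⟩
  · rintro _ ⟨x, hx, rfl⟩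
    obtain ⟨h, hx'⟩ := hℓ x hx
    obtain ⟨t, ht⟩ := hf x hx.2 h
    have hP : restrictLine x (fun i => eval x (pderiv i f)) f ≠ 0 := by
      intro h0
      rw [← eval_restrictLine, h0, Polynomial.eval_zero] at ht
      exact ht rfl
    refine Set.Finite.subset (((restrictLine x (fun i => eval x (pderiv i f)) f).roots.toFinset
      |>.finite_toSet).image fun s => x + s • fun i => eval x (pderiv i f)) ?_
    rintro y ⟨hy, hxy⟩
    obtain ⟨h', hy'⟩ := hℓ y hy
    have hxy' : ℓ y = ℓ x := hxy
    rw [hx', hy', Projectivization.mk_eq_mk_iff'] at hxy'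
    obtain ⟨a, ha⟩ := hxy'
    have hperp : normalVector f x ⬝ᵥ ![y 0, y 1, 1] = 0 := by
      have h1 : normalVector f y ⬝ᵥ ![y 0, y 1, 1] = 0 := by
        rw [dotProduct_normalVector]; ring
      have ha0 : a ≠ 0 := by
        rintro rfl
        rw [zero_smul] at ha
        exact h' ha.symm
      rw [← ha, smul_dotProduct, smul_eq_mul] at h1
      exact (mul_eq_zero.1 h1).resolve_left ha0
    rw [dotProduct_normalVector] at hperp
    have hs : ∃ s : K, y = x + s • fun i => eval x (pderiv i f) := by
      obtain ⟨i, hi⟩ := normalVector_ne_zero_iff.1 h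
      refine ⟨(y i - x i) * (eval x (pderiv i f))⁻¹, ?_⟩
      ext j
      simp only [Pi.add_apply, Pi.smul_apply, smul_eq_mul]
      fin_cases i <;> fin_cases j <;> simp only [Fin.zero_eta, Fin.mk_one] at hi ⊢ <;>
        field_simp <;>
        first | ring1 | linear_combination hperp | linear_combination -hperp
    obtain ⟨s, rfl⟩ := hs
    refine ⟨s, ?_, rfl⟩
    simp only [Finset.mem_coe, Multiset.mem_toFinset, Polynomial.mem_roots hP, Polynomial.IsRoot,
      eval_restrictLine]
    exact hy.2

/-- A normal whose direction is not isotropic is not contained in the curve. -/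
theorem exists_eval_ne_zero_of_not_isotropic {K : Type*} [Field K] {f : MvPolynomial (Fin 2) K}
    {p : Fin 2 → K} [Infinite K]
    (h : eval p (pderiv 0 f) ^ 2 + eval p (pderiv 1 f) ^ 2 ≠ 0) :
    ∃ t : K, eval (p + t • fun i => eval p (pderiv i f)) f ≠ 0 := by
  by_contra! hall
  have h0 : restrictLine p (fun i => eval p (pderiv i f)) f = 0 :=
    Polynomial.funext fun t => by rw [eval_restrictLine, hall, Polynomial.eval_zero]
  have h1 := eval_derivative_restrictLine p (fun i => eval p (pderiv i f)) f 0
  rw [h0, Polynomial.derivative_zero, Polynomial.eval_zero, Fin.sum_univ_two, zero_smul,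
    add_zero] at h1
  exact h (by linear_combination -h1)

/-- Over `ℝ` a nonzero gradient is never isotropic, so `f` has nonzero derivative along each of its
normals. -/
theorem hasNoIsolatedPoint_real (f : MvPolynomial (Fin 2) ℝ) :
    HasNoIsolatedPoint (curveOfNormals f) := by
  refine hasNoIsolatedPoint_curveOfNormals fun p _ hn => exists_eval_ne_zero_of_not_isotropic ?_
  obtain ⟨i, hi⟩ := normalVector_ne_zero_iff.1 hn
  fin_cases i
  · have := sq_pos_of_ne_zero hi
    have := sq_nonneg (eval p (pderiv 1 f))
    simp only [Fin.zero_eta] at *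
    positivity
  · have := sq_pos_of_ne_zero hi
    have := sq_nonneg (eval p (pderiv 0 f))
    simp only [Fin.mk_one] at *
    positivity

/-- The upper bound for the `ℝ`-degree. -/
theorem realDegree_curveOfNormals_le {f : MvPolynomial (Fin 2) ℝ} (hf : 1 ≤ f.totalDegree) :
    realDegree (curveOfNormals f) ≤ (f.totalDegree : ℕ∞) ^ 2 := by
  obtain ⟨n, h, h0, hn, hI⟩ := exists_projIdeal_eq_span (hasNoIsolatedPoint_real f)
    (projIdeal_curveOfNormals_ne_bot hf)
  have hnd := degree_le_of_projIdeal_eq_span hf h0 hn hI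
  refine iSup₂_le fun w hw => ?_
  obtain ⟨u, huw, hu⟩ := exists_eval_ne_zero_of_meetsTransversally hI hw
  refine (encard_projClosure_inter_pencil_le hn hI huw hu).trans ?_
  exact_mod_cast hnd

end Analysis

/-! ### Perturbed products of lines: leading forms and coprimality -/

section Arrangement

variable {K : Type*} [Field K]

/-- The affine polynomial `l 0 * X + l 1 * Y + l 2`. -/
def affineForm (l : Fin 3 → K) : MvPolynomial (Fin 2) K :=
  C (l 0) * X 0 + C (l 1) * X 1 + C (l 2)

/-- The linear part of `affineForm l`. -/
def linearPart (l : Fin 3 → K) : MvPolynomial (Fin 2) K :=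
  C (l 0) * X 0 + C (l 1) * X 1

/-- The equation satisfied by the feet of the normals through `z`. -/
def footPoly (f : MvPolynomial (Fin 2) K) (z : Fin 2 → K) : MvPolynomial (Fin 2) K :=
  (C (z 0) - X 0) * pderiv 1 f - (C (z 1) - X 1) * pderiv 0 f

theorem eval_footPoly (f : MvPolynomial (Fin 2) K) (z p : Fin 2 → K) :
    eval p (footPoly f z) =
      (z 0 - p 0) * eval p (pderiv 1 f) - (z 1 - p 1) * eval p (pderiv 0 f) := by
  simp [footPoly]

theorem footPoly_add (f g : MvPolynomial (Fin 2) K) (z : Fin 2 → K) :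
    footPoly (f + g) z = footPoly f z + footPoly g z := by
  simp only [footPoly, map_add]
  ring

theorem totalDegree_footPoly_le (f : MvPolynomial (Fin 2) K) (z : Fin 2 → K) :
    (footPoly f z).totalDegree ≤ f.totalDegree := by
  rcases Nat.eq_zero_or_pos f.totalDegree with h | h
  · rw [totalDegree_eq_zero_iff_eq_C] at h
    rw [h]
    simp [footPoly]
  · have h0 := totalDegree_pderiv_le 0 f
    have h1 := totalDegree_pderiv_le 1 f
    have h2 : ∀ i : Fin 2, (C (z i) - X i : MvPolynomial (Fin 2) K).totalDegree ≤ 1 := fun i =>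
      (totalDegree_sub _ _).trans (by simp)
    refine (totalDegree_sub _ _).trans (max_le ?_ ?_)
    · have := h2 0
      exact (totalDegree_mul _ _).trans (by omega)
    · have := h2 1
      exact (totalDegree_mul _ _).trans (by omega)

theorem dilate_affineForm (l : Fin 3 → K) :
    dilate (affineForm l) =
      Polynomial.C (linearPart l) * Polynomial.X + Polynomial.C (C (l 2)) := by
  have h : ∀ r : K, dilate (C r : MvPolynomial (Fin 2) K) = Polynomial.C (C r) := fun r => by
    simp [dilate, Polynomial.algebraMap_apply, algebraMap_eq]
  rw [affineForm, linearPart, map_add, map_add, map_mul, map_mul, h, h, h]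
  simp only [dilate, aeval_X, map_add, map_mul]
  ring

theorem homogeneousComponent_prod_affineForm {d : ℕ} (M : Fin d → Fin 3 → K) :
    homogeneousComponent d (∏ i, affineForm (M i)) = ∏ i, linearPart (M i) := by
  have h := Polynomial.coeff_prod_of_natDegree_le (s := Finset.univ)
    (fun i => dilate (affineForm (M i))) 1 fun i _ => by
      rw [dilate_affineForm]
      compute_degree
  rw [Finset.card_univ, Fintype.card_fin, mul_one, ← map_prod, coeff_dilate] at h
  rw [h]
  refine Finset.prod_congr rfl fun i _ => ?_
  rw [dilate_affineForm]
  simp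

theorem totalDegree_affineForm_le (l : Fin 3 → K) : (affineForm l).totalDegree ≤ 1 := by
  have h : ∀ (r : K) (i : Fin 2), (C r * X i : MvPolynomial (Fin 2) K).totalDegree ≤ 1 :=
    fun r i => (totalDegree_mul _ _).trans (by simp)
  refine (totalDegree_add _ _).trans
    (max_le ((totalDegree_add _ _).trans (max_le (h _ _) (h _ _))) ?_)
  simp

theorem totalDegree_prod_affineForm_le {ι : Type*} (s : Finset ι) (M : ι → Fin 3 → K) :
    (∏ i ∈ s, affineForm (M i)).totalDegree ≤ s.card := by
  refine (totalDegree_finsetProd _ _).trans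
    ((Finset.sum_le_card_nsmul _ _ 1 fun i _ => totalDegree_affineForm_le _).trans ?_)
  simp

theorem pderiv_affineForm_zero (l : Fin 3 → K) : pderiv 0 (affineForm l) = C (l 0) := by
  simp [affineForm, pderiv_X]

theorem pderiv_affineForm_one (l : Fin 3 → K) : pderiv 1 (affineForm l) = C (l 1) := by
  simp [affineForm, pderiv_X]

/-- The line through `z` perpendicular to the line `l`. -/
def perpLine (l : Fin 3 → K) (z : Fin 2 → K) : Fin 3 → K :=
  ![- l 1, l 0, z 0 * l 1 - z 1 * l 0]

theorem pderiv_prod {σ ι : Type*} [DecidableEq ι] (s : Finset ι)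
    (g : ι → MvPolynomial σ K) (k : σ) :
    pderiv k (∏ i ∈ s, g i) = ∑ i ∈ s, (∏ j ∈ s.erase i, g j) * pderiv k (g i) := by
  induction s using Finset.induction_on with
  | empty => simp
  | insert a s ha ih =>
    rw [Finset.prod_insert ha, Derivation.leibniz, ih, Finset.sum_insert ha,
      Finset.erase_insert ha, smul_eq_mul, smul_eq_mul, Finset.mul_sum, add_comm]
    congr 1
    refine Finset.sum_congr rfl fun i hi => ?_
    rw [Finset.erase_insert_of_ne (by rintro rfl; exact ha hi),
      Finset.prod_insert (fun h => ha (Finset.mem_of_mem_erase h)), mul_assoc]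

/-- By the Leibniz rule, each summand replaces one line by its perpendicular through `z`. It is
again a product of `d` affine forms, so its leading form is known. -/
theorem footPoly_prod_affineForm {d : ℕ} (L : Fin d → Fin 3 → K) (z : Fin 2 → K) :
    footPoly (∏ i, affineForm (L i)) z =
      ∑ i, ∏ j, affineForm (Function.update L i (perpLine (L i) z) j) := by
  classical
  have h : ∀ i, ∏ j, affineForm (Function.update L i (perpLine (L i) z) j) =
      (∏ j ∈ Finset.univ.erase i, affineForm (L j)) * affineForm (perpLine (L i) z) := by
    intro i
    rw [← Finset.prod_erase_mul _ _ (Finset.mem_univ i), Function.update_self]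
    congr 1
    exact Finset.prod_congr rfl fun j hj => by
      rw [Function.update_of_ne (Finset.ne_of_mem_erase hj)]
  simp only [h]
  rw [footPoly, pderiv_prod, pderiv_prod, Finset.mul_sum, Finset.mul_sum,
    ← Finset.sum_sub_distrib]
  refine Finset.sum_congr rfl fun i _ => ?_
  rw [pderiv_affineForm_zero, pderiv_affineForm_one, affineForm, perpLine]
  simp only [Matrix.cons_val_zero, Matrix.cons_val_one, Matrix.cons_val, map_neg,
    map_sub, map_mul]
  ring

/-- By Cramer's rule a common divisor divides both variables, up to the nonzero determinant. -/
theorem isRelPrime_linearPart {u v : Fin 3 → K} (h : u 0 * v 1 - u 1 * v 0 ≠ 0) :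
    IsRelPrime (linearPart u) (linearPart v) := by
  intro c hu hv
  have hC : IsUnit (C (u 0 * v 1 - u 1 * v 0) : MvPolynomial (Fin 2) K) := (IsUnit.mk0 _ h).map C
  have h0 : c ∣ X 0 := by
    rw [← hC.dvd_mul_left]
    have := dvd_sub (hu.mul_left (C (v 1))) (hv.mul_left (C (u 1)))
    convert this using 1
    simp only [linearPart, map_sub, map_mul]
    ring
  have h1 : c ∣ X 1 := by
    rw [← hC.dvd_mul_left]
    have := dvd_sub (hv.mul_left (C (u 0))) (hu.mul_left (C (v 0)))
    convert this using 1
    simp only [linearPart, map_sub, map_mul]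
    ring
  have hX : Irreducible (X 0 : MvPolynomial (Fin 2) K) := X_prime.irreducible
  rcases hX.dvd_iff.1 h0 with hc | hc
  · exact hc
  · exfalso
    have h2 : (X 0 : MvPolynomial (Fin 2) K) ∣ X 1 := hc.dvd.trans h1
    exact absurd (X_dvd_X.1 h2) zero_ne_one

theorem linearPart_not_isUnit (u : Fin 3 → K) : ¬ IsUnit (linearPart u) := by
  intro h
  have := h.map (eval (0 : Fin 2 → K))
  simp [linearPart] at this

variable {d : ℕ} {L : Fin d → Fin 3 → K} {R : MvPolynomial (Fin 2) K}

theorem linearPart_ne_zero {u : Fin 3 → K} (h : u 0 ^ 2 + u 1 ^ 2 ≠ 0) : linearPart u ≠ 0 := by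
  intro h0
  apply h
  have := congrArg (eval (u ∘ Fin.castSucc)) h0
  simp [linearPart] at this
  linear_combination this

/-- Modulo the `i`-th linear form only the `i`-th summand survives. Its factors are the other lines,
not parallel to line `i`, and the perpendicular, which has a different direction because line `i` is
not isotropic. Geometrically, the curve and its foot curve do not meet at infinity. -/
theorem isRelPrime_top (hpar : ∀ i j, i ≠ j → L i 0 * L j 1 - L i 1 * L j 0 ≠ 0)
    (hiso : ∀ i, L i 0 ^ 2 + L i 1 ^ 2 ≠ 0) (z : Fin 2 → K) :
    IsRelPrime (∏ i, linearPart (L i))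
      (∑ i, ∏ j, linearPart (Function.update L i (perpLine (L i) z) j)) := by
  classical
  refine IsRelPrime.prod_left fun i _ => ?_
  rw [← Finset.add_sum_erase _ _ (Finset.mem_univ i)]
  have hdvd : linearPart (L i) ∣ ∑ k ∈ Finset.univ.erase i,
      ∏ j, linearPart (Function.update L k (perpLine (L k) z) j) := by
    refine Finset.dvd_sum fun k hk => ?_
    have h := Finset.dvd_prod_of_mem
      (fun j => linearPart (Function.update L k (perpLine (L k) z) j)) (Finset.mem_univ i)
    simpa only [Function.update_of_ne (Finset.ne_of_mem_erase hk).symm] using h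
  obtain ⟨r, hr⟩ := hdvd
  rw [hr]
  refine IsRelPrime.add_mul_left_right ?_ r
  refine IsRelPrime.prod_right fun j _ => isRelPrime_linearPart ?_
  rcases eq_or_ne j i with rfl | hj
  · rw [Function.update_self]
    simp only [perpLine, Matrix.cons_val_zero, Matrix.cons_val_one]
    convert hiso j using 1
    ring
  · rw [Function.update_of_ne hj]
    exact hpar i j hj.symm

theorem totalDegree_prod_add (hiso : ∀ i, L i 0 ^ 2 + L i 1 ^ 2 ≠ 0) (hR : R.totalDegree < d) :
    (∏ i, affineForm (L i) + R).totalDegree = d := by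
  refine le_antisymm ?_ ?_
  · refine (totalDegree_add _ _).trans (max_le ?_ hR.le)
    simpa using totalDegree_prod_affineForm_le Finset.univ L
  · by_contra! h
    have h1 := homogeneousComponent_eq_zero _ _ h
    rw [map_add, homogeneousComponent_prod_affineForm, homogeneousComponent_eq_zero _ _ hR,
      add_zero] at h1
    exact Finset.prod_ne_zero_iff.2 (fun i _ => linearPart_ne_zero (hiso i)) h1

/-- The leading form of a common divisor divides both leading forms, which are coprime; so it is
constant, and so is the divisor. -/
theorem isRelPrime_footPoly (hpar : ∀ i j, i ≠ j → L i 0 * L j 1 - L i 1 * L j 0 ≠ 0)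
    (hiso : ∀ i, L i 0 ^ 2 + L i 1 ^ 2 ≠ 0) (hR : R.totalDegree < d) (z : Fin 2 → K) :
    footPoly (∏ i, affineForm (L i) + R) z ≠ 0 ∧
    IsRelPrime (∏ i, affineForm (L i) + R) (footPoly (∏ i, affineForm (L i) + R) z) := by
  have htop := isRelPrime_top hpar hiso z
  set F := ∏ i, linearPart (L i) with hF
  set Φ := ∑ i, ∏ j, linearPart (Function.update L i (perpLine (L i) z) j) with hΦ
  set f := ∏ i, affineForm (L i) + R with hf
  have hf1 : homogeneousComponent d f = F := by
    rw [hf, map_add, homogeneousComponent_prod_affineForm, homogeneousComponent_eq_zero _ _ hR,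
      add_zero]
  have hφ1 : homogeneousComponent d (footPoly f z) = Φ := by
    rw [hf, footPoly_add, map_add, homogeneousComponent_eq_zero _ _
      ((totalDegree_footPoly_le R z).trans_lt hR), add_zero, footPoly_prod_affineForm, map_sum]
    exact Finset.sum_congr rfl fun i _ => homogeneousComponent_prod_affineForm _
  have hfd : f.totalDegree = d := totalDegree_prod_add hiso hR
  have hF0 : F ≠ 0 := Finset.prod_ne_zero_iff.2 fun i _ => linearPart_ne_zero (hiso i)
  have hFu : ¬ IsUnit F := by
    intro h
    rw [hF, IsUnit.prod_univ_iff] at h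
    exact linearPart_not_isUnit _ (h ⟨0, by omega⟩)
  have hΦ0 : Φ ≠ 0 := by
    intro h
    rw [h, isRelPrime_zero_right] at htop
    exact hFu htop
  have hlead : ∀ g : MvPolynomial (Fin 2) K, g.totalDegree ≤ d → homogeneousComponent d g ≠ 0 →
      (dilate g).leadingCoeff = homogeneousComponent d g := by
    intro g hg h0
    rw [← coeff_dilate] at h0 ⊢
    have h1 := Polynomial.le_natDegree_of_ne_zero h0
    have h2 := (natDegree_dilate_le g).trans hg
    rw [Polynomial.leadingCoeff, le_antisymm h2 h1]
  have hlf : (dilate f).leadingCoeff = F := by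
    rw [hlead f hfd.le (by rwa [hf1]), hf1]
  have hlφ : (dilate (footPoly f z)).leadingCoeff = Φ := by
    rw [hlead _ ((totalDegree_footPoly_le f z).trans hfd.le) (by rwa [hφ1]), hφ1]
  refine ⟨fun h => hΦ0 (by rw [← hφ1, h, map_zero]), fun q hqf hqφ => ?_⟩
  have hdvd : ∀ g, q ∣ g → (dilate q).leadingCoeff ∣ (dilate g).leadingCoeff := by
    rintro _ ⟨r, rfl⟩
    rw [map_mul, Polynomial.leadingCoeff_mul]
    exact dvd_mul_right _ _
  have h1 := hdvd f hqf
  have h2 := hdvd _ hqφ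
  rw [hlf] at h1
  rw [hlφ] at h2
  have hu := htop h1 h2
  have hk : (dilate q).leadingCoeff = homogeneousComponent (dilate q).natDegree q :=
    coeff_dilate _ _
  have hdeg : (dilate q).natDegree = 0 := by
    have h3 := (homogeneousComponent_isHomogeneous (dilate q).natDegree q)
    rw [← hk] at h3
    rw [← h3.totalDegree hu.ne_zero]
    obtain ⟨c, hc, hc'⟩ := (dvd_C_iff_exists (one_ne_zero (α := K))).1
      (show (dilate q).leadingCoeff ∣ C 1 by rw [C_1]; exact hu.dvd)
    rw [hc', totalDegree_C]
  have hq : q = (dilate q).leadingCoeff := by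
    conv_lhs => rw [← eval_one_dilate q]
    rw [Polynomial.eq_C_of_natDegree_eq_zero hdeg]
    simp
  rw [hq]
  exact hu

/-- Over `ℂ` the gradient `v` may be isotropic. Then no line of the arrangement has direction `v`,
since the lines are not isotropic, so the restriction of `f` to the normal has degree exactly `d ≥
1`. -/
theorem exists_eval_normal_ne_zero [Infinite K] (hiso : ∀ i, L i 0 ^ 2 + L i 1 ^ 2 ≠ 0)
    (hR : R.totalDegree < d) {f : MvPolynomial (Fin 2) K} (hf : f = ∏ i, affineForm (L i) + R)
    (p : Fin 2 → K) (hn : normalVector f p ≠ 0) :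
    ∃ t : K, eval (p + t • fun i => eval p (pderiv i f)) f ≠ 0 := by
  by_cases hv : eval p (pderiv 0 f) ^ 2 + eval p (pderiv 1 f) ^ 2 = 0
  swap
  · exact exists_eval_ne_zero_of_not_isotropic hv
  set v : Fin 2 → K := fun i => eval p (pderiv i f) with hvdef
  have hv' : v 0 ^ 2 + v 1 ^ 2 = 0 := hv
  have hne : ∀ i, L i 0 * v 0 + L i 1 * v 1 ≠ 0 := by
    intro i h
    have h0 : (L i 0 ^ 2 + L i 1 ^ 2) * v 0 ^ 2 = 0 := by
      linear_combination (L i 0 * v 0 - L i 1 * v 1) * h + L i 1 ^ 2 * hv'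
    have h0' : v 0 = 0 := by
      simpa using (mul_eq_zero.1 h0).resolve_left (hiso i)
    have h1' : v 1 = 0 := by
      rw [h0'] at hv'
      simpa using hv'
    obtain ⟨k, hk⟩ := normalVector_ne_zero_iff.1 hn
    fin_cases k
    · exact hk h0'
    · exact hk h1'
  have hdeg : ∀ i, (restrictLine p v (affineForm (L i))).degree = 1 := by
    intro i
    have : restrictLine p v (affineForm (L i)) =
        Polynomial.C (L i 0 * v 0 + L i 1 * v 1) * Polynomial.X +
          Polynomial.C (L i 0 * p 0 + L i 1 * p 1 + L i 2) := by
      simp [restrictLine, affineForm]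
      ring
    rw [this, Polynomial.degree_linear (hne i)]
  have hf0 : restrictLine p v f ≠ 0 := by
    intro h
    rw [hf, map_add, map_prod] at h
    have h1 : (∏ i, restrictLine p v (affineForm (L i))).degree = d := by
      rw [Polynomial.degree_prod, Finset.sum_congr rfl fun i _ => hdeg i]
      simp
    rw [eq_neg_of_add_eq_zero_left h, Polynomial.degree_neg] at h1
    have h2 := natDegree_restrictLine_le p v R
    rw [Polynomial.natDegree_eq_of_degree_eq_some h1] at h2
    omega
  by_contra! hall
  exact hf0 (Polynomial.funext fun t => by rw [eval_restrictLine, hall, Polynomial.eval_zero])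

end Arrangement

/-! ### Consequences of having `d ^ 2` feet -/

section Feet

variable {K : Type*} [RCLike K]

/-- A maximal system of feet of normals through `z` to the curve `f = 0`, where `f` is the sum of a
product of `d` affine forms in general directions and a polynomial of smaller degree. -/
structure IsFeetSystem {d : ℕ} (L : Fin d → Fin 3 → K) (R : MvPolynomial (Fin 2) K)
    (z : Fin 2 → K) (P : Fin d × Fin d → Fin 2 → K) : Prop where
  not_parallel : ∀ i j, i ≠ j → L i 0 * L j 1 - L i 1 * L j 0 ≠ 0
  not_isotropic : ∀ i, L i 0 ^ 2 + L i 1 ^ 2 ≠ 0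
  totalDegree_lt : R.totalDegree < d
  eval_eq_zero : ∀ a, eval (P a) (∏ i, affineForm (L i) + R) = 0
  eval_footPoly : ∀ a, eval (P a) (footPoly (∏ i, affineForm (L i) + R) z) = 0
  nonsingular : ∀ a, normalVector (∏ i, affineForm (L i) + R) (P a) ≠ 0
  wedge_ne_zero : ∀ a b, a ≠ b →
    (P a 0 - z 0) * (P b 1 - z 1) - (P a 1 - z 1) * (P b 0 - z 0) ≠ 0

namespace IsFeetSystem

variable {d : ℕ} {L : Fin d → Fin 3 → K} {R : MvPolynomial (Fin 2) K} {z : Fin 2 → K}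
  {P : Fin d × Fin d → Fin 2 → K}

theorem injective (h : IsFeetSystem L R z P) : Function.Injective P := by
  intro a b hab
  by_contra hne
  apply h.wedge_ne_zero a b hne
  rw [hab]
  ring

/-- The system already attains Bézout's bound, so there is no room for further common zeros. -/
theorem commonZeros_eq (h : IsFeetSystem L R z P) :
    {p | eval p (∏ i, affineForm (L i) + R) = 0 ∧
      eval p (footPoly (∏ i, affineForm (L i) + R) z) = 0} = Set.range P := by
  have hf0 : ∏ i, affineForm (L i) + R ≠ 0 := by
    intro h0
    have h1 := totalDegree_prod_add h.not_isotropic h.totalDegree_lt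
    have h2 := h.totalDegree_lt
    rw [h0, totalDegree_zero] at h1
    omega
  obtain ⟨hφ0, hrel⟩ := isRelPrime_footPoly h.not_parallel h.not_isotropic h.totalDegree_lt z
  have hle := encard_commonZeros_le hf0 hφ0 hrel
  have hdeg := totalDegree_footPoly_le (∏ i, affineForm (L i) + R) z
  rw [totalDegree_prod_add h.not_isotropic h.totalDegree_lt] at hle hdeg
  have hcard : (Set.range P).encard = ((d * d : ℕ) : ℕ∞) := by
    rw [← Set.image_univ, h.injective.encard_image, Set.encard_univ]
    simp
  symm
  refine Set.Finite.eq_of_subset_of_encard_le (Set.finite_range P) ?_ ?_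
  · rintro _ ⟨a, rfl⟩
    exact ⟨h.eval_eq_zero a, h.eval_footPoly a⟩
  · rw [hcard]
    exact hle.trans (Nat.cast_le.2 (Nat.mul_le_mul_left d hdeg))

theorem exists_eq_of_commonZero (h : IsFeetSystem L R z P) {p : Fin 2 → K}
    (h1 : eval p (∏ i, affineForm (L i) + R) = 0)
    (h2 : eval p (PlaneNormals.footPoly (∏ i, affineForm (L i) + R) z) = 0) : ∃ a, P a = p := by
  have : p ∈ {p | eval p (∏ i, affineForm (L i) + R) = 0 ∧
      eval p (PlaneNormals.footPoly (∏ i, affineForm (L i) + R) z) = 0} := ⟨h1, h2⟩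
  rwa [h.commonZeros_eq] at this

theorem mem_pencil_mk_iff {K : Type*} [Field K] {f : MvPolynomial (Fin 2) K} {z p : Fin 2 → K}
    (hn : normalVector f p ≠ 0) :
    Projectivization.mk K (normalVector f p) hn ∈ pencil (toProj z) ↔
      eval p (PlaneNormals.footPoly f z) = 0 := by
  rw [PlaneNormals.eval_footPoly, ← dotProduct_normalVector]
  exact Projectivization.orthogonal_mk _ _

theorem normalsThrough_eq (h : IsFeetSystem L R z P) :
    normalsThrough (∏ i, affineForm (L i) + R) z =
      Set.range fun a => Projectivization.mk K _ (h.nonsingular a) := by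
  ext ℓ
  constructor
  · rintro ⟨⟨p, hp, hn, rfl⟩, hz⟩
    obtain ⟨a, rfl⟩ := h.exists_eq_of_commonZero hp ((mem_pencil_mk_iff hn).1 hz)
    exact ⟨a, rfl⟩
  · rintro ⟨a, rfl⟩
    exact ⟨⟨P a, h.eval_eq_zero a, h.nonsingular a, rfl⟩,
      (mem_pencil_mk_iff _).2 (h.eval_footPoly a)⟩

theorem eq_zero_of_dotProduct {K : Type*} [Field K] {n : Fin 3 → K} {z p q : Fin 2 → K}
    (hz : n ⬝ᵥ ![z 0, z 1, 1] = 0) (hp : n ⬝ᵥ ![p 0, p 1, 1] = 0) (hq : n ⬝ᵥ ![q 0, q 1, 1] = 0)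
    (h : (p 0 - z 0) * (q 1 - z 1) - (p 1 - z 1) * (q 0 - z 0) ≠ 0) : n = 0 := by
  simp only [dotProduct, Fin.sum_univ_three, Matrix.cons_val_zero, Matrix.cons_val_one,
    Matrix.cons_val] at hz hp hq
  have h0 : n 0 = 0 := by
    refine (mul_eq_zero.1 (?_ : n 0 * _ = 0)).resolve_right h
    linear_combination (q 1 - z 1) * (hp - hz) - (p 1 - z 1) * (hq - hz)
  have h1 : n 1 = 0 := by
    refine (mul_eq_zero.1 (?_ : n 1 * _ = 0)).resolve_right h
    linear_combination (p 0 - z 0) * (hq - hz) - (q 0 - z 0) * (hp - hz)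
  have h2 : n 2 = 0 := by
    rw [h0, h1] at hz
    simpa using hz
  ext i
  fin_cases i <;> assumption

/-- A common normal would contain the three noncollinear points `z`, `p`, `q`. -/
theorem normal_injective {K : Type*} [Field K] {f : MvPolynomial (Fin 2) K} {z p q : Fin 2 → K}
    (hp : normalVector f p ≠ 0) (hq : normalVector f q ≠ 0)
    (hpz : eval p (PlaneNormals.footPoly f z) = 0)
    (h : (p 0 - z 0) * (q 1 - z 1) - (p 1 - z 1) * (q 0 - z 0) ≠ 0) :
    Projectivization.mk K _ hp ≠ Projectivization.mk K _ hq := by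
  intro heq
  rw [Projectivization.mk_eq_mk_iff'] at heq
  obtain ⟨c, hc⟩ := heq
  rw [PlaneNormals.eval_footPoly, ← dotProduct_normalVector] at hpz
  refine hp (eq_zero_of_dotProduct hpz ?_ ?_ h)
  · rw [dotProduct_normalVector]; ring
  · rw [← hc, smul_dotProduct, dotProduct_normalVector]
    simp

theorem encard_normalsThrough (h : IsFeetSystem L R z P) :
    (normalsThrough (∏ i, affineForm (L i) + R) z).encard = (d : ℕ∞) ^ 2 := by
  have hinj : Function.Injective fun a => Projectivization.mk K _ (h.nonsingular a) := by
    intro a b hab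
    by_contra hne
    exact normal_injective (h.nonsingular a) (h.nonsingular b) (h.eval_footPoly a)
      (h.wedge_ne_zero a b hne) hab
  rw [h.normalsThrough_eq, ← Set.image_univ, hinj.encard_image, Set.encard_univ]
  simp [sq]

/-- A singular point is a zero of the foot polynomial, hence belongs to the system, all of whose
points are nonsingular. -/
theorem isNonsingular (h : IsFeetSystem L R z P) :
    IsNonsingular (∏ i, affineForm (L i) + R) := by
  intro p hp
  by_contra! hall
  obtain ⟨a, rfl⟩ := h.exists_eq_of_commonZero hp
    (by rw [PlaneNormals.eval_footPoly, hall, hall]; ring)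
  exact (normalVector_ne_zero_iff.1 (h.nonsingular a)).elim fun i hi => hi (hall i)

/-- A repeated factor divides both partial derivatives, hence the foot polynomial, which is coprime
to the equation. -/
theorem squarefree (h : IsFeetSystem L R z P) : Squarefree (∏ i, affineForm (L i) + R) := by
  obtain ⟨-, hrel⟩ := isRelPrime_footPoly h.not_parallel h.not_isotropic h.totalDegree_lt z
  rintro q ⟨r, hr⟩
  have hd : ∀ i, q ∣ pderiv i (∏ i, affineForm (L i) + R) := by
    intro i
    rw [hr, mul_assoc, pderiv_mul]
    exact dvd_add ((dvd_mul_right q r).mul_left _) (dvd_mul_right q _)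
  exact hrel (by rw [hr, mul_assoc]; exact dvd_mul_right _ _)
    (dvd_sub ((hd 1).mul_left _) ((hd 0).mul_left _))

/-- The pencil of `z` carries `d ^ 2` normals and is not contained in the closure, so the degree `n`
is at least `d ^ 2`; Hilbert functions give the opposite inequality. With equality, the number of
common points is the degree, and transversality follows. -/
theorem exists_equation (h : IsFeetSystem L R z P) :
    HasDegree (curveOfNormals (∏ i, affineForm (L i) + R)) (d ^ 2) ∧
    MeetsTransversally (toProj z) (curveOfNormals (∏ i, affineForm (L i) + R)) ∧
    (projClosure (curveOfNormals (∏ i, affineForm (L i) + R)) ∩ pencil (toProj z)).encard =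
      (d : ℕ∞) ^ 2 := by
  have hcard := h.encard_normalsThrough
  have hdeg := totalDegree_prod_add h.not_isotropic h.totalDegree_lt
  have hiso := hasNoIsolatedPoint_curveOfNormals fun p _ hn =>
    exists_eval_normal_ne_zero h.not_isotropic h.totalDegree_lt rfl p hn
  set f := ∏ i, affineForm (L i) + R
  have hd : 1 ≤ f.totalDegree := by have := h.totalDegree_lt; omega
  obtain ⟨n, e, he0, hn, hI⟩ := exists_projIdeal_eq_span hiso (projIdeal_curveOfNormals_ne_bot hd)
  have hle := degree_le_of_projIdeal_eq_span hd he0 hn hI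
  rw [hdeg] at hle
  obtain ⟨u, huz, hu⟩ := exists_eval_ne_zero_of_finite hiso he0 hn hI z
    (Set.finite_of_encard_eq_coe (k := d ^ 2) (by push_cast; exact hcard))
  have h1 := encard_projClosure_inter_pencil_le hn hI huz hu
  have h2 : (d : ℕ∞) ^ 2 ≤ (projClosure (curveOfNormals f) ∩ pencil (toProj z)).encard := by
    rw [← hcard]
    exact Set.encard_le_encard (Set.inter_subset_inter_left _ (subset_projClosure _))
  obtain rfl : n = d ^ 2 := le_antisymm hle (by exact_mod_cast h2.trans h1)
  have h3 : (projClosure (curveOfNormals f) ∩ pencil (toProj z)).encard = ((d ^ 2 : ℕ) : ℕ∞) :=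
    le_antisymm h1 (by push_cast; exact h2)
  exact ⟨⟨e, he0, hn, hI⟩, meetsTransversally_of_encard_eq hn hI huz hu h3, by
    rw [h3]; push_cast; rfl⟩

end IsFeetSystem

theorem realDegree_eq_of_isFeetSystem {d : ℕ} {L : Fin d → Fin 3 → ℝ} {R : MvPolynomial (Fin 2) ℝ}
    {z : Fin 2 → ℝ} {P : Fin d × Fin d → Fin 2 → ℝ} (h : IsFeetSystem L R z P) :
    realDegree (curveOfNormals (∏ i, affineForm (L i) + R)) = (d : ℕ∞) ^ 2 := by
  have hdeg := totalDegree_prod_add h.not_isotropic h.totalDegree_lt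
  obtain ⟨-, h1, h2⟩ := h.exists_equation
  refine le_antisymm ?_ ?_
  · have h3 := realDegree_curveOfNormals_le (f := ∏ i, affineForm (L i) + R)
      (by have := h.totalDegree_lt; omega)
    rwa [hdeg] at h3
  · rw [← h2]
    exact le_iSup₂_of_le (toProj z) h1 le_rfl

section Complexify

theorem eval_complexify (f : MvPolynomial (Fin 2) ℝ) (p : Fin 2 → ℝ) :
    eval (toComplex p) (complexify f) = ((eval p f : ℝ) : ℂ) := by
  have h := MvPolynomial.eval₂_comp_left (algebraMap ℝ ℂ) (RingHom.id ℝ) p f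
  rw [complexify, eval_map]
  exact h.symm

theorem complexify_affineForm (l : Fin 3 → ℝ) :
    complexify (affineForm l) = affineForm fun i => (l i : ℂ) := by
  simp [complexify, affineForm]

theorem complexify_prod_add {d : ℕ} (L : Fin d → Fin 3 → ℝ) (R : MvPolynomial (Fin 2) ℝ) :
    complexify (∏ i, affineForm (L i) + R) =
      ∏ i, affineForm (fun j => (L i j : ℂ)) + complexify R := by
  rw [complexify, map_add, map_prod]
  congr 1
  exact Finset.prod_congr rfl fun i _ => complexify_affineForm (L i)

theorem eval_pderiv_complexify (f : MvPolynomial (Fin 2) ℝ) (p : Fin 2 → ℝ) (i : Fin 2) :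
    eval (toComplex p) (pderiv i (complexify f)) = ((eval p (pderiv i f) : ℝ) : ℂ) := by
  rw [complexify, pderiv_map]
  exact eval_complexify _ p

theorem totalDegree_complexify_le (f : MvPolynomial (Fin 2) ℝ) :
    (complexify f).totalDegree ≤ f.totalDegree := by
  have h : (complexify f).support ⊆ f.support := support_map_subset (algebraMap ℝ ℂ) f
  exact Finset.sup_mono h

/-- All conditions are polynomial equations and inequations in real data, or degree bounds. Bézout
over `ℂ` then shows that the real feet are all the complex ones. -/
theorem isFeetSystem_complexify {d : ℕ} {L : Fin d → Fin 3 → ℝ} {R : MvPolynomial (Fin 2) ℝ}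
    {z : Fin 2 → ℝ} {P : Fin d × Fin d → Fin 2 → ℝ} (h : IsFeetSystem L R z P) :
    IsFeetSystem (fun i j => (L i j : ℂ)) (complexify R) (toComplex z)
      (fun a => toComplex (P a)) where
  not_parallel i j hij := by exact_mod_cast h.not_parallel i j hij
  not_isotropic i := by exact_mod_cast h.not_isotropic i
  totalDegree_lt := (totalDegree_complexify_le R).trans_lt h.totalDegree_lt
  eval_eq_zero a := by
    rw [← complexify_prod_add, eval_complexify, h.eval_eq_zero a, Complex.ofReal_zero]
  eval_footPoly a := by
    have := h.eval_footPoly a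
    rw [eval_footPoly] at this
    rw [← complexify_prod_add, eval_footPoly, eval_pderiv_complexify, eval_pderiv_complexify]
    simp only [toComplex]
    exact_mod_cast this
  nonsingular a := by
    rw [normalVector_ne_zero_iff]
    obtain ⟨i, hi⟩ := normalVector_ne_zero_iff.1 (h.nonsingular a)
    refine ⟨i, ?_⟩
    rw [← complexify_prod_add, eval_pderiv_complexify]
    exact_mod_cast hi
  wedge_ne_zero a b hab := by
    have := h.wedge_ne_zero a b hab
    simp only [toComplex]
    exact_mod_cast this

theorem allNormalsReal_of_isFeetSystem {d : ℕ} {L : Fin d → Fin 3 → ℝ}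
    {R : MvPolynomial (Fin 2) ℝ} {z : Fin 2 → ℝ} {P : Fin d × Fin d → Fin 2 → ℝ}
    (h : IsFeetSystem L R z P) : AllNormalsReal (∏ i, affineForm (L i) + R) z := by
  rintro p _ ⟨hp, hn, rfl⟩ hz
  have h' := isFeetSystem_complexify h
  rw [IsFeetSystem.mem_pencil_mk_iff hn] at hz
  rw [complexify_prod_add] at hp hz
  obtain ⟨a, rfl⟩ := h'.exists_eq_of_commonZero hp hz
  exact ⟨P a, rfl⟩

end Complexify

end Feet

/-! ### Continuation of nondegenerate solutions -/

section ImplicitFunction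

/-- The derivative in the parameter is left unspecified, since it does not enter the nondegeneracy
condition. -/
theorem fderiv_apply_eq {A : ℝ × ℝ × ℝ → ℝ} {s₀ t₀ as at' : ℝ}
    (hA : DifferentiableAt ℝ A (0, s₀, t₀))
    (hAs : HasDerivAt (fun s => A (0, s, t₀)) as s₀)
    (hAt : HasDerivAt (fun t => A (0, s₀, t)) at' t₀) (v : ℝ × ℝ × ℝ) :
    fderiv ℝ A (0, s₀, t₀) v =
      v.1 * fderiv ℝ A (0, s₀, t₀) (1, 0, 0) + v.2.1 * as + v.2.2 * at' := by
  have h1 : fderiv ℝ A (0, s₀, t₀) (0, 1, 0) = as := by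
    have h := hA.hasFDerivAt.comp_hasDerivAt s₀ (f := fun s : ℝ => ((0 : ℝ), s, t₀))
      ((hasDerivAt_const s₀ (0 : ℝ)).prodMk ((hasDerivAt_id s₀).prodMk (hasDerivAt_const s₀ t₀)))
    exact h.unique hAs
  have h2 : fderiv ℝ A (0, s₀, t₀) (0, 0, 1) = at' := by
    have h := hA.hasFDerivAt.comp_hasDerivAt t₀ (f := fun t : ℝ => ((0 : ℝ), s₀, t))
      ((hasDerivAt_const t₀ (0 : ℝ)).prodMk ((hasDerivAt_const t₀ s₀).prodMk (hasDerivAt_id t₀)))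
    exact h.unique hAt
  have hv : v = v.1 • ((1 : ℝ), (0 : ℝ), (0 : ℝ)) + v.2.1 • ((0 : ℝ), (1 : ℝ), (0 : ℝ)) +
      v.2.2 • ((0 : ℝ), (0 : ℝ), (1 : ℝ)) := by
    ext <;> simp
  conv_lhs => rw [hv]
  rw [map_add, map_add, map_smul, map_smul, map_smul, h1, h2]
  rfl

/-- A nondegenerate solution of two equations in two unknowns depends continuously on a
parameter. -/
theorem exists_tendsto_zeros {A B : ℝ × ℝ × ℝ → ℝ} (hA : ContDiff ℝ 1 A) (hB : ContDiff ℝ 1 B)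
    {s₀ t₀ as at' bs bt : ℝ} (hA0 : A (0, s₀, t₀) = 0) (hB0 : B (0, s₀, t₀) = 0)
    (hAs : HasDerivAt (fun s => A (0, s, t₀)) as s₀)
    (hAt : HasDerivAt (fun t => A (0, s₀, t)) at' t₀)
    (hBs : HasDerivAt (fun s => B (0, s, t₀)) bs s₀)
    (hBt : HasDerivAt (fun t => B (0, s₀, t)) bt t₀) (hdet : as * bt - at' * bs ≠ 0) :
    ∃ q : ℝ → ℝ × ℝ, Tendsto q (𝓝 0) (𝓝 (s₀, t₀)) ∧
      ∀ᶠ δ in 𝓝 0, A (δ, q δ) = 0 ∧ B (δ, q δ) = 0 := by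
  -- Keeping the parameter as a coordinate reduces the claim to the inverse function theorem; the
  -- path is the local inverse along `(δ, 0, 0)`.
  let Ψ : ℝ × ℝ × ℝ → ℝ × ℝ × ℝ := fun x => (x.1, A x, B x)
  have hAd := fderiv_apply_eq (hA.differentiable one_ne_zero _) hAs hAt
  have hBd := fderiv_apply_eq (hB.differentiable one_ne_zero _) hBs hBt
  set DA := fderiv ℝ A (0, s₀, t₀)
  set DB := fderiv ℝ B (0, s₀, t₀)
  let D : ℝ × ℝ × ℝ →L[ℝ] ℝ × ℝ × ℝ := (ContinuousLinearMap.fst ℝ ℝ (ℝ × ℝ)).prod (DA.prod DB)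
  have hD : ∀ v, D v = (v.1, DA v, DB v) := fun v => rfl
  have hΨ : HasStrictFDerivAt Ψ D (0, s₀, t₀) :=
    (ContinuousLinearMap.fst ℝ ℝ (ℝ × ℝ)).hasStrictFDerivAt.prodMk
      ((hA.hasStrictFDerivAt one_ne_zero).prodMk (hB.hasStrictFDerivAt one_ne_zero))
  have hker : (D : ℝ × ℝ × ℝ →ₗ[ℝ] ℝ × ℝ × ℝ).ker = ⊥ := by
    rw [LinearMap.ker_eq_bot']
    rintro ⟨x, y, w⟩ hv
    have hv' : ((x, DA (x, y, w), DB (x, y, w)) : ℝ × ℝ × ℝ) = 0 := hv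
    obtain ⟨h1, h2, h3⟩ : x = 0 ∧ DA (x, y, w) = 0 ∧ DB (x, y, w) = 0 := by
      simpa [Prod.ext_iff] using hv'
    rw [hAd] at h2
    rw [hBd] at h3
    simp only [h1, zero_mul, zero_add] at h2 h3
    have hy : y = 0 := by
      refine (mul_eq_zero.1 (?_ : y * (as * bt - at' * bs) = 0)).resolve_right hdet
      linear_combination bt * h2 - at' * h3
    have hw : w = 0 := by
      refine (mul_eq_zero.1 (?_ : w * (as * bt - at' * bs) = 0)).resolve_right hdet
      linear_combination as * h3 - bs * h2
    rw [h1, hy, hw]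
    rfl
  have hrange : (D : ℝ × ℝ × ℝ →ₗ[ℝ] ℝ × ℝ × ℝ).range = ⊤ :=
    LinearMap.range_eq_top.2 (LinearMap.injective_iff_surjective.1 (LinearMap.ker_eq_bot.1 hker))
  let E := ContinuousLinearEquiv.ofBijective D hker hrange
  have hE : HasStrictFDerivAt Ψ (E : ℝ × ℝ × ℝ →L[ℝ] ℝ × ℝ × ℝ) (0, s₀, t₀) := hΨ
  have hΨ0 : Ψ (0, s₀, t₀) = (0, 0, 0) := by simp only [Ψ, hA0, hB0]
  have htend := hE.localInverse_tendsto
  have hright := hE.eventually_right_inverse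
  rw [hΨ0] at htend hright
  have hline : Tendsto (fun δ : ℝ => (δ, (0 : ℝ), (0 : ℝ))) (𝓝 0) (𝓝 (0, 0, 0)) :=
    (Continuous.prodMk_left ((0 : ℝ), (0 : ℝ))).tendsto 0
  refine ⟨fun δ => (hE.localInverse Ψ E _ (δ, 0, 0)).2,
    (continuous_snd.tendsto _).comp (htend.comp hline), ?_⟩
  filter_upwards [hline.eventually hright] with δ hδ
  set r := hE.localInverse Ψ E _ (δ, 0, 0)
  have hδ' : (r.1, A r, B r) = (δ, (0 : ℝ), (0 : ℝ)) := hδ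
  obtain ⟨h1, h2, h3⟩ : r.1 = δ ∧ A r = 0 ∧ B r = 0 := by
    simpa [Prod.ext_iff] using hδ'
  have hr : (δ, r.2) = r := by rw [← h1]
  rw [hr]
  exact ⟨h2, h3⟩

theorem contDiff_eval (P : MvPolynomial (Fin 2) ℝ) : ContDiff ℝ 1 fun x : Fin 2 → ℝ => eval x P :=
  (AnalyticOnNhd.eval_mvPolynomial P).contDiff

end ImplicitFunction

/-! ### Feet near the perpendicular feet and near the nodes -/

section LocalFeet

/-- Along the path `p`, as `ε → 0`, the points `p ε` are nonsingular points of the curve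
`G + ε H = 0`, at which the normal passes through `z`. -/
def IsFootPath (G H : MvPolynomial (Fin 2) ℝ) (z v : Fin 2 → ℝ) (p : ℝ → Fin 2 → ℝ) : Prop :=
  Tendsto p (𝓝[>] 0) (𝓝 v) ∧ ∀ᶠ ε in 𝓝[>] (0 : ℝ), eval (p ε) (G + C ε * H) = 0 ∧
    eval (p ε) (footPoly (G + C ε * H) z) = 0 ∧ normalVector (G + C ε * H) (p ε) ≠ 0

theorem eval_affineForm (l : Fin 3 → ℝ) (p : Fin 2 → ℝ) :
    eval p (affineForm l) = l 0 * p 0 + l 1 * p 1 + l 2 := by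
  simp [affineForm]

theorem pderiv_affineForm (l : Fin 3 → ℝ) (k : Fin 2) :
    pderiv k (affineForm l) = C (l k.castSucc) := by
  fin_cases k
  · exact pderiv_affineForm_zero l
  · exact pderiv_affineForm_one l

theorem hasDerivAt_id_mul {g : ℝ → ℝ} (hg : DifferentiableAt ℝ g 0) :
    HasDerivAt (fun s => s * g s) (g 0) 0 := by
  have h := (hasDerivAt_id' (0 : ℝ)).mul hg.hasDerivAt
  rw [one_mul, zero_mul, add_zero] at h
  exact h

/-- The smoothing has a normal through `z` with foot near the foot `w` of the perpendicular from `z`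
to a line of the arrangement. -/
theorem exists_isFootPath_line {a : Fin 3 → ℝ} (ha : a 0 ^ 2 + a 1 ^ 2 ≠ 0)
    {z w : Fin 2 → ℝ} {κ : ℝ} (hw : ∀ i : Fin 2, z i - w i = κ * a i.castSucc)
    (hwa : eval w (affineForm a) = 0) {P H : MvPolynomial (Fin 2) ℝ} (hP : eval w P ≠ 0) :
    ∃ p, IsFootPath (affineForm a * P) H z w p := by
  have hw0 : z 0 - w 0 = κ * a 0 := hw 0
  have hw1 : z 1 - w 1 = κ * a 1 := hw 1
  -- In the coordinates `(ε, s, t)`, `s` runs along the normal `a` and `t` along the line itself, so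
  -- that the linear form becomes `s * (a 0 ^ 2 + a 1 ^ 2)`. `A` is the equation of the curve, `N`
  -- its gradient and `B` the foot equation.
  let pt : ℝ × ℝ × ℝ → Fin 2 → ℝ := fun x =>
    ![w 0 + (x.2.1 * a 0 - x.2.2 * a 1), w 1 + (x.2.1 * a 1 + x.2.2 * a 0)]
  have hpt : ContDiff ℝ 1 pt := by
    refine contDiff_pi.2 fun i => ?_
    fin_cases i <;> simp [pt] <;> fun_prop
  have hev : ∀ Q : MvPolynomial (Fin 2) ℝ, ContDiff ℝ 1 fun x => eval (pt x) Q := fun Q =>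
    (contDiff_eval Q).comp hpt
  have hl : ∀ x, eval (pt x) (affineForm a) = x.2.1 * (a 0 ^ 2 + a 1 ^ 2) := by
    intro x
    rw [eval_affineForm] at hwa ⊢
    simp only [pt, Matrix.cons_val_zero, Matrix.cons_val_one]
    linear_combination hwa
  let N : Fin 2 → ℝ × ℝ × ℝ → ℝ := fun k x => a k.castSucc * eval (pt x) P +
    x.2.1 * (a 0 ^ 2 + a 1 ^ 2) * eval (pt x) (pderiv k P) + x.1 * eval (pt x) (pderiv k H)
  have hN : ∀ k, ContDiff ℝ 1 (N k) := by
    intro k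
    have h1 := hev P
    have h2 := hev (pderiv k P)
    have h3 := hev (pderiv k H)
    fun_prop
  let A : ℝ × ℝ × ℝ → ℝ := fun x => x.2.1 * (a 0 ^ 2 + a 1 ^ 2) * eval (pt x) P +
    x.1 * eval (pt x) H
  let B : ℝ × ℝ × ℝ → ℝ := fun x => (z 0 - pt x 0) * N 1 x - (z 1 - pt x 1) * N 0 x
  have hA : ContDiff ℝ 1 A := by
    have h1 := hev P
    have h2 := hev H
    fun_prop
  have hB : ContDiff ℝ 1 B := by
    have h1 := hN 0
    have h2 := hN 1
    have h3 : ContDiff ℝ 1 fun x => pt x 0 := contDiff_pi.1 hpt 0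
    have h4 : ContDiff ℝ 1 fun x => pt x 1 := contDiff_pi.1 hpt 1
    fun_prop
  have hpt0 : pt (0, 0, 0) = w := by
    ext i; fin_cases i <;> simp [pt]
  have hAs : HasDerivAt (fun s => A (0, s, 0)) ((a 0 ^ 2 + a 1 ^ 2) * eval w P) 0 := by
    have h3 : Differentiable ℝ fun s : ℝ => eval (pt (0, s, 0)) P :=
      ((hev P).differentiable one_ne_zero).comp (by fun_prop)
    have h1 := hasDerivAt_id_mul ((h3 0).const_mul (a 0 ^ 2 + a 1 ^ 2))
    rw [hpt0] at h1
    refine h1.congr_of_eventuallyEq (Eventually.of_forall fun s => ?_)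
    simp only [A]
    ring
  have hAt : HasDerivAt (fun t => A (0, 0, t)) 0 0 := by
    have h0 : (fun t => A (0, 0, t)) = fun _ => 0 := by
      ext t
      simp [A]
    rw [h0]
    exact hasDerivAt_const _ _
  -- The value of this derivative is immaterial: the `t`-derivative of `A` is zero, so the Jacobian
  -- is triangular with both diagonal entries equal to `(a 0 ^ 2 + a 1 ^ 2) * eval w P`.
  have hBs : HasDerivAt (fun s => B (0, s, 0)) (deriv (fun s => B (0, s, 0)) 0) 0 := by
    have h3 : Differentiable ℝ fun s : ℝ => B (0, s, 0) :=
      (hB.differentiable one_ne_zero).comp (by fun_prop)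
    exact (h3 0).hasDerivAt
  have hBt : HasDerivAt (fun t => B (0, 0, t)) ((a 0 ^ 2 + a 1 ^ 2) * eval w P) 0 := by
    have h3 : Differentiable ℝ fun t : ℝ => eval (pt (0, 0, t)) P :=
      ((hev P).differentiable one_ne_zero).comp (by fun_prop)
    have h1 := hasDerivAt_id_mul ((h3 0).const_mul (a 0 ^ 2 + a 1 ^ 2))
    rw [hpt0] at h1
    refine h1.congr_of_eventuallyEq (Eventually.of_forall fun t => ?_)
    simp only [B, N, pt, Matrix.cons_val_zero, Matrix.cons_val_one, Fin.castSucc_zero,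
      Fin.castSucc_one]
    linear_combination (hw0 * a 1 - hw1 * a 0) * eval (pt (0, 0, t)) P
  obtain ⟨q, hq, hq0⟩ := exists_tendsto_zeros hA hB (by simp [A])
    (by
      simp only [B, N, hpt0, Fin.castSucc_zero, Fin.castSucc_one]
      linear_combination (hw0 * a 1 - hw1 * a 0) * eval w P)
    hAs hAt hBs hBt
    (by rw [zero_mul, sub_zero]; exact mul_ne_zero (mul_ne_zero ha hP) (mul_ne_zero ha hP))
  have hlim : Tendsto (fun ε => (ε, q ε)) (𝓝 0) (𝓝 ((0 : ℝ), (0 : ℝ), (0 : ℝ))) :=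
    tendsto_id.prodMk_nhds hq
  have hgrad : ∀ ε k, eval (pt (ε, q ε)) (pderiv k (affineForm a * P + C ε * H)) =
      N k (ε, q ε) := by
    intro ε k
    simp only [map_add, pderiv_mul, pderiv_C, map_mul, eval_C, hl, pderiv_affineForm, N, zero_mul,
      zero_add]
  refine ⟨fun ε => pt (ε, q ε), ?_, ?_⟩
  · have := (hpt.continuous.tendsto (0, 0, 0)).comp hlim
    rw [hpt0] at this
    exact this.mono_left nhdsWithin_le_nhds
  · refine Filter.Eventually.filter_mono nhdsWithin_le_nhds ?_
    have hne : ∃ k, N k (0, 0, 0) ≠ 0 := by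
      by_contra! hall
      have h0 := hall 0
      have h1 := hall 1
      simp only [N, hpt0, Fin.castSucc_zero, Fin.castSucc_one, zero_mul, add_zero] at h0 h1
      have h0' := (mul_eq_zero.1 h0).resolve_right hP
      have h1' := (mul_eq_zero.1 h1).resolve_right hP
      exact ha (by rw [h0', h1']; ring)
    obtain ⟨k, hk⟩ := hne
    have hNk : ∀ᶠ ε in 𝓝 (0 : ℝ), N k (ε, q ε) ≠ 0 :=
      (((hN k).continuous.tendsto (0, 0, 0)).comp hlim).eventually_ne hk
    filter_upwards [hq0, hNk] with ε hε hεk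
    refine ⟨?_, ?_, normalVector_ne_zero_iff.2 ⟨k, by rwa [hgrad]⟩⟩
    · rw [← hε.1]
      simp only [map_add, map_mul, eval_C, hl, A]
    · rw [eval_footPoly, hgrad, hgrad, ← hε.2]

/-- The smoothing has two normals through `z` with feet near a node `v`. -/
theorem exists_isFootPath_node {a b : Fin 3 → ℝ} (hab : a 0 * b 1 - a 1 * b 0 ≠ 0)
    {z v : Fin 2 → ℝ} {α β : ℝ} (hα : α ≠ 0) (hβ : β ≠ 0)
    (hz : ∀ i : Fin 2, z i - v i = α * a i.castSucc + β * b i.castSucc)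
    (hva : eval v (affineForm a) = 0) (hvb : eval v (affineForm b) = 0)
    (hbis : α ^ 2 * (a 0 ^ 2 + a 1 ^ 2) - β ^ 2 * (b 0 ^ 2 + b 1 ^ 2) ≠ 0)
    {P H : MvPolynomial (Fin 2) ℝ} (hP : eval v P ≠ 0) (hH : eval v H = -(α * β * eval v P)) :
    ∃ p q, IsFootPath (affineForm a * (affineForm b * P)) H z v p ∧
      IsFootPath (affineForm a * (affineForm b * P)) H z v q ∧
      ∀ᶠ ε in 𝓝[>] (0 : ℝ),
        (p ε 0 - z 0) * (q ε 1 - z 1) - (p ε 1 - z 1) * (q ε 0 - z 0) ≠ 0 := by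
  have hz0 : z 0 - v 0 = α * a 0 + β * b 0 := hz 0
  have hz1 : z 1 - v 1 = α * a 1 + β * b 1 := hz 1
  set D := a 0 * b 1 - a 1 * b 0 with hD
  -- `dir (s, t)` is the vector on which the linear parts of `a` and `b` take the values `s` and
  -- `t`. With `ε = δ ^ 2` and the point `v + δ * dir (s, t)`, the equation of the curve is `δ ^ 2 *
  -- A` and its gradient is `δ * N`, so both problems extend to `δ = 0`.
  let dir : ℝ × ℝ → Fin 2 → ℝ := fun x =>
    ![(x.1 * b 1 - x.2 * a 1) / D, (x.2 * a 0 - x.1 * b 0) / D]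
  have hdir : Continuous dir := by
    refine continuous_pi fun i => ?_
    fin_cases i <;> simp [dir] <;> fun_prop
  let pt : ℝ × ℝ × ℝ → Fin 2 → ℝ := fun x =>
    ![v 0 + x.1 * ((x.2.1 * b 1 - x.2.2 * a 1) / D), v 1 + x.1 * ((x.2.2 * a 0 - x.2.1 * b 0) / D)]
  have hpt : ContDiff ℝ 1 pt := by
    refine contDiff_pi.2 fun i => ?_
    fin_cases i <;> simp [pt] <;> fun_prop
  have hptdir : ∀ x i, pt x i = v i + x.1 * dir x.2 i := by
    intro x i
    fin_cases i <;> simp [pt, dir]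
  have hev : ∀ Q : MvPolynomial (Fin 2) ℝ, ContDiff ℝ 1 fun x => eval (pt x) Q := fun Q =>
    (contDiff_eval Q).comp hpt
  have hla : ∀ x, eval (pt x) (affineForm a) = x.1 * x.2.1 := by
    intro x
    rw [eval_affineForm] at hva ⊢
    simp only [pt, Matrix.cons_val_zero, Matrix.cons_val_one]
    have h1 : a 0 * ((x.2.1 * b 1 - x.2.2 * a 1) / D) + a 1 * ((x.2.2 * a 0 - x.2.1 * b 0) / D) =
        x.2.1 := by
      field_simp
      rw [hD]; ring
    linear_combination hva + x.1 * h1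
  have hlb : ∀ x, eval (pt x) (affineForm b) = x.1 * x.2.2 := by
    intro x
    rw [eval_affineForm] at hvb ⊢
    simp only [pt, Matrix.cons_val_zero, Matrix.cons_val_one]
    have h1 : b 0 * ((x.2.1 * b 1 - x.2.2 * a 1) / D) + b 1 * ((x.2.2 * a 0 - x.2.1 * b 0) / D) =
        x.2.2 := by
      field_simp
      rw [hD]; ring
    linear_combination hvb + x.1 * h1
  let N : Fin 2 → ℝ × ℝ × ℝ → ℝ := fun k x =>
    (x.2.2 * a k.castSucc + x.2.1 * b k.castSucc) * eval (pt x) P +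
      x.1 * (x.2.1 * x.2.2 * eval (pt x) (pderiv k P) + eval (pt x) (pderiv k H))
  have hN : ∀ k, ContDiff ℝ 1 (N k) := by
    intro k
    have h1 := hev P
    have h2 := hev (pderiv k P)
    have h3 := hev (pderiv k H)
    fun_prop
  let A : ℝ × ℝ × ℝ → ℝ := fun x => x.2.1 * x.2.2 * eval (pt x) P + eval (pt x) H
  let B : ℝ × ℝ × ℝ → ℝ := fun x => (z 0 - pt x 0) * N 1 x - (z 1 - pt x 1) * N 0 x
  have hA : ContDiff ℝ 1 A := by
    have h1 := hev P
    have h2 := hev H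
    fun_prop
  have hB : ContDiff ℝ 1 B := by
    have h1 := hN 0
    have h2 := hN 1
    have h3 : ContDiff ℝ 1 fun x => pt x 0 := contDiff_pi.1 hpt 0
    have h4 : ContDiff ℝ 1 fun x => pt x 1 := contDiff_pi.1 hpt 1
    fun_prop
  have hpt0 : ∀ s t, pt (0, s, t) = v := by
    intro s t
    ext i; fin_cases i <;> simp [pt]
  have hN0 : ∀ k s t, N k (0, s, t) = (t * a k.castSucc + s * b k.castSucc) * eval v P := by
    intro k s t
    simp only [N, hpt0, zero_mul, add_zero]
  have hA0 : ∀ s t, A (0, s, t) = s * t * eval v P + eval v H := by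
    intro s t
    simp only [A, hpt0]
  -- In the limit the gradient is a multiple of `t * a + s * b`, which is parallel to `z - v = α * a
  -- + β * b` when `α * s = β * t`.
  have hB0 : ∀ s t, B (0, s, t) = (α * s - β * t) * (eval v P * D) := by
    intro s t
    simp only [B, hN0, hpt0, Fin.castSucc_zero, Fin.castSucc_one, hz0, hz1, hD]
    ring
  have hgrad : ∀ (δ : ℝ) (y : ℝ × ℝ) (k : Fin 2), eval (pt (δ, y))
      (pderiv k (affineForm a * (affineForm b * P) + C (δ ^ 2) * H)) = δ * N k (δ, y) := by
    intro δ y k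
    simp only [map_add, pderiv_mul, pderiv_C, map_mul, eval_C, hla, hlb, pderiv_affineForm, N,
      zero_mul, zero_add]
    ring
  -- By the choice of `H` at `v` the limit equations are `s * t = α * β` and `α * s = β * t`, with
  -- the two solutions `σ * (β, α)`, `σ = ±1`. The Jacobian there is nonzero because `α` and `β`
  -- are.
  have key : ∀ σ : ℝ, σ * σ = 1 → ∃ q : ℝ → ℝ × ℝ, Tendsto q (𝓝 0) (𝓝 (σ * β, σ * α)) ∧
      ∀ᶠ δ in 𝓝 0, A (δ, q δ) = 0 ∧ B (δ, q δ) = 0 := by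
    intro σ hσ
    have hσ0 : σ ≠ 0 := by rintro rfl; simp at hσ
    refine exists_tendsto_zeros hA hB (as := σ * α * eval v P) (at' := σ * β * eval v P)
      (bs := α * (eval v P * D)) (bt := -β * (eval v P * D)) ?_ ?_ ?_ ?_ ?_ ?_ ?_
    · rw [hA0, hH]
      linear_combination α * β * eval v P * hσ
    · rw [hB0]
      ring
    · simp only [hA0]
      simpa using (((hasDerivAt_id' (σ * β)).mul_const (σ * α)).mul_const (eval v P)).add_const
        (eval v H)
    · simp only [hA0]
      simpa using (((hasDerivAt_id' (σ * α)).const_mul (σ * β)).mul_const (eval v P)).add_const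
        (eval v H)
    · simp only [hB0]
      simpa using (((hasDerivAt_id' (σ * β)).const_mul α).sub_const (β * (σ * α))).mul_const
        (eval v P * D)
    · simp only [hB0]
      simpa using (((hasDerivAt_id' (σ * α)).const_mul β).const_sub (α * (σ * β))).mul_const
        (eval v P * D)
    · have : σ * α * eval v P * (-β * (eval v P * D)) - σ * β * eval v P * (α * (eval v P * D)) =
          -2 * σ * α * β * eval v P ^ 2 * D := by ring
      rw [this]
      have h2 : (-2 : ℝ) ≠ 0 := by norm_num
      positivity
  have hsqrt : Tendsto Real.sqrt (𝓝[>] 0) (𝓝 0) := by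
    have := (Real.continuous_sqrt.tendsto 0).mono_left (nhdsWithin_le_nhds (s := Set.Ioi (0 : ℝ)))
    rwa [Real.sqrt_zero] at this
  have path : ∀ (σ : ℝ), σ * σ = 1 → ∀ q : ℝ → ℝ × ℝ, Tendsto q (𝓝 0) (𝓝 (σ * β, σ * α)) →
      (∀ᶠ δ in 𝓝 0, A (δ, q δ) = 0 ∧ B (δ, q δ) = 0) →
      IsFootPath (affineForm a * (affineForm b * P)) H z v
        fun ε => pt (Real.sqrt ε, q (Real.sqrt ε)) := by
    intro σ hσ q hq hq0
    have hσ0 : σ ≠ 0 := by rintro rfl; simp at hσ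
    have hlim : Tendsto (fun δ => (δ, q δ)) (𝓝 0) (𝓝 ((0 : ℝ), σ * β, σ * α)) :=
      tendsto_id.prodMk_nhds hq
    refine ⟨?_, ?_⟩
    · have := ((hpt.continuous.tendsto _).comp hlim).comp hsqrt
      rwa [hpt0] at this
    · have hne : ∃ k, N k (0, σ * β, σ * α) ≠ 0 := by
        by_contra! hall
        have h0 := hall 0
        have h1 := hall 1
        rw [hN0] at h0 h1
        have h0' := (mul_eq_zero.1 h0).resolve_right hP
        have h1' := (mul_eq_zero.1 h1).resolve_right hP
        simp only [Fin.castSucc_zero, Fin.castSucc_one] at h0' h1'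
        have : σ * α * D = 0 := by rw [hD]; linear_combination b 1 * h0' - b 0 * h1'
        exact mul_ne_zero (mul_ne_zero hσ0 hα) hab this
      obtain ⟨k, hk⟩ := hne
      have hNk : ∀ᶠ δ in 𝓝 (0 : ℝ), N k (δ, q δ) ≠ 0 :=
        (((hN k).continuous.tendsto _).comp hlim).eventually_ne hk
      filter_upwards [hsqrt.eventually hq0, hsqrt.eventually hNk, self_mem_nhdsWithin]
        with ε hε hεk hpos
      have hpos' : 0 < ε := hpos
      have hsq : ε = Real.sqrt ε ^ 2 := (Real.sq_sqrt hpos'.le).symm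
      have hs0 : Real.sqrt ε ≠ 0 := (Real.sqrt_pos.2 hpos').ne'
      generalize Real.sqrt ε = δ at *
      subst hsq
      refine ⟨?_, ?_, normalVector_ne_zero_iff.2 ⟨k, ?_⟩⟩
      · have := hε.1
        simp only [map_add, map_mul, eval_C, hla, hlb]
        simp only [A] at this
        linear_combination δ ^ 2 * this
      · rw [eval_footPoly, hgrad, hgrad]
        have := hε.2
        simp only [B] at this
        linear_combination δ * this
      · rw [hgrad]
        exact mul_ne_zero hs0 hεk
  obtain ⟨q₁, hq₁, hq₁'⟩ := key 1 (by norm_num)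
  obtain ⟨q₂, hq₂, hq₂'⟩ := key (-1) (by norm_num)
  refine ⟨_, _, path 1 (by norm_num) q₁ hq₁ hq₁', path (-1) (by norm_num) q₂ hq₂ hq₂', ?_⟩
  -- Both feet tend to `v`, so their wedge tends to zero. Since `(p - z) ∧ (q - z) = (p - q) ∧ (q -
  -- z)` and `p - q` is divisible by `δ`, the wedge is `δ * W`; the limit of `W` is nonzero as long
  -- as `z` is off the bisectors of the two lines.
  let W : ℝ × (ℝ × ℝ) × ℝ × ℝ → ℝ := fun x =>
    (dir x.2.1 0 - dir x.2.2 0) * (pt (x.1, x.2.2) 1 - z 1) -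
      (dir x.2.1 1 - dir x.2.2 1) * (pt (x.1, x.2.2) 0 - z 0)
  have hW : Continuous W := by
    have h1 : ∀ i, Continuous fun y => dir y i := fun i => (continuous_apply i).comp hdir
    have h2 : ∀ i, Continuous fun y => pt y i := fun i =>
      (continuous_apply i).comp hpt.continuous
    have h3 := h1 0
    have h4 := h1 1
    have h5 := h2 0
    have h6 := h2 1
    fun_prop
  have hW0 : W (0, (1 * β, 1 * α), (-1 * β, -1 * α)) ≠ 0 := by
    have : W (0, (1 * β, 1 * α), (-1 * β, -1 * α)) =
        2 * (α ^ 2 * (a 0 ^ 2 + a 1 ^ 2) - β ^ 2 * (b 0 ^ 2 + b 1 ^ 2)) / D := by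
      simp only [W, hpt0, dir, Matrix.cons_val_zero, Matrix.cons_val_one]
      rw [← neg_sub (z 0), ← neg_sub (z 1), hz0, hz1]
      field_simp
      ring
    rw [this]
    exact div_ne_zero (mul_ne_zero two_ne_zero hbis) hab
  have hlimW : Tendsto (fun δ => (δ, q₁ δ, q₂ δ)) (𝓝 0)
      (𝓝 ((0 : ℝ), (1 * β, 1 * α), (-1 * β, -1 * α))) :=
    tendsto_id.prodMk_nhds (hq₁.prodMk_nhds hq₂)
  filter_upwards [hsqrt.eventually (((hW.tendsto _).comp hlimW).eventually_ne hW0),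
    self_mem_nhdsWithin] with ε hε hpos
  have hs0 : Real.sqrt ε ≠ 0 := (Real.sqrt_pos.2 hpos).ne'
  generalize Real.sqrt ε = δ at *
  have hε' : W (δ, q₁ δ, q₂ δ) ≠ 0 := hε
  intro h0
  apply mul_ne_zero hs0 hε'
  rw [← h0]
  simp only [W, hptdir]
  ring

end LocalFeet

/-! ### Generic arrangements and general points -/

section GeneralPosition

theorem linePoly_eq_affineForm (l : Fin 3 → ℝ) : linePoly l = affineForm l := rfl

/-- The lines `y = i * x - i ^ 2` are tangents to the parabola `4 * y = x ^ 2`. Lines `i` and `j`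
meet at `x = i + j`, so lines `j` and `k` meet line `i` at different points. -/
theorem exists_isGenericArrangement (d : ℕ) : ∃ L : Fin d → Fin 3 → ℝ, IsGenericArrangement L := by
  have hne : ∀ i j : Fin d, i ≠ j → ((i : ℕ) : ℝ) - ((j : ℕ) : ℝ) ≠ 0 := by
    intro i j hij h
    exact hij (Fin.ext (by exact_mod_cast sub_eq_zero.1 h))
  refine ⟨fun i => ![((i : ℕ) : ℝ), -1, -((i : ℕ) : ℝ) ^ 2], fun i => Or.inr (by simp), ?_, ?_⟩
  · intro i j hij
    simp only [Matrix.cons_val_zero, Matrix.cons_val_one]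
    have := hne j i hij.symm
    intro h
    apply this
    linear_combination h
  · rintro i j k hij hik hjk v ⟨hi, hj, hk⟩
    rw [linePoly_eq_affineForm, eval_affineForm] at hi hj hk
    simp only [Matrix.cons_val_zero, Matrix.cons_val_one, Matrix.cons_val] at hi hj hk
    have h1 : v 0 - ((i : ℕ) : ℝ) - ((j : ℕ) : ℝ) = 0 := by
      refine (mul_eq_zero.1 (?_ : (((i : ℕ) : ℝ) - ((j : ℕ) : ℝ)) * _ = 0)).resolve_left
        (hne i j hij)
      linear_combination hi - hj
    have h2 : v 0 - ((i : ℕ) : ℝ) - ((k : ℕ) : ℝ) = 0 := by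
      refine (mul_eq_zero.1 (?_ : (((i : ℕ) : ℝ) - ((k : ℕ) : ℝ)) * _ = 0)).resolve_left
        (hne i k hik)
      linear_combination hi - hk
    exact hne j k hjk (by linear_combination h2 - h1)

/-- The intersection point of two lines that are not parallel. -/
def nodePoint (a b : Fin 3 → ℝ) : Fin 2 → ℝ :=
  ![(a 1 * b 2 - b 1 * a 2) / (a 0 * b 1 - a 1 * b 0),
    (a 2 * b 0 - a 0 * b 2) / (a 0 * b 1 - a 1 * b 0)]

theorem eval_nodePoint_left {a b : Fin 3 → ℝ} (h : a 0 * b 1 - a 1 * b 0 ≠ 0) :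
    eval (nodePoint a b) (affineForm a) = 0 := by
  rw [eval_affineForm]
  simp only [nodePoint, Matrix.cons_val_zero, Matrix.cons_val_one]
  field_simp
  ring

theorem eval_nodePoint_right {a b : Fin 3 → ℝ} (h : a 0 * b 1 - a 1 * b 0 ≠ 0) :
    eval (nodePoint a b) (affineForm b) = 0 := by
  rw [eval_affineForm]
  simp only [nodePoint, Matrix.cons_val_zero, Matrix.cons_val_one, div_eq_mul_inv]
  linear_combination -b 2 * mul_inv_cancel₀ h

theorem eq_nodePoint {a b : Fin 3 → ℝ} (h : a 0 * b 1 - a 1 * b 0 ≠ 0) {v : Fin 2 → ℝ}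
    (ha : eval v (affineForm a) = 0) (hb : eval v (affineForm b) = 0) : v = nodePoint a b := by
  rw [eval_affineForm] at ha hb
  ext i
  fin_cases i
  · change v 0 = (a 1 * b 2 - b 1 * a 2) / (a 0 * b 1 - a 1 * b 0)
    rw [eq_div_iff h]
    linear_combination b 1 * ha - a 1 * hb
  · change v 1 = (a 2 * b 0 - a 0 * b 2) / (a 0 * b 1 - a 1 * b 0)
    rw [eq_div_iff h]
    linear_combination a 0 * hb - b 0 * ha

/-- The polynomial whose value at `z` is the determinant of `z - v` and the direction of `u`. -/
def wedgePoly (v : Fin 2 → ℝ) (x y : ℝ) : MvPolynomial (Fin 2) ℝ :=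
  (X 0 - C (v 0)) * C y - (X 1 - C (v 1)) * C x

theorem eval_wedgePoly (v z : Fin 2 → ℝ) (x y : ℝ) :
    eval z (wedgePoly v x y) = (z 0 - v 0) * y - (z 1 - v 1) * x := by
  simp [wedgePoly]

theorem wedgePoly_ne_zero (v : Fin 2 → ℝ) {x y : ℝ} (h : x ^ 2 + y ^ 2 ≠ 0) :
    wedgePoly v x y ≠ 0 := by
  intro h0
  have := eval_wedgePoly v ![v 0 + y, v 1 - x] x y
  rw [h0, map_zero] at this
  simp only [Matrix.cons_val_zero, Matrix.cons_val_one] at this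
  exact h (by linear_combination -this)

variable {d : ℕ} {L : Fin d → Fin 3 → ℝ}

theorem IsGenericArrangement.sq_add_sq_ne_zero (hL : IsGenericArrangement L) (i : Fin d) :
    L i 0 ^ 2 + L i 1 ^ 2 ≠ 0 := by
  rcases hL.isLine i with h | h <;> positivity

/-- The squared bisectors of two lines through `v`. -/
def bisectorPoly (v : Fin 2 → ℝ) (a b : Fin 3 → ℝ) : MvPolynomial (Fin 2) ℝ :=
  wedgePoly v (b 0) (b 1) ^ 2 * C (a 0 ^ 2 + a 1 ^ 2) -
    wedgePoly v (a 0) (a 1) ^ 2 * C (b 0 ^ 2 + b 1 ^ 2)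

theorem bisectorPoly_ne_zero (v : Fin 2 → ℝ) {a b : Fin 3 → ℝ}
    (h : a 0 * b 1 - a 1 * b 0 ≠ 0) (ha : a 0 ^ 2 + a 1 ^ 2 ≠ 0) : bisectorPoly v a b ≠ 0 := by
  intro h0
  -- At `v + a` the second term vanishes and the first is the squared determinant times `a 0 ^ 2 + a
  -- 1 ^ 2`.
  have h1 := congrArg (eval ![v 0 + a 0, v 1 + a 1]) h0
  simp only [bisectorPoly, map_sub, map_mul, map_pow, eval_wedgePoly, eval_C, map_zero,
    Matrix.cons_val_zero, Matrix.cons_val_one] at h1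
  refine mul_ne_zero (pow_ne_zero 2 h) ha ?_
  linear_combination h1

/-- A point `z` in general position with respect to the arrangement. -/
structure IsGeneralPoint (L : Fin d → Fin 3 → ℝ) (z : Fin 2 → ℝ) : Prop where
  not_mem_line : ∀ i, eval z (affineForm (L i)) ≠ 0
  -- For `k = i, j` this makes both normal coordinates of `z` at the node nonzero and keeps
  -- perpendicular feet away from nodes. In general it separates, as seen from `z`, a node from the
  -- perpendicular foot on any line.
  not_perp : ∀ i j k, i ≠ j →
    eval z (wedgePoly (nodePoint (L i) (L j)) (L k 0) (L k 1)) ≠ 0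
  not_bisector : ∀ i j, i ≠ j → eval z (bisectorPoly (nodePoint (L i) (L j)) (L i) (L j)) ≠ 0
  not_collinear : ∀ i j k l, nodePoint (L i) (L j) ≠ nodePoint (L k) (L l) →
    eval z (wedgePoly (nodePoint (L i) (L j))
      (nodePoint (L k) (L l) 0 - nodePoint (L i) (L j) 0)
      (nodePoint (L k) (L l) 1 - nodePoint (L i) (L j) 1)) ≠ 0

/-- Zero members are replaced by `1` in the product. This allows index sets with degenerate members,
such as pairs `i = j` or coinciding nodes. -/
theorem exists_eval_ne_zero_of_ne_zero {ι : Type*} [Fintype ι] (Q : ι → MvPolynomial (Fin 2) ℝ) :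
    ∃ z, ∀ i, Q i ≠ 0 → eval z (Q i) ≠ 0 := by
  classical
  have h : ∏ i, (if Q i = 0 then 1 else Q i) ≠ 0 := by
    rw [Finset.prod_ne_zero_iff]
    intro i _
    split_ifs with hi
    · exact one_ne_zero
    · exact hi
  obtain ⟨z, hz⟩ : ∃ z, eval z (∏ i, (if Q i = 0 then 1 else Q i)) ≠ 0 := by
    by_contra! hall
    exact h (MvPolynomial.funext fun z => by rw [hall, map_zero])
  rw [map_prod, Finset.prod_ne_zero_iff] at hz
  refine ⟨z, fun i hi => ?_⟩
  have := hz i (Finset.mem_univ i)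
  rwa [if_neg hi] at this

theorem IsGenericArrangement.exists_isGeneralPoint (hL : IsGenericArrangement L) :
    ∃ z, IsGeneralPoint L z := by
  obtain ⟨z, hz⟩ := exists_eval_ne_zero_of_ne_zero
    (ι := Fin d ⊕ (Fin d × Fin d × Fin d) ⊕ (Fin d × Fin d) ⊕ (Fin d × Fin d × Fin d × Fin d))
    (Sum.elim (fun i => affineForm (L i)) (Sum.elim
      (fun x => wedgePoly (nodePoint (L x.1) (L x.2.1)) (L x.2.2 0) (L x.2.2 1)) (Sum.elim
      (fun x => bisectorPoly (nodePoint (L x.1) (L x.2)) (L x.1) (L x.2))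
      (fun x => wedgePoly (nodePoint (L x.1) (L x.2.1))
        (nodePoint (L x.2.2.1) (L x.2.2.2) 0 - nodePoint (L x.1) (L x.2.1) 0)
        (nodePoint (L x.2.2.1) (L x.2.2.2) 1 - nodePoint (L x.1) (L x.2.1) 1)))))
  refine ⟨z, fun i => hz (Sum.inl i) ?_, fun i j k _ => hz (Sum.inr (Sum.inl (i, j, k))) ?_,
    fun i j hij => hz (Sum.inr (Sum.inr (Sum.inl (i, j)))) ?_,
    fun i j k l hne => hz (Sum.inr (Sum.inr (Sum.inr (i, j, k, l)))) ?_⟩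
  · change affineForm (L i) ≠ 0
    intro h0
    have h1 := congrArg (pderiv 0) h0
    have h2 := congrArg (pderiv 1) h0
    rw [pderiv_affineForm_zero, map_zero, C_eq_zero] at h1
    rw [pderiv_affineForm_one, map_zero, C_eq_zero] at h2
    rcases hL.isLine i with h | h
    · exact h h1
    · exact h h2
  · exact wedgePoly_ne_zero _ (hL.sq_add_sq_ne_zero k)
  · exact bisectorPoly_ne_zero _ (hL.not_parallel i j hij) (hL.sq_add_sq_ne_zero i)
  · refine wedgePoly_ne_zero _ fun h => hne ?_
    have h0 : nodePoint (L k) (L l) 0 - nodePoint (L i) (L j) 0 = 0 := by nlinarith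
    have h1 : nodePoint (L k) (L l) 1 - nodePoint (L i) (L j) 1 = 0 := by nlinarith
    ext m
    fin_cases m
    · exact (sub_eq_zero.1 h0).symm
    · exact (sub_eq_zero.1 h1).symm

end GeneralPosition

/-! ### The admissible smoothing and its `d ^ 2` feet -/

section Smoothing

variable {d : ℕ} {L : Fin d → Fin 3 → ℝ} {z : Fin 2 → ℝ}

/-- The product of the equations of all lines but the `i`-th and the `j`-th. -/
def otherLines (L : Fin d → Fin 3 → ℝ) (i j : Fin d) : MvPolynomial (Fin 2) ℝ :=
  ∏ k ∈ (Finset.univ.erase i).erase j, affineForm (L k)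

theorem prod_eq_mul_otherLines (L : Fin d → Fin 3 → ℝ) {i j : Fin d} (hij : i ≠ j) :
    ∏ k, affineForm (L k) = affineForm (L i) * (affineForm (L j) * otherLines L i j) := by
  rw [otherLines, Finset.mul_prod_erase _ (fun k => affineForm (L k))
    (Finset.mem_erase.2 ⟨hij.symm, Finset.mem_univ j⟩),
    Finset.mul_prod_erase _ (fun k => affineForm (L k)) (Finset.mem_univ i)]

theorem IsGenericArrangement.eval_otherLines_ne_zero (hL : IsGenericArrangement L) {i j : Fin d}
    (hij : i ≠ j) : eval (nodePoint (L i) (L j)) (otherLines L i j) ≠ 0 := by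
  rw [otherLines, map_prod, Finset.prod_ne_zero_iff]
  intro k hk h0
  have hkj := Finset.ne_of_mem_erase hk
  have hki := Finset.ne_of_mem_erase (Finset.mem_of_mem_erase hk)
  exact hL.not_concurrent i j k hij hki.symm hkj.symm _
    ⟨eval_nodePoint_left (hL.not_parallel i j hij),
      eval_nodePoint_right (hL.not_parallel i j hij), h0⟩

/-- There are polynomials of degree less than `d` with given values at the nodes. -/
theorem IsGenericArrangement.exists_smoothing_term (hL : IsGenericArrangement L) (hd : 1 ≤ d)
    (c : Fin d → Fin d → ℝ) :
    ∃ H : MvPolynomial (Fin 2) ℝ, H.totalDegree < d ∧ ∀ i j, i < j →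
      eval (nodePoint (L i) (L j)) H =
        c i j * eval (nodePoint (L i) (L j)) (otherLines L i j) := by
  classical
  -- Lagrange interpolation: the product of all lines but two vanishes at every node except the
  -- intersection of those two.
  refine ⟨∑ x ∈ (Finset.univ : Finset (Fin d × Fin d)).filter (fun x => x.1 < x.2),
    C (c x.1 x.2) * otherLines L x.1 x.2, ?_, ?_⟩
  · refine lt_of_le_of_lt (totalDegree_finsetSum_le (d := d - 1) fun x _ => ?_) (by omega)
    refine (totalDegree_mul _ _).trans ?_
    rw [totalDegree_C, zero_add]
    refine (totalDegree_prod_affineForm_le _ _).trans ((Finset.card_erase_le).trans ?_)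
    rw [Finset.card_erase_of_mem (Finset.mem_univ _), Finset.card_univ, Fintype.card_fin]
  · intro i j hij
    rw [map_sum, Finset.sum_eq_single (i, j)]
    · rw [map_mul, eval_C]
    · rintro ⟨k, l⟩ hkl hne
      simp only [Finset.mem_filter, Finset.mem_univ, true_and] at hkl
      have hmem : i ∈ (Finset.univ.erase k).erase l ∨ j ∈ (Finset.univ.erase k).erase l := by
        simp only [Finset.mem_erase, Finset.mem_univ, and_true]
        by_contra! h
        have h1 := h.1
        have h2 := h.2
        apply hne
        by_cases hil : i = l
        · subst hil
          by_cases hjl : j = i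
          · exact absurd hjl hij.ne'
          · have := h2 hjl
            omega
        · have hik := h1 hil
          by_cases hjl : j = l
          · rw [hik, hjl]
          · have := h2 hjl
            omega
      rw [map_mul, otherLines, map_prod]
      refine mul_eq_zero_of_right _ ?_
      rcases hmem with h | h
      · exact Finset.prod_eq_zero h (eval_nodePoint_left (hL.not_parallel i j hij.ne))
      · exact Finset.prod_eq_zero h (eval_nodePoint_right (hL.not_parallel i j hij.ne))
    · intro h
      simp [hij] at h

/-- The coordinate of `z - v` along the normal of the line `a`, in the basis of normals of `a` and
`b`, where `v` is the intersection of the two lines. -/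
def normalCoord (a b : Fin 3 → ℝ) (z : Fin 2 → ℝ) : ℝ :=
  eval z (wedgePoly (nodePoint a b) (b 0) (b 1)) / (a 0 * b 1 - a 1 * b 0)

/-- The coordinate of `z - v` along the normal of the line `b`. -/
def normalCoord' (a b : Fin 3 → ℝ) (z : Fin 2 → ℝ) : ℝ :=
  - eval z (wedgePoly (nodePoint a b) (a 0) (a 1)) / (a 0 * b 1 - a 1 * b 0)

theorem sub_nodePoint_eq {a b : Fin 3 → ℝ} (h : a 0 * b 1 - a 1 * b 0 ≠ 0) (z : Fin 2 → ℝ)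
    (k : Fin 2) : z k - nodePoint a b k =
      normalCoord a b z * a k.castSucc + normalCoord' a b z * b k.castSucc := by
  simp only [normalCoord, normalCoord', eval_wedgePoly, div_eq_mul_inv]
  generalize nodePoint a b = v
  fin_cases k
  · simp only [Fin.zero_eta, Fin.castSucc_zero]
    linear_combination -(z 0 - v 0) * mul_inv_cancel₀ h
  · simp only [Fin.mk_one, Fin.castSucc_one]
    linear_combination -(z 1 - v 1) * mul_inv_cancel₀ h

/-- The oriented area of the parallelogram spanned by `x - z` and `y - z`. -/
def wedge (z x y : Fin 2 → ℝ) : ℝ := (x 0 - z 0) * (y 1 - z 1) - (x 1 - z 1) * (y 0 - z 0)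

theorem wedge_swap (z x y : Fin 2 → ℝ) : wedge z y x = - wedge z x y := by
  simp only [wedge]
  ring

theorem eventually_wedge_ne_zero {p q : ℝ → Fin 2 → ℝ} {F : Filter ℝ} {x y : Fin 2 → ℝ}
    (hp : Tendsto p F (𝓝 x)) (hq : Tendsto q F (𝓝 y)) (h : wedge z x y ≠ 0) :
    ∀ᶠ ε in F, wedge z (p ε) (q ε) ≠ 0 := by
  have hc : Continuous fun r : (Fin 2 → ℝ) × (Fin 2 → ℝ) => wedge z r.1 r.2 := by
    unfold wedge
    fun_prop
  exact ((hc.tendsto (x, y)).comp (hp.prodMk_nhds hq)).eventually_ne h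

/-- The foot of the perpendicular from `z` to the line `l`. -/
def perpFoot (l : Fin 3 → ℝ) (z : Fin 2 → ℝ) : Fin 2 → ℝ := fun k =>
  z k - eval z (affineForm l) / (l 0 ^ 2 + l 1 ^ 2) * l k.castSucc

theorem eval_perpFoot {l : Fin 3 → ℝ} (h : l 0 ^ 2 + l 1 ^ 2 ≠ 0) (z : Fin 2 → ℝ) :
    eval (perpFoot l z) (affineForm l) = 0 := by
  rw [eval_affineForm]
  simp only [perpFoot, Fin.castSucc_zero, Fin.castSucc_one, eval_affineForm]
  field_simp
  ring

variable (L z) in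
/-- The limit positions of the feet of normals through `z`. -/
def footLimit (x : Fin d × Fin d) : Fin 2 → ℝ :=
  -- Diagonal indices stand for the lines; `(i, j)` and `(j, i)` stand for the two feet at one node.
  if x.1 = x.2 then perpFoot (L x.1) z
  else nodePoint (L (min x.1 x.2)) (L (max x.1 x.2))

/-- Different limit points lie in different directions from `z`, an open condition that persists for
small `ε`. Only the two feet at the same node are excluded here; they are separated in
`exists_isFootPath_node`. -/
theorem wedge_footLimit_ne_zero (hL : IsGenericArrangement L) (hz : IsGeneralPoint L z)
    {x y : Fin d × Fin d} (hxy : x ≠ y) (hswap : x ≠ y.swap) :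
    wedge z (footLimit L z x) (footLimit L z y) ≠ 0 := by
  have hκ : ∀ i, eval z (affineForm (L i)) / (L i 0 ^ 2 + L i 1 ^ 2) ≠ 0 := fun i =>
    div_ne_zero (hz.not_mem_line i) (hL.sq_add_sq_ne_zero i)
  have hlines : ∀ i k, i ≠ k → wedge z (perpFoot (L i) z) (perpFoot (L k) z) ≠ 0 := by
    intro i k hik
    have := mul_ne_zero (mul_ne_zero (hκ i) (hκ k)) (hL.not_parallel i k hik)
    convert this using 1
    simp only [wedge, perpFoot, Fin.castSucc_zero, Fin.castSucc_one]
    ring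
  have hmixed : ∀ i j k, i ≠ j → wedge z (nodePoint (L i) (L j)) (perpFoot (L k) z) ≠ 0 := by
    intro i j k hij
    have := mul_ne_zero (hκ k) (hz.not_perp i j k hij)
    convert this using 1
    rw [eval_wedgePoly]
    simp only [wedge, perpFoot, Fin.castSucc_zero, Fin.castSucc_one]
    ring
  have hnodes : ∀ i j k l, i ≠ j → k ≠ l → (k ≠ i ∧ k ≠ j) ∨ (l ≠ i ∧ l ≠ j) →
      wedge z (nodePoint (L i) (L j)) (nodePoint (L k) (L l)) ≠ 0 := by
    intro i j k l hij hkl hor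
    have hne : nodePoint (L i) (L j) ≠ nodePoint (L k) (L l) := by
      intro heq
      have h1 := eval_nodePoint_left (hL.not_parallel i j hij)
      have h2 := eval_nodePoint_right (hL.not_parallel i j hij)
      have h3 := eval_nodePoint_left (hL.not_parallel k l hkl)
      have h4 := eval_nodePoint_right (hL.not_parallel k l hkl)
      rw [← heq] at h3 h4
      rcases hor with h | h
      · exact hL.not_concurrent i j k hij h.1.symm h.2.symm _ ⟨h1, h2, h3⟩
      · exact hL.not_concurrent i j l hij h.1.symm h.2.symm _ ⟨h1, h2, h4⟩
    have := hz.not_collinear i j k l hne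
    rw [eval_wedgePoly] at this
    intro h0
    apply this
    simp only [wedge] at h0
    linear_combination -h0
  obtain ⟨i, j⟩ := x
  obtain ⟨k, l⟩ := y
  simp only [ne_eq, Prod.mk.injEq, Prod.swap_prod_mk] at hxy hswap
  have hmm : ∀ i j : Fin d, i ≠ j → min i j ≠ max i j := fun i j h => by
    rcases lt_or_gt_of_ne h with h' | h'
    · rwa [min_eq_left h'.le, max_eq_right h'.le]
    · rw [min_eq_right h'.le, max_eq_left h'.le]
      exact h'.ne
  simp only [footLimit]
  split_ifs with h1 h2 h2
  · exact hlines i k fun h => hxy ⟨h, by rw [← h1, h, h2]⟩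
  · rw [wedge_swap]
    exact neg_ne_zero.2 (hmixed _ _ _ (hmm k l h2))
  · exact hmixed _ _ _ (hmm i j h1)
  · refine hnodes _ _ _ _ (hmm i j h1) (hmm k l h2) ?_
    rcases lt_or_gt_of_ne h1 with h | h <;> rcases lt_or_gt_of_ne h2 with h' | h' <;>
      simp only [min_eq_left h.le, max_eq_right h.le, min_eq_right h.le, max_eq_left h.le,
        min_eq_left h'.le, max_eq_right h'.le, min_eq_right h'.le, max_eq_left h'.le] <;> omega

/-- For small `ε`, the smoothing has `d ^ 2` feet of real normals through `z`. -/
theorem exists_footPaths (hL : IsGenericArrangement L) (hz : IsGeneralPoint L z)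
    {H : MvPolynomial (Fin 2) ℝ}
    (hH : ∀ i j, i < j → eval (nodePoint (L i) (L j)) H =
      -(normalCoord (L i) (L j) z * normalCoord' (L i) (L j) z) *
        eval (nodePoint (L i) (L j)) (otherLines L i j)) :
    ∃ P : Fin d × Fin d → ℝ → Fin 2 → ℝ,
      (∀ x, IsFootPath (∏ k, affineForm (L k)) H z (footLimit L z x) (P x)) ∧
      ∀ x y, x ≠ y → ∀ᶠ ε in 𝓝[>] (0 : ℝ), wedge z (P x ε) (P y ε) ≠ 0 := by
  have hline : ∀ i, ∃ p, IsFootPath (∏ k, affineForm (L k)) H z (perpFoot (L i) z) p := by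
    intro i
    rw [← Finset.mul_prod_erase _ (fun k => affineForm (L k)) (Finset.mem_univ i)]
    refine exists_isFootPath_line (hL.sq_add_sq_ne_zero i)
      (κ := eval z (affineForm (L i)) / (L i 0 ^ 2 + L i 1 ^ 2)) (fun k => ?_)
      (eval_perpFoot (hL.sq_add_sq_ne_zero i) z) ?_
    · simp only [perpFoot]
      ring
    -- If the foot were on another line it would be a node, and `z` would lie on the perpendicular
    -- through this node, against `not_perp`.
    · rw [map_prod, Finset.prod_ne_zero_iff]
      intro k hk h0
      have hik : i ≠ k := (Finset.ne_of_mem_erase hk).symm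
      have heq := eq_nodePoint (hL.not_parallel i k hik)
        (eval_perpFoot (hL.sq_add_sq_ne_zero i) z) h0
      apply hz.not_perp i k i hik
      rw [← heq, eval_wedgePoly]
      simp only [perpFoot, Fin.castSucc_zero, Fin.castSucc_one]
      ring
  have hnode : ∀ i j, i < j → ∃ p q,
      IsFootPath (∏ k, affineForm (L k)) H z (nodePoint (L i) (L j)) p ∧
      IsFootPath (∏ k, affineForm (L k)) H z (nodePoint (L i) (L j)) q ∧
      ∀ᶠ ε in 𝓝[>] (0 : ℝ), wedge z (p ε) (q ε) ≠ 0 := by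
    intro i j hij
    have hD := hL.not_parallel i j hij.ne
    rw [prod_eq_mul_otherLines L hij.ne]
    refine exists_isFootPath_node hD (α := normalCoord (L i) (L j) z)
      (β := normalCoord' (L i) (L j) z) (div_ne_zero (hz.not_perp i j j hij.ne) hD)
      (div_ne_zero (neg_ne_zero.2 (hz.not_perp i j i hij.ne)) hD)
      (sub_nodePoint_eq hD z) (eval_nodePoint_left hD) (eval_nodePoint_right hD) ?_
      (hL.eval_otherLines_ne_zero hij.ne) (by rw [hH i j hij]; ring)
    have := div_ne_zero (hz.not_bisector i j hij.ne) (pow_ne_zero 2 hD)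
    convert this using 1
    simp only [bisectorPoly, map_sub, map_mul, map_pow, eval_C, normalCoord, normalCoord']
    field_simp
  choose p₀ hp₀ using hline
  choose! p q hp hq hpq using hnode
  let P : Fin d × Fin d → ℝ → Fin 2 → ℝ := fun x =>
    if x.1 = x.2 then p₀ x.1 else if x.1 < x.2 then p x.1 x.2 else q x.2 x.1
  have hP : ∀ x, IsFootPath (∏ k, affineForm (L k)) H z (footLimit L z x) (P x) := by
    rintro ⟨i, j⟩
    simp only [P, footLimit]
    split_ifs with h1 h2
    · exact hp₀ i
    · rw [min_eq_left h2.le, max_eq_right h2.le]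
      exact hp i j h2
    · have h3 : j < i := lt_of_le_of_ne (not_lt.1 h2) (Ne.symm h1)
      rw [min_eq_right h3.le, max_eq_left h3.le]
      exact hq j i h3
  refine ⟨P, hP, fun x y hxy => ?_⟩
  by_cases hswap : x = y.swap
  · subst hswap
    obtain ⟨i, j⟩ := y
    have hij : i ≠ j := by
      rintro rfl
      exact hxy rfl
    rcases lt_or_gt_of_ne hij with h | h
    · have h1 : P (i, j) = p i j := by simp only [P]; rw [if_neg hij, if_pos h]
      have h2 : P (j, i) = q i j := by simp only [P]; rw [if_neg hij.symm, if_neg h.asymm]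
      rw [Prod.swap_prod_mk, h1, h2]
      filter_upwards [hpq i j h] with ε hε
      rw [wedge_swap]
      exact neg_ne_zero.2 hε
    · have h1 : P (j, i) = p j i := by simp only [P]; rw [if_neg hij.symm, if_pos h]
      have h2 : P (i, j) = q j i := by simp only [P]; rw [if_neg hij, if_neg h.asymm]
      rw [Prod.swap_prod_mk, h1, h2]
      exact hpq j i h
  · exact eventually_wedge_ne_zero (hP x).1 (hP y).1 (wedge_footLimit_ne_zero hL hz hxy hswap)

theorem isAdmissibleAt_of_isFootPath {H : MvPolynomial (Fin 2) ℝ} {v : Fin 2 → ℝ}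
    {p q : ℝ → Fin 2 → ℝ} (hp : IsFootPath (∏ k, affineForm (L k)) H z v p)
    (hq : IsFootPath (∏ k, affineForm (L k)) H z v q)
    (hpq : ∀ᶠ ε in 𝓝[>] (0 : ℝ), wedge z (p ε) (q ε) ≠ 0) : IsAdmissibleAt L H z v := by
  intro U hU
  filter_upwards [hp.1.eventually_mem hU, hq.1.eventually_mem hU, hp.2, hq.2, hpq]
    with ε hpU hqU hp' hq' hw
  exact ⟨p ε, hpU, q ε, hqU, Projectivization.mk ℝ _ hp'.2.2,
    (IsFeetSystem.mem_pencil_mk_iff hp'.2.2).2 hp'.2.1, Projectivization.mk ℝ _ hq'.2.2,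
    (IsFeetSystem.mem_pencil_mk_iff hq'.2.2).2 hq'.2.1,
    IsFeetSystem.normal_injective hp'.2.2 hq'.2.2 hp'.2.1 hw,
    ⟨hp'.1, hp'.2.2, rfl⟩, ⟨hq'.1, hq'.2.2, rfl⟩⟩

/-- Every generic arrangement has an admissible smoothing with `d ^ 2` real normals through a
point. -/
theorem IsGenericArrangement.exists_admissible (hL : IsGenericArrangement L) (hd : 1 ≤ d) :
    ∃ z : Fin 2 → ℝ, (∀ i, eval z (linePoly (L i)) ≠ 0) ∧
      ∃ H : MvPolynomial (Fin 2) ℝ, IsAdmissibleSmoothing L H z ∧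
      ∀ᶠ ε in 𝓝[>] (0 : ℝ), ∃ P, IsFeetSystem L (C ε * H) z P := by
  obtain ⟨z, hz⟩ := hL.exists_isGeneralPoint
  -- The value at a node is minus the product of the normal coordinates of `z`, times the other
  -- lines: the value for which both limit feet `±(β, α)` are real.
  obtain ⟨H, hHdeg, hH⟩ := hL.exists_smoothing_term hd fun i j =>
    -(normalCoord (L i) (L j) z * normalCoord' (L i) (L j) z)
  obtain ⟨P, hP, hPw⟩ := exists_footPaths hL hz hH
  have hnode : ∀ v ∈ nodes L, ∃ i j, i < j ∧ v = nodePoint (L i) (L j) := by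
    rintro v ⟨i, j, hij, hi, hj⟩
    rcases lt_or_gt_of_ne hij with h | h
    · exact ⟨i, j, h, eq_nodePoint (hL.not_parallel i j hij) hi hj⟩
    · exact ⟨j, i, h, eq_nodePoint (hL.not_parallel j i hij.symm) hj hi⟩
  refine ⟨z, hz.not_mem_line, H, ⟨hHdeg.le, ?_, ?_⟩, ?_⟩
  · intro v hv
    obtain ⟨i, j, hij, rfl⟩ := hnode v hv
    have hD := hL.not_parallel i j hij.ne
    rw [hH i j hij]
    refine mul_ne_zero (neg_ne_zero.2 (mul_ne_zero ?_ ?_)) (hL.eval_otherLines_ne_zero hij.ne)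
    · exact div_ne_zero (hz.not_perp i j j hij.ne) hD
    · exact div_ne_zero (neg_ne_zero.2 (hz.not_perp i j i hij.ne)) hD
  · intro v hv
    obtain ⟨i, j, hij, rfl⟩ := hnode v hv
    have h1 := hP (i, j)
    have h2 := hP (j, i)
    simp only [footLimit] at h1 h2
    rw [if_neg hij.ne, min_eq_left hij.le, max_eq_right hij.le] at h1
    rw [if_neg hij.ne', min_eq_right hij.le, max_eq_left hij.le] at h2
    exact isAdmissibleAt_of_isFootPath h1 h2
      (hPw (i, j) (j, i) fun h => hij.ne (congrArg Prod.fst h))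
  · have hw : ∀ᶠ ε in 𝓝[>] (0 : ℝ), ∀ x y, x ≠ y → wedge z (P x ε) (P y ε) ≠ 0 := by
      rw [eventually_all]
      intro x
      rw [eventually_all]
      intro y
      by_cases hxy : x = y
      · exact Eventually.of_forall fun ε h => absurd hxy h
      · filter_upwards [hPw x y hxy] with ε hε _
        exact hε
    filter_upwards [eventually_all.2 fun x => (hP x).2, hw] with ε hε hwε
    refine ⟨fun x => P x ε, hL.not_parallel, hL.sq_add_sq_ne_zero, ?_, fun x => (hε x).1,
      fun x => (hε x).2.1, fun x => (hε x).2.2, hwε⟩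
    refine lt_of_le_of_lt (totalDegree_mul _ _) ?_
    rwa [totalDegree_C, zero_add]

end Smoothing

end PlaneNormals

end

/-! ### Assembly of the main theorem -/

theorem mainTheorem2 (d : ℕ) (hd : 1 ≤ d) :
    (∃ L : Fin d → Fin 3 → ℝ, PlaneNormals.IsGenericArrangement L) ∧
    (∀ L : Fin d → Fin 3 → ℝ, PlaneNormals.IsGenericArrangement L →
      ∃ z : Fin 2 → ℝ, (∀ i, eval z (PlaneNormals.linePoly (L i)) ≠ 0) ∧
      ∃ H : MvPolynomial (Fin 2) ℝ, PlaneNormals.IsAdmissibleSmoothing L H z ∧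
      ∀ᶠ ε in 𝓝[>] (0 : ℝ), ∀ f : MvPolynomial (Fin 2) ℝ, f = PlaneNormals.smoothing L H ε →
        f.totalDegree = d ∧
        PlaneNormals.IsNonsingular (PlaneNormals.complexify f) ∧
        (PlaneNormals.normalsThrough (PlaneNormals.complexify f)
          (PlaneNormals.toComplex z)).encard = (d : ℕ∞) ^ 2 ∧
        PlaneNormals.AllNormalsReal f z ∧
        PlaneNormals.HasDegree
          (PlaneNormals.curveOfNormals (PlaneNormals.complexify f)) (d ^ 2) ∧
        PlaneNormals.realDegree (PlaneNormals.curveOfNormals f) = (d : ℕ∞) ^ 2) ∧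
    IsGreatest {r : ℕ∞ | ∃ f : MvPolynomial (Fin 2) ℝ, Squarefree f ∧ f.totalDegree = d ∧
      r = PlaneNormals.realDegree (PlaneNormals.curveOfNormals f)} ((d : ℕ∞) ^ 2) := by
  open PlaneNormals in
  refine ⟨exists_isGenericArrangement d, fun L hL => ?_, ?_, ?_⟩
  · obtain ⟨z, hz, H, hH, hP⟩ := hL.exists_admissible hd
    refine ⟨z, hz, H, hH, ?_⟩
    filter_upwards [hP] with ε hε f hf
    obtain ⟨P, hP⟩ := hε
    have hf' : f = ∏ i, affineForm (L i) + C ε * H := hf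
    rw [hf']
    have hC := isFeetSystem_complexify hP
    refine ⟨totalDegree_prod_add hP.not_isotropic hP.totalDegree_lt, ?_, ?_,
      allNormalsReal_of_isFeetSystem hP, ?_, realDegree_eq_of_isFeetSystem hP⟩
    · rw [complexify_prod_add]
      exact hC.isNonsingular
    · rw [complexify_prod_add]
      exact hC.encard_normalsThrough
    · rw [complexify_prod_add]
      exact hC.exists_equation.1
  · obtain ⟨L, hL⟩ := exists_isGenericArrangement d
    obtain ⟨z, -, H, -, hP⟩ := hL.exists_admissible hd
    obtain ⟨ε, P, hP⟩ := hP.exists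
    exact ⟨_, hP.squarefree, totalDegree_prod_add hP.not_isotropic hP.totalDegree_lt,
      (realDegree_eq_of_isFeetSystem hP).symm⟩
  · rintro r ⟨f, -, hfd, rfl⟩
    rw [← hfd]
    exact realDegree_curveOfNormals_le (by omega)
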